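/- Let $A$ be a $C^*$-algebra with multiplier algebra $M(A)$. An endomorphism of $A$ is *extendible* if it extends to a strictly continuous endomorphism of $M(A)$. An *Exel system* $(A,\alpha,L)$ consists of an extendible endomorphism $\alpha$ of $A$ and a positive linear map $L:A\to A$ which extends to a positive linear map $\overline L:M(A)\to M(A)$ such that $L(\alpha(a)m)=a\overline L(m)$ for $a\in A$, $m\in M(A)$, and $\overline L(1)=1$. Let $M_L$ be the right-Hilbert $A$-bimodule obtained by completing $A$ (modulo vectors of length zero) in the bimodule structure $a\cdot m=am$, $m\cdot b=m\alpha(b)$ and the pairing $\langle m,n\rangle=L(m^*n)$; let $q:A\to M_L$ be the canonical map and $\phi:A\to\mathcal L(M_L)$ the left action. Put $M_L^{\otimes 0}=A$ and $M_L^{\otimes(i+1)}=M_L\otimes_A M_L^{\otimes i}$. A representation of $M_L$ in a $C^*$-algebra $B$ is a pair $(\psi,\pi)$ of a linear map $\psi:M_L\to B$ and a homomorphism $\pi:A\to B$ with $\psi(m\cdot a)=\psi(m)\pi(a)$, $\psi(m)^*\psi(n)=\pi(\langle m,n\rangle)$ and $\psi(a\cdot m)=\pi(a)\psi(m)$; it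 induces linear maps $\psi^{\otimes i}:M_L^{\otimes i}\to B$ with $\psi^{\otimes 0}=\pi$ and $\psi^{\otimes(i+1)}(m\otimes_A n)=\psi(m)\psi^{\otimes i}(n)$, and a homomorphism $(\psi,\pi)^{(1)}:\mathcal K(M_L)\to B$ with $(\psi,\pi)^{(1)}(\Theta_{m,n})=\psi(m)\psi(n)^*$. Let $J$ be a (closed two-sided) ideal of $A$ contained in $\phi^{-1}(\mathcal K(M_L))$, let $\mathcal O(J,M_L)$ be the relative Cuntz–Pimsner algebra, that is, the $C^*$-algebra generated by a representation $(k_M,k_A)$ universal for the representations which are coisometric on $J$, i.e. satisfy $\pi|_J=(\psi,\pi)^{(1)}\circ\phi|_J$, and let $\gamma:\mathbb T\to\operatorname{Aut}\mathcal O(J,M_L)$ be the gauge action, with $\gamma_z(k_A(a))=k_A(a)$ and $\gamma_z(k_M(m))=zk_M(m)$. For an endomorphism $\beta$ of a $C^*$-algebra $C$, a *Stacey-covariant representation* of $(C,\beta)$ in $B$ consists of a nondegenerate homomorphism $\pi:C\to B$ and an isometry $V\in M(B)$ with $\pi(\beta(c))=V\pi(c)V^*$; the Stacey crossed product $C\times_\beta\mathbb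 N$ is generated by a universal Stacey-covariant representation $(i_C,v)$, and $\pi\times V$ is the homomorphism with $(\pi\times V)\circ i_C=\pi$ and $(\pi\times V)(v)=V$. **Theorem.** Let $(A,\alpha,L)$ be an Exel system and $J$ an ideal of $A$ contained in $\phi^{-1}(\mathcal K(M_L))$. There is a unique isometry $V\in M(\mathcal O(J,M_L))$ such that $k_M(q(a))=k_A(a)V$ for all $a\in A$, and $\operatorname{Ad}V:T\mapsto VTV^*$ restricts to an endomorphism $\alpha'$ of the core $C_J:=\mathcal O(J,M_L)^\gamma$ such that $$\alpha'\big(k_M^{\otimes i}(a\cdot m)\,k_M^{\otimes i}(b\cdot n)^*\big)=k_M^{\otimes(i+1)}(q(\alpha(a))\otimes_A m)\,k_M^{\otimes(i+1)}(q(\alpha(b))\otimes_A n)^*$$ for $i\ge 0$, $a,b\in A$ and $m,n\in M_L^{\otimes i}$. Further, $\alpha'$ is extendible with $\overline{\alpha'}(1)=VV^*$, is injective, and has range $\overline{\alpha'}(1)C_J\overline{\alpha'}(1)$. Finally, $(\operatorname{id},V)$ is a Stacey-covariant representation of $(C_J,\alpha')$ in $\mathcal O(J,M_L)$, and $\operatorname{id}\times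 V$ is an isomorphism of the Stacey crossed product $C_J\times_{\alpha'}\mathbb N$ onto $\mathcal O(J,M_L)$. -/

import Mathlib

open scoped MultiplierAlgebra TensorProduct ENNReal

universe u v w

set_option linter.unusedSectionVars false

noncomputable section

namespace ExelStacey

/-- A criterion for positivity of a self-adjoint element in terms of its compressions. -/
lemma exists_compression {M : Type*} [NonUnitalCStarAlgebra M] (X : M) (hX : IsSelfAdjoint X) :
    ∃ Y Z : M, star Y = Y ∧ Y * X * Y + star Z * Z = 0 ∧
      (Z = 0 → ∃ T : M, X = star T * T) := by
  let _ := CStarAlgebra.spectralOrder M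
  have := CStarAlgebra.spectralOrderedRing M
  have hn : 0 ≤ X⁻ := CFC.negPart_nonneg X
  have hs : star X⁻ = X⁻ := (IsSelfAdjoint.of_nonneg hn).star_eq
  have h3 : 0 ≤ X⁻ * X⁻ * X⁻ := by
    have := star_left_conjugate_nonneg hn X⁻
    rwa [hs] at this
  obtain ⟨Z, hZ⟩ := CStarAlgebra.nonneg_iff_eq_star_mul_self.1 h3
  refine ⟨X⁻, Z, hs, ?_, fun h0 => ?_⟩
  · rw [← hZ]
    conv_lhs => enter [1, 1, 2]; rw [← CFC.posPart_sub_negPart X hX]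
    rw [mul_sub, CFC.negPart_mul_posPart, zero_sub, neg_mul, neg_add_cancel]
  · have h : X⁻ = 0 := by
      rw [h0, mul_zero] at hZ
      have h4 : star (X⁻ * X⁻) * (X⁻ * X⁻) = 0 := by
        rw [star_mul, hs, ← mul_assoc, hZ, zero_mul]
      rw [CStarRing.star_mul_self_eq_zero_iff] at h4
      have h5 : star X⁻ * X⁻ = 0 := by rw [hs, h4]
      exact CStarRing.star_mul_self_eq_zero_iff _ |>.1 h5
    have : 0 ≤ X := by
      rw [← CFC.posPart_sub_negPart X hX, h, sub_zero]
      exact CFC.posPart_nonneg X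
    exact CStarAlgebra.nonneg_iff_eq_star_mul_self.1 this

section Correspondences

variable (A : Type u) [NonUnitalCStarAlgebra A] [PartialOrder A] [StarOrderedRing A]

/-- A right pre-Hilbert bimodule over the C⋆-algebra `A`: a complex `A`-bimodule with a positive
semidefinite right `A`-linear pairing `⟨x, y⟩` for which the left action is by adjointable maps.
`lact a x` is `a · x` and `ract a x` is `x · a`. -/
structure PreBimodule where
  carrier : Type u
  [addCommGroup : AddCommGroup carrier]
  [module : Module ℂ carrier]
  inner : carrier →ₗ⋆[ℂ] carrier →ₗ[ℂ] A
  lact : A →ₗ[ℂ] carrier →ₗ[ℂ] carrier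
  ract : A →ₗ[ℂ] carrier →ₗ[ℂ] carrier
  lact_mul : ∀ a b x, lact (a * b) x = lact a (lact b x)
  ract_mul : ∀ a b x, ract (a * b) x = ract b (ract a x)
  lact_ract : ∀ a b x, lact a (ract b x) = ract b (lact a x)
  star_inner : ∀ x y, star (inner x y) = inner y x
  inner_self_nonneg : ∀ x, 0 ≤ inner x x
  inner_ract : ∀ a x y, inner x (ract a y) = inner x y * a
  inner_lact : ∀ a x y, inner (lact a x) y = inner x (lact (star a) y)

/-- A right-Hilbert bimodule over the C⋆-algebra `A` (also called a C⋆-correspondence): a right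
Hilbert `A`-module with a left action of `A` by adjointable operators.
`lact a x` is `a · x` and `ract a x` is `x · a`. Mathlib's `CStarModule` is not used, because its
inner product is linear for a left action. -/
structure HilbertBimodule where
  carrier : Type u
  [normedAddCommGroup : NormedAddCommGroup carrier]
  [normedSpace : NormedSpace ℂ carrier]
  [completeSpace : CompleteSpace carrier]
  inner : carrier →ₗ⋆[ℂ] carrier →ₗ[ℂ] A
  lact : A →ₗ[ℂ] carrier →L[ℂ] carrier
  ract : A →ₗ[ℂ] carrier →L[ℂ] carrier
  lact_mul : ∀ a b x, lact (a * b) x = lact a (lact b x)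
  ract_mul : ∀ a b x, ract (a * b) x = ract b (ract a x)
  lact_ract : ∀ a b x, lact a (ract b x) = ract b (lact a x)
  star_inner : ∀ x y, star (inner x y) = inner y x
  inner_self_nonneg : ∀ x, 0 ≤ inner x x
  inner_ract : ∀ a x y, inner x (ract a y) = inner x y * a
  inner_lact : ∀ a x y, inner (lact a x) y = inner x (lact (star a) y)
  norm_sq : ∀ x, ‖x‖ ^ 2 = ‖inner x x‖

variable {A}

attribute [instance] PreBimodule.addCommGroup PreBimodule.module
  HilbertBimodule.normedAddCommGroup HilbertBimodule.normedSpace HilbertBimodule.completeSpace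

namespace PreBimodule

variable (P : PreBimodule A)

lemma inner_ract_left (a : A) (x y : P.carrier) :
    P.inner (P.ract a x) y = star a * P.inner x y := by
  rw [← P.star_inner, P.inner_ract, star_mul, P.star_inner]

lemma real_smul_inner (r : ℝ) (x y : P.carrier) :
    P.inner ((r : ℂ) • x) y = r • P.inner x y := by
  rw [LinearMap.map_smulₛₗ, LinearMap.smul_apply, Complex.conj_ofReal, Complex.coe_smul]

lemma inner_real_smul (r : ℝ) (x y : P.carrier) :
    P.inner x ((r : ℂ) • y) = r • P.inner x y := by
  simp

lemma norm_inner_sq_le (x y : P.carrier) :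
    ‖P.inner x y‖ ^ 2 ≤ ‖P.inner x x‖ * ‖P.inner y y‖ := by
  have key : ∀ r : ℝ, ‖P.inner x x‖ < r → ‖P.inner x y‖ ^ 2 ≤ r * ‖P.inner y y‖ := by
    intro r hr
    have hr0 : 0 < r := (norm_nonneg _).trans_lt hr
    set a := P.inner x y with ha
    have h0 := P.inner_self_nonneg (P.ract a x - (r : ℂ) • y)
    have h1 : P.inner (P.ract a x - (r : ℂ) • y) (P.ract a x - (r : ℂ) • y)
        = star a * P.inner x x * a - (2 * r) • (star a * a) + (r * r) • P.inner y y := by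
      have e : P.inner y x = star a := by rw [ha, P.star_inner]
      simp only [map_sub, LinearMap.sub_apply, P.inner_real_smul, P.real_smul_inner,
        P.inner_ract, P.inner_ract_left, e, ← ha, smul_smul, two_mul, add_smul,
        mul_assoc]
      abel
    have h2 : star a * P.inner x x * a ≤ r • (star a * a) := by
      refine (CStarAlgebra.star_left_conjugate_le_norm_smul
        (IsSelfAdjoint.of_nonneg (P.inner_self_nonneg x))).trans ?_
      exact smul_le_smul_of_nonneg_right hr.le (star_mul_self_nonneg a)
    have h3 : r • (star a * a) ≤ r • (r • P.inner y y) := by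
      rw [h1] at h0
      have h4 : 0 ≤ r • (star a * a) - (2 * r) • (star a * a) + (r * r) • P.inner y y :=
        h0.trans (by gcongr)
      rw [← sub_nonneg]
      convert h4 using 1
      rw [two_mul, add_smul, smul_smul]
      abel
    have h5 : star a * a ≤ r • P.inner y y := (smul_le_smul_iff_of_pos_left hr0).1 h3
    have h6 := CStarAlgebra.norm_le_norm_of_nonneg_of_le (star_mul_self_nonneg a) h5
    rw [CStarRing.norm_star_mul_self, norm_smul, Real.norm_of_nonneg hr0.le] at h6
    nlinarith
  refine ge_of_tendsto (x := nhdsWithin ‖P.inner x x‖ (Set.Ioi _))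
    (f := fun r : ℝ => r * ‖P.inner y y‖) ?_ (Filter.eventually_of_mem self_mem_nhdsWithin key)
  exact ((continuous_mul_const _).tendsto _).mono_left nhdsWithin_le_nhds

instance : Norm P.carrier := ⟨fun x => √‖P.inner x x‖⟩

lemma norm_def (x : P.carrier) : ‖x‖ = √‖P.inner x x‖ := rfl

lemma norm_sq (x : P.carrier) : ‖x‖ ^ 2 = ‖P.inner x x‖ := Real.sq_sqrt (norm_nonneg _)

lemma norm_nonneg' (x : P.carrier) : 0 ≤ ‖x‖ := Real.sqrt_nonneg _

lemma norm_inner_le (x y : P.carrier) : ‖P.inner x y‖ ≤ ‖x‖ * ‖y‖ := by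
  refine le_of_sq_le_sq ?_ (mul_nonneg (P.norm_nonneg' x) (P.norm_nonneg' y))
  rw [mul_pow, P.norm_sq, P.norm_sq]
  exact P.norm_inner_sq_le x y

lemma core : SeminormedSpace.Core ℂ P.carrier where
  norm_nonneg := P.norm_nonneg'
  norm_smul c x := by
    refine (sq_eq_sq₀ (P.norm_nonneg' _) (mul_nonneg (norm_nonneg _) (P.norm_nonneg' x))).1 ?_
    rw [mul_pow, P.norm_sq, P.norm_sq]
    simp [norm_smul, sq, mul_assoc]
  norm_triangle x y := by
    refine le_of_sq_le_sq ?_ (add_nonneg (P.norm_nonneg' x) (P.norm_nonneg' y))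
    rw [P.norm_sq]
    simp only [map_add, LinearMap.add_apply]
    have h1 := P.norm_inner_le x y
    have h2 := P.norm_inner_le y x
    have h3 := P.norm_sq x
    have h4 := P.norm_sq y
    calc _ ≤ ‖P.inner x x‖ + ‖P.inner y x‖ + (‖P.inner x y‖ + ‖P.inner y y‖) :=
          (norm_add_le _ _).trans (add_le_add (norm_add_le _ _) (norm_add_le _ _))
      _ ≤ _ := by nlinarith

instance : SeminormedAddCommGroup P.carrier := SeminormedAddCommGroup.ofCore P.core

instance : NormedSpace ℂ P.carrier  where
  norm_smul_le r x := (P.core.norm_smul r x).le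

/-- For `h = a⋆a` and `t = ‖a‖` there is a self-adjoint `d` in `A` with `(t - d)² = t² - h`. -/
lemma exists_sqrt_defect (a : A) :
    ∃ d : A, star d = d ∧ (2 * ‖a‖) • d - d * d = star a * a := by
  set t := ‖a‖
  set h := star a * a with hh
  have hpos : 0 ≤ h := star_mul_self_nonneg a
  have hsa : IsSelfAdjoint h := IsSelfAdjoint.of_nonneg hpos
  let f : ℝ → ℝ := fun s => t - √(t ^ 2 - s)
  have hf : Continuous f := by fun_prop
  have hf0 : f 0 = 0 := by simp [f, t]
  refine ⟨cfcₙ f h, (cfcₙ_predicate (R := ℝ) f h).star_eq, ?_⟩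
  rw [← cfcₙ_mul f f h, ← cfcₙ_smul (2 * t) f h, ← cfcₙ_sub _ _ h]
  conv_rhs => rw [← cfcₙ_id ℝ h]
  refine cfcₙ_congr fun s hs => ?_
  have hs' : s ≤ t ^ 2 := by
    have := NonUnitalIsometricContinuousFunctionalCalculus.norm_quasispectrum_le (𝕜 := ℝ) h hs
    rw [hh, CStarRing.norm_star_mul_self] at this
    exact (le_abs_self s).trans (this.trans (sq t).ge)
  have := Real.sq_sqrt (sub_nonneg.2 hs')
  simp only [f, smul_eq_mul, id]
  nlinarith

lemma norm_lact_le (a : A) (x : P.carrier) : ‖P.lact a x‖ ≤ ‖a‖ * ‖x‖ := by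
  obtain ⟨d, hd, hda⟩ := exists_sqrt_defect a
  have h0 := P.inner_self_nonneg ((‖a‖ : ℂ) • x - P.lact d x)
  have h1 : P.inner ((‖a‖ : ℂ) • x - P.lact d x) ((‖a‖ : ℂ) • x - P.lact d x)
      = (‖a‖ ^ 2) • P.inner x x - P.inner (P.lact a x) (P.lact a x) := by
    rw [P.inner_lact a, ← P.lact_mul, ← hda]
    simp only [map_sub, LinearMap.sub_apply, P.inner_real_smul, P.real_smul_inner,
      P.inner_lact, hd, ← P.lact_mul]
    have : P.lact ((2 * ‖a‖) • d) x = ((2 * ‖a‖ : ℝ) : ℂ) • P.lact d x := by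
      rw [← Complex.coe_smul, map_smul]; rfl
    rw [this, P.inner_real_smul, sq, mul_smul, two_mul, add_smul]
    abel
  rw [h1, sub_nonneg] at h0
  have h2 := CStarAlgebra.norm_le_norm_of_nonneg_of_le (P.inner_self_nonneg _) h0
  rw [norm_smul, ← P.norm_sq, ← P.norm_sq, norm_pow, norm_norm, ← mul_pow] at h2
  exact le_of_sq_le_sq h2 (by positivity)

lemma norm_ract_le (a : A) (x : P.carrier) : ‖P.ract a x‖ ≤ ‖a‖ * ‖x‖ := by
  refine le_of_sq_le_sq ?_ (by positivity)
  rw [P.norm_sq, P.inner_ract, P.inner_ract_left, mul_pow, P.norm_sq]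
  calc _ ≤ ‖star a‖ * ‖P.inner x x‖ * ‖a‖ :=
        (norm_mul_le _ _).trans (by gcongr; exact norm_mul_le _ _)
    _ = _ := by rw [norm_star]; ring

/-- `a · x` as a continuous operator. -/
def lactL (a : A) : P.carrier →L[ℂ] P.carrier :=
  (P.lact a).mkContinuous ‖a‖ (P.norm_lact_le a)

/-- `x · a` as a continuous operator. -/
def ractL (a : A) : P.carrier →L[ℂ] P.carrier :=
  (P.ract a).mkContinuous ‖a‖ (P.norm_ract_le a)

/-- The continuous extension of a continuous linear map to the completion. -/
def ext {F : Type*} [NormedAddCommGroup F] [NormedSpace ℂ F] [CompleteSpace F]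
    (f : P.carrier →L[ℂ] F) : UniformSpace.Completion P.carrier →L[ℂ] F :=
  f.extend (UniformSpace.Completion.toComplL (𝕜 := ℂ))

lemma ext_coe {F : Type*} [NormedAddCommGroup F] [NormedSpace ℂ F] [CompleteSpace F]
    (f : P.carrier →L[ℂ] F) (x : P.carrier) :
    P.ext f (x : UniformSpace.Completion P.carrier) = f x :=
  f.extend_eq (e := UniformSpace.Completion.toComplL (𝕜 := ℂ))
    UniformSpace.Completion.denseRange_coe (UniformSpace.Completion.isUniformInducing_coe _) x

/-- The left action on the completion. -/
def lactC (a : A) :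
    UniformSpace.Completion P.carrier →L[ℂ] UniformSpace.Completion P.carrier :=
  P.ext ((UniformSpace.Completion.toComplL (𝕜 := ℂ)).comp (P.lactL a))

/-- The right action on the completion. -/
def ractC (a : A) :
    UniformSpace.Completion P.carrier →L[ℂ] UniformSpace.Completion P.carrier :=
  P.ext ((UniformSpace.Completion.toComplL (𝕜 := ℂ)).comp (P.ractL a))

lemma lactC_coe (a : A) (x : P.carrier) :
    P.lactC a (x : UniformSpace.Completion P.carrier) = (P.lact a x : P.carrier) :=
  P.ext_coe _ x

lemma ractC_coe (a : A) (x : P.carrier) :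
    P.ractC a (x : UniformSpace.Completion P.carrier) = (P.ract a x : P.carrier) :=
  P.ext_coe _ x

lemma clm_ext {F : Type*} [NormedAddCommGroup F] [NormedSpace ℂ F]
    {f g : UniformSpace.Completion P.carrier →L[ℂ] F}
    (h : ∀ x : P.carrier, f (x : UniformSpace.Completion P.carrier) = g x) : f = g :=
  ContinuousLinearMap.ext fun x => UniformSpace.Completion.induction_on x
    (isClosed_eq f.continuous g.continuous) h

lemma lactC_add (a b : A) : P.lactC (a + b) = P.lactC a + P.lactC b :=
  P.clm_ext fun x => by
    rw [add_apply, lactC_coe, lactC_coe, lactC_coe, map_add, LinearMap.add_apply,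
      UniformSpace.Completion.coe_add]

lemma lactC_smul (c : ℂ) (a : A) : P.lactC (c • a) = c • P.lactC a :=
  P.clm_ext fun x => by
    rw [smul_apply, lactC_coe, lactC_coe, map_smul, LinearMap.smul_apply,
      UniformSpace.Completion.coe_smul]

lemma ractC_add (a b : A) : P.ractC (a + b) = P.ractC a + P.ractC b :=
  P.clm_ext fun x => by
    rw [add_apply, ractC_coe, ractC_coe, ractC_coe, map_add, LinearMap.add_apply,
      UniformSpace.Completion.coe_add]

lemma ractC_smul (c : ℂ) (a : A) : P.ractC (c • a) = c • P.ractC a :=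
  P.clm_ext fun x => by
    rw [smul_apply, ractC_coe, ractC_coe, map_smul, LinearMap.smul_apply,
      UniformSpace.Completion.coe_smul]

/-- The pairing on the completion. -/
def innerC (x y : UniformSpace.Completion P.carrier) : A :=
  (UniformSpace.Completion.isDenseInducing_coe.prodMap
    UniformSpace.Completion.isDenseInducing_coe).extend
      (fun p : P.carrier × P.carrier => P.inner p.1 p.2) (x, y)

lemma continuous_inner : Continuous fun p : P.carrier × P.carrier => P.inner p.1 p.2 := by
  let f : P.carrier →L⋆[ℂ] P.carrier →L[ℂ] A := LinearMap.mkContinuous₂ P.inner 1 fun x y => by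
    rw [one_mul]; exact P.norm_inner_le x y
  have h : Continuous fun p : P.carrier × P.carrier => f p.1 p.2 :=
    (f.continuous.comp continuous_fst).clm_apply continuous_snd
  exact h

lemma innerC_coe (x y : P.carrier) : P.innerC x y = P.inner x y :=
  (UniformSpace.Completion.isDenseInducing_coe.prodMap
    UniformSpace.Completion.isDenseInducing_coe).extend_eq P.continuous_inner (x, y)

lemma continuous_innerC_pair :
    Continuous fun p : UniformSpace.Completion P.carrier × UniformSpace.Completion P.carrier =>
      P.innerC p.1 p.2 := by
  let inner' : P.carrier →+ P.carrier →+ A :=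
    { toFun := fun x => (P.inner x).toAddMonoidHom
      map_zero' := by ext x; simp
      map_add' := fun x y => by ext z; simp }
  have : Continuous fun p : P.carrier × P.carrier => inner' p.1 p.2 := P.continuous_inner
  exact (UniformSpace.Completion.isDenseInducing_toCompl P.carrier).extend_Z_bilin
    (UniformSpace.Completion.isDenseInducing_toCompl P.carrier) this

@[fun_prop]
lemma continuous_innerC {X : Type*} [TopologicalSpace X]
    {f g : X → UniformSpace.Completion P.carrier}
    (hf : Continuous f) (hg : Continuous g) : Continuous fun x => P.innerC (f x) (g x) :=
  P.continuous_innerC_pair.comp (hf.prodMk hg)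

lemma innerC_add_left (x y z : UniformSpace.Completion P.carrier) :
    P.innerC (x + y) z = P.innerC x z + P.innerC y z := by
  refine UniformSpace.Completion.induction_on₃ x y z (isClosed_eq (by fun_prop) (by fun_prop))
    fun x y z => ?_
  rw [← UniformSpace.Completion.coe_add, innerC_coe, innerC_coe, innerC_coe, map_add,
    LinearMap.add_apply]

lemma innerC_add_right (x y z : UniformSpace.Completion P.carrier) :
    P.innerC x (y + z) = P.innerC x y + P.innerC x z := by
  refine UniformSpace.Completion.induction_on₃ x y z (isClosed_eq (by fun_prop) (by fun_prop))
    fun x y z => ?_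
  rw [← UniformSpace.Completion.coe_add, innerC_coe, innerC_coe, innerC_coe, map_add]

lemma innerC_smul_left (c : ℂ) (x y : UniformSpace.Completion P.carrier) :
    P.innerC (c • x) y = (starRingEnd ℂ c) • P.innerC x y := by
  refine UniformSpace.Completion.induction_on₂ x y (isClosed_eq
    (P.continuous_innerC (continuous_fst.const_smul c) continuous_snd)
    ((P.continuous_innerC continuous_fst continuous_snd).const_smul (starRingEnd ℂ c)))
    fun x y => ?_
  rw [← UniformSpace.Completion.coe_smul, innerC_coe, innerC_coe, LinearMap.map_smulₛₗ,
    LinearMap.smul_apply]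

lemma innerC_smul_right (c : ℂ) (x y : UniformSpace.Completion P.carrier) :
    P.innerC x (c • y) = c • P.innerC x y := by
  refine UniformSpace.Completion.induction_on₂ x y (isClosed_eq
    (P.continuous_innerC continuous_fst (continuous_snd.const_smul c))
    ((P.continuous_innerC continuous_fst continuous_snd).const_smul c))
    fun x y => ?_
  rw [← UniformSpace.Completion.coe_smul, innerC_coe, innerC_coe, map_smul]

/-- The pairing on the completion as a sesquilinear map. -/
def innerS : UniformSpace.Completion P.carrier →ₗ⋆[ℂ] UniformSpace.Completion P.carrier →ₗ[ℂ] A :=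
  LinearMap.mk₂'ₛₗ _ _ P.innerC P.innerC_add_left P.innerC_smul_left P.innerC_add_right
    P.innerC_smul_right

lemma lactC_mul (a b : A) (x : UniformSpace.Completion P.carrier) :
    P.lactC (a * b) x = P.lactC a (P.lactC b x) := by
  refine UniformSpace.Completion.induction_on x (isClosed_eq (by fun_prop) (by fun_prop))
    fun x => ?_
  rw [lactC_coe, lactC_coe, lactC_coe, lact_mul]

lemma ractC_mul (a b : A) (x : UniformSpace.Completion P.carrier) :
    P.ractC (a * b) x = P.ractC b (P.ractC a x) := by
  refine UniformSpace.Completion.induction_on x (isClosed_eq (by fun_prop) (by fun_prop))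
    fun x => ?_
  rw [ractC_coe, ractC_coe, ractC_coe, ract_mul]

lemma lactC_ractC (a b : A) (x : UniformSpace.Completion P.carrier) :
    P.lactC a (P.ractC b x) = P.ractC b (P.lactC a x) := by
  refine UniformSpace.Completion.induction_on x (isClosed_eq (by fun_prop) (by fun_prop))
    fun x => ?_
  rw [lactC_coe, ractC_coe, lactC_coe, ractC_coe, lact_ract]

lemma star_innerC (x y : UniformSpace.Completion P.carrier) :
    star (P.innerC x y) = P.innerC y x := by
  refine UniformSpace.Completion.induction_on₂ x y (isClosed_eq (by fun_prop) (by fun_prop))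
    fun x y => ?_
  rw [innerC_coe, innerC_coe, star_inner]

lemma innerC_self_nonneg (x : UniformSpace.Completion P.carrier) : 0 ≤ P.innerC x x := by
  refine UniformSpace.Completion.induction_on x (isClosed_le (by fun_prop) (by fun_prop))
    fun x => ?_
  rw [innerC_coe]
  exact P.inner_self_nonneg x

lemma innerC_ractC (a : A) (x y : UniformSpace.Completion P.carrier) :
    P.innerC x (P.ractC a y) = P.innerC x y * a := by
  refine UniformSpace.Completion.induction_on₂ x y (isClosed_eq (by fun_prop) (by fun_prop))
    fun x y => ?_
  rw [ractC_coe, innerC_coe, innerC_coe, inner_ract]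

lemma innerC_lactC (a : A) (x y : UniformSpace.Completion P.carrier) :
    P.innerC (P.lactC a x) y = P.innerC x (P.lactC (star a) y) := by
  refine UniformSpace.Completion.induction_on₂ x y (isClosed_eq (by fun_prop) (by fun_prop))
    fun x y => ?_
  rw [lactC_coe, lactC_coe, innerC_coe, innerC_coe, inner_lact]

lemma normC_sq (x : UniformSpace.Completion P.carrier) : ‖x‖ ^ 2 = ‖P.innerC x x‖ := by
  refine UniformSpace.Completion.induction_on x (isClosed_eq (by fun_prop) (by fun_prop))
    fun x => ?_
  rw [innerC_coe, UniformSpace.Completion.norm_coe, P.norm_sq]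

/-- The Hausdorff completion of a right pre-Hilbert bimodule: vectors of length zero are divided
out and the quotient is completed. -/
def completion : HilbertBimodule A where
  carrier := UniformSpace.Completion P.carrier
  inner := P.innerS
  lact := { toFun := P.lactC, map_add' := P.lactC_add, map_smul' := P.lactC_smul }
  ract := { toFun := P.ractC, map_add' := P.ractC_add, map_smul' := P.ractC_smul }
  lact_mul := P.lactC_mul
  ract_mul := P.ractC_mul
  lact_ract := P.lactC_ractC
  star_inner := P.star_innerC
  inner_self_nonneg := P.innerC_self_nonneg
  inner_ract := P.innerC_ractC
  inner_lact := P.innerC_lactC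
  norm_sq := P.normC_sq

/-- The canonical map of a right pre-Hilbert bimodule into its completion. -/
def toCompletion : P.carrier →ₗ[ℂ] P.completion.carrier :=
  (UniformSpace.Completion.toComplL (𝕜 := ℂ)).toLinearMap

end PreBimodule

namespace HilbertBimodule

variable (E F : HilbertBimodule A)

lemma inner_ract_left (a : A) (x y : E.carrier) :
    E.inner (E.ract a x) y = star a * E.inner x y := by
  rw [← E.star_inner, E.inner_ract, star_mul, E.star_inner]

lemma norm_sq_inner_le (x y : E.carrier) : ‖E.inner x y‖ ^ 2 ≤ ‖E.inner x x‖ * ‖E.inner y y‖ :=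
  PreBimodule.norm_inner_sq_le
    { carrier := E.carrier
      inner := E.inner
      lact := (ContinuousLinearMap.coeLM ℂ).comp E.lact
      ract := (ContinuousLinearMap.coeLM ℂ).comp E.ract
      lact_mul := E.lact_mul
      ract_mul := E.ract_mul
      lact_ract := E.lact_ract
      star_inner := E.star_inner
      inner_self_nonneg := E.inner_self_nonneg
      inner_ract := E.inner_ract
      inner_lact := E.inner_lact } x y

/-- The matrix `(⟨m i, m j⟩)` of inner products in a right Hilbert module is positive. -/
lemma gram_eq_star_mul_self {ι : Type} [Fintype ι] [DecidableEq ι] (m : ι → E.carrier) :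
    ∃ T : CStarMatrix ι ι A, ∀ i j, E.inner (m i) (m j) = ∑ k, star (T k i) * T k j := by
  let X : CStarMatrix ι ι A := CStarMatrix.ofMatrix (Matrix.of fun i j => E.inner (m i) (m j))
  have hX : ∀ i j, X i j = E.inner (m i) (m j) := fun i j => rfl
  have hsa : IsSelfAdjoint X := by
    ext i j
    rw [CStarMatrix.star_apply, hX, hX, E.star_inner]
  obtain ⟨Y, Z, hY, hYZ, hT⟩ := exists_compression X hsa
  have hYs : ∀ i j, star (Y j i) = Y i j := fun i j => by
    conv_rhs => rw [← hY]
    rw [CStarMatrix.star_apply]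
  have hZ : Z = 0 := by
    ext k i
    have h1 := congrFun₂ hYZ i i
    have h2 : (Y * X * Y + star Z * Z) i i = (Y * X * Y) i i + (star Z * Z) i i := rfl
    have h3 : (Y * X * Y) i i
        = E.inner (∑ j, E.ract (Y j i) (m j)) (∑ j, E.ract (Y j i) (m j)) := by
      simp only [CStarMatrix.mul_apply, hX, map_sum, LinearMap.sum_apply, E.inner_ract,
        E.inner_ract_left, hYs, Finset.sum_mul]
    have h4 : (star Z * Z) i i = ∑ k, star (Z k i) * Z k i := by
      simp only [CStarMatrix.mul_apply, CStarMatrix.star_apply]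
    rw [h2] at h1
    have h5 : ∑ k, star (Z k i) * Z k i = 0 := by
      refine le_antisymm ?_ (Finset.sum_nonneg fun k _ => star_mul_self_nonneg _)
      have h6 : E.inner (∑ j, E.ract (Y j i) (m j)) (∑ j, E.ract (Y j i) (m j))
          + ∑ k, star (Z k i) * Z k i = 0 := by
        rw [← h3, ← h4]
        exact h1
      exact (le_add_of_nonneg_left (E.inner_self_nonneg _)).trans h6.le
    rw [Finset.sum_eq_zero_iff_of_nonneg fun k _ => star_mul_self_nonneg _] at h5
    exact CStarRing.star_mul_self_eq_zero_iff _ |>.1 (h5 k (Finset.mem_univ k))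
  obtain ⟨T, hT⟩ := hT hZ
  refine ⟨T, fun i j => ?_⟩
  rw [← hX, hT, CStarMatrix.mul_apply]
  simp only [CStarMatrix.star_apply]

/-- The pairing `⟨m ⊗ n, m' ⊗ n'⟩ = ⟨n, ⟨m, m'⟩ · n'⟩` on the algebraic tensor product. -/
def tensorInner : E.carrier ⊗[ℂ] F.carrier →ₗ⋆[ℂ] E.carrier ⊗[ℂ] F.carrier →ₗ[ℂ] A :=
  TensorProduct.lift <| LinearMap.mk₂'ₛₗ (starRingEnd ℂ) (starRingEnd ℂ)
    (fun m n => TensorProduct.lift <| LinearMap.mk₂ ℂ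
      (fun m' n' => F.inner n (F.lact (E.inner m m') n'))
      (fun x y z => by simp only [map_add, add_apply])
      (fun c x y => by simp only [map_smul, smul_apply])
      (fun x y z => by simp only [map_add])
      (fun c x y => by simp only [map_smul]))
    (fun x y z => TensorProduct.ext' fun m' n' => by
      simp [LinearMap.mk₂_apply])
    (fun c x y => TensorProduct.ext' fun m' n' => by
      simp [LinearMap.mk₂_apply])
    (fun x y z => TensorProduct.ext' fun m' n' => by
      simp [LinearMap.mk₂_apply])
    (fun c x y => TensorProduct.ext' fun m' n' => by
      simp [LinearMap.mk₂_apply])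

lemma tensorInner_tmul (m m' : E.carrier) (n n' : F.carrier) :
    E.tensorInner F (m ⊗ₜ n) (m' ⊗ₜ n') = F.inner n (F.lact (E.inner m m') n') := rfl

lemma tensorInner_self_nonneg (x : E.carrier ⊗[ℂ] F.carrier) : 0 ≤ E.tensorInner F x x := by
  obtain ⟨k, m, n, rfl⟩ := TensorProduct.exists_sum_tmul_eq x
  obtain ⟨T, hT⟩ := E.gram_eq_star_mul_self m
  have : E.tensorInner F (∑ j, m j ⊗ₜ n j) (∑ j, m j ⊗ₜ n j)
      = ∑ l, F.inner (∑ j, F.lact (T l j) (n j)) (∑ j, F.lact (T l j) (n j)) := by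
    simp only [map_sum, LinearMap.sum_apply, tensorInner_tmul, hT, sum_apply, F.lact_mul,
      F.inner_lact]
    conv_rhs => rw [Finset.sum_comm]
    exact Finset.sum_congr rfl fun j _ => Finset.sum_comm
  rw [this]
  exact Finset.sum_nonneg fun l _ => F.inner_self_nonneg _

/-- The algebraic tensor product of two right-Hilbert bimodules. The relations
`m · a ⊗ n = m ⊗ a · n` hold up to vectors of length zero. -/
def tensorPre : PreBimodule A where
  carrier := E.carrier ⊗[ℂ] F.carrier
  inner := E.tensorInner F
  lact :=
    { toFun := fun a => (E.lact a).toLinearMap.rTensor F.carrier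
      map_add' := fun a b => by rw [map_add]; exact LinearMap.rTensor_add _ _ _
      map_smul' := fun c a => by rw [map_smul]; exact LinearMap.rTensor_smul _ _ _ }
  ract :=
    { toFun := fun a => (F.ract a).toLinearMap.lTensor E.carrier
      map_add' := fun a b => by rw [map_add]; exact LinearMap.lTensor_add _ _ _
      map_smul' := fun c a => by rw [map_smul]; exact LinearMap.lTensor_smul _ _ _ }
  lact_mul a b x := by
    induction x with
    | zero => simp only [map_zero]
    | add x y hx hy => simp only [map_add, hx, hy]
    | tmul m n => simp [E.lact_mul]
  ract_mul a b x := by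
    induction x with
    | zero => simp only [map_zero]
    | add x y hx hy => simp only [map_add, hx, hy]
    | tmul m n => simp [F.ract_mul]
  lact_ract a b x := by
    induction x with
    | zero => simp only [map_zero]
    | add x y hx hy => simp only [map_add, hx, hy]
    | tmul m n => simp
  star_inner x y := by
    induction x with
    | zero => simp
    | add x x' hx hx' => simp only [map_add, LinearMap.add_apply, star_add, hx, hx']
    | tmul m n =>
      induction y with
      | zero => simp
      | add y y' hy hy' => simp only [map_add, LinearMap.add_apply, star_add, hy, hy']
      | tmul m' n' => rw [tensorInner_tmul, tensorInner_tmul, F.star_inner, F.inner_lact,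
          E.star_inner]
  inner_self_nonneg := E.tensorInner_self_nonneg F
  inner_ract a x y := by
    induction x with
    | zero => simp
    | add x x' hx hx' => simp only [map_add, LinearMap.add_apply, add_mul, hx, hx']
    | tmul m n =>
      induction y with
      | zero => simp
      | add y y' hy hy' => simp only [map_add, add_mul, hy, hy']
      | tmul m' n' =>
        simp only [LinearMap.coe_mk, AddHom.coe_mk, LinearMap.lTensor_tmul,
          ContinuousLinearMap.coe_coe, tensorInner_tmul, F.lact_ract, F.inner_ract]
  inner_lact a x y := by
    induction x with
    | zero => simp
    | add x x' hx hx' => simp only [map_add, LinearMap.add_apply, hx, hx']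
    | tmul m n =>
      induction y with
      | zero => simp
      | add y y' hy hy' => simp only [map_add, hy, hy']
      | tmul m' n' =>
        simp only [LinearMap.coe_mk, AddHom.coe_mk, LinearMap.rTensor_tmul,
          ContinuousLinearMap.coe_coe, tensorInner_tmul, E.inner_lact]

/-- The internal tensor product `E ⊗_A F`. -/
def tensor : HilbertBimodule A := (E.tensorPre F).completion

/-- The elementary tensor `m ⊗_A n`. -/
def tmul (m : E.carrier) (n : F.carrier) : (E.tensor F).carrier :=
  (E.tensorPre F).toCompletion (m ⊗ₜ[ℂ] n : E.carrier ⊗[ℂ] F.carrier)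

variable (A) in
/-- `A` as a right-Hilbert bimodule over itself, with `⟨a, b⟩ = a⋆b`. -/
def self : HilbertBimodule A where
  carrier := A
  inner := LinearMap.mk₂'ₛₗ (starRingEnd ℂ) (RingHom.id ℂ) (fun a b => star a * b)
    (fun x y z => by rw [star_add, add_mul])
    (fun c x y => by rw [star_smul, smul_mul_assoc]; rfl)
    (fun x y z => mul_add _ _ _)
    (fun c x y => by rw [mul_smul_comm]; rfl)
  lact := (ContinuousLinearMap.mul ℂ A).toLinearMap
  ract := (ContinuousLinearMap.mul ℂ A).flip.toLinearMap
  lact_mul a b x := mul_assoc a b x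
  ract_mul a b x := (mul_assoc x a b).symm
  lact_ract a b x := (mul_assoc a x b).symm
  star_inner x y := by
    change star (star x * y) = star y * x
    rw [star_mul, star_star]
  inner_self_nonneg x := star_mul_self_nonneg x
  inner_ract a x y := (mul_assoc _ _ _).symm
  inner_lact a x y := by
    change star (a * x) * y = star x * (star a * y)
    rw [star_mul, mul_assoc]
  norm_sq x := by
    change ‖x‖ ^ 2 = ‖star x * x‖
    rw [CStarRing.norm_star_mul_self, sq]

/-- The tensor powers `E^{⊗ 0} = A` and `E^{⊗ (i + 1)} = E ⊗_A E^{⊗ i}`. -/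
def pow : ℕ → HilbertBimodule A
  | 0 => self A
  | i + 1 => E.tensor (pow i)

lemma norm_inner_le (x y : E.carrier) : ‖E.inner x y‖ ≤ ‖x‖ * ‖y‖ := by
  refine le_of_sq_le_sq ?_ (by positivity)
  rw [mul_pow, E.norm_sq, E.norm_sq]
  exact E.norm_sq_inner_le x y

lemma norm_ract_le (a : A) (x : E.carrier) : ‖E.ract a x‖ ≤ ‖a‖ * ‖x‖ := by
  refine le_of_sq_le_sq ?_ (by positivity)
  rw [E.norm_sq, E.inner_ract, E.inner_ract_left, mul_pow, E.norm_sq]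
  calc _ ≤ ‖star a‖ * ‖E.inner x x‖ * ‖a‖ :=
        (norm_mul_le _ _).trans (by gcongr; exact norm_mul_le _ _)
    _ = _ := by rw [norm_star]; ring

/-- The rank-one operator `Θ_{m, n} : p ↦ m · ⟨n, p⟩`. -/
def rankOne (m n : E.carrier) : E.carrier →L[ℂ] E.carrier :=
  LinearMap.mkContinuous
    { toFun := fun p => E.ract (E.inner n p) m
      map_add' := fun x y => by rw [map_add, map_add, add_apply]
      map_smul' := fun c x => by rw [map_smul, map_smul, smul_apply, RingHom.id_apply] }
    (‖m‖ * ‖n‖) fun p => (E.norm_ract_le _ m).trans <| by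
      have := mul_le_mul_of_nonneg_right (E.norm_inner_le n p) (norm_nonneg m)
      linarith

/-- The compact operators `𝒦(E)`: the closed linear span of the rank-one operators. -/
def compacts : Submodule ℂ (E.carrier →L[ℂ] E.carrier) :=
  (Submodule.span ℂ
    (Set.range fun p : E.carrier × E.carrier => E.rankOne p.1 p.2)).topologicalClosure

lemma rankOne_mem (m n : E.carrier) : E.rankOne m n ∈ E.compacts :=
  Submodule.le_topologicalClosure _ (Submodule.subset_span ⟨(m, n), rfl⟩)

end HilbertBimodule

end Correspondences

section Representations

variable {A : Type u} [NonUnitalCStarAlgebra A] [PartialOrder A] [StarOrderedRing A]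

/-- A representation `(ψ, π)` of a right-Hilbert bimodule `E` in a C⋆-algebra `B`, with the
homomorphism `π : A → B` as a parameter. -/
structure Rep (E : HilbertBimodule A) {B : Type v} [NonUnitalCStarAlgebra B]
    (π : A →⋆ₙₐ[ℂ] B) where
  ψ : E.carrier →ₗ[ℂ] B
  map_ract : ∀ a m, ψ (E.ract a m) = ψ m * π a
  star_mul_map : ∀ m n, star (ψ m) * ψ n = π (E.inner m n)
  map_lact : ∀ a m, ψ (E.lact a m) = π a * ψ m

namespace Rep

variable {E F : HilbertBimodule A} {B : Type v} [NonUnitalCStarAlgebra B] {π : A →⋆ₙₐ[ℂ] B}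

lemma norm_le (r : Rep E π) (m : E.carrier) : ‖r.ψ m‖ ≤ ‖m‖ := by
  refine le_of_sq_le_sq ?_ (norm_nonneg _)
  rw [sq, ← CStarRing.norm_star_mul_self, r.star_mul_map, E.norm_sq]
  exact NonUnitalStarAlgHom.norm_apply_le π _

/-- The linear map `m ⊗ n ↦ ψ(m) ψ'(n)` on the algebraic tensor product. -/
def tensorAlg (r : Rep E π) (r' : Rep F π) : E.carrier ⊗[ℂ] F.carrier →ₗ[ℂ] B :=
  TensorProduct.lift ((LinearMap.mul ℂ B).compl₁₂ r.ψ r'.ψ)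

lemma tensorAlg_tmul (r : Rep E π) (r' : Rep F π) (m : E.carrier) (n : F.carrier) :
    r.tensorAlg r' (m ⊗ₜ n) = r.ψ m * r'.ψ n := rfl

lemma star_mul_tensorAlg (r : Rep E π) (r' : Rep F π) (x y : E.carrier ⊗[ℂ] F.carrier) :
    star (r.tensorAlg r' x) * r.tensorAlg r' y = π (E.tensorInner F x y) := by
  induction x with
  | zero => simp
  | add x x' hx hx' => simp only [map_add, LinearMap.add_apply, star_add, add_mul, hx, hx']
  | tmul m n =>
    induction y with
    | zero => simp
    | add y y' hy hy' => simp only [map_add, mul_add, hy, hy']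
    | tmul m' n' =>
      rw [tensorAlg_tmul, tensorAlg_tmul, HilbertBimodule.tensorInner_tmul, star_mul,
        ← r'.star_mul_map, r'.map_lact, ← r.star_mul_map]
      simp only [mul_assoc]

/-- The continuous linear map `m ⊗ n ↦ ψ(m) ψ'(n)` on the algebraic tensor product. -/
def tensorPreL (r : Rep E π) (r' : Rep F π) : (E.tensorPre F).carrier →L[ℂ] B :=
  LinearMap.mkContinuous (r.tensorAlg r') 1 fun x => by
    rw [one_mul]
    refine le_of_sq_le_sq ?_ (norm_nonneg _)
    rw [sq, ← CStarRing.norm_star_mul_self, PreBimodule.norm_sq]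
    refine (congrArg norm (r.star_mul_tensorAlg r' x x)).le.trans ?_
    exact NonUnitalStarAlgHom.norm_apply_le π _

lemma tensorPreL_apply (r : Rep E π) (r' : Rep F π) (x : E.carrier ⊗[ℂ] F.carrier) :
    r.tensorPreL r' x = r.tensorAlg r' x := rfl

/-- The continuous linear map `m ⊗_A n ↦ ψ(m) ψ'(n)` on the internal tensor product. -/
def tensorL (r : Rep E π) (r' : Rep F π) : (E.tensor F).carrier →L[ℂ] B :=
  (E.tensorPre F).ext (r.tensorPreL r')

lemma tensorL_tmul (r : Rep E π) (r' : Rep F π) (m : E.carrier) (n : F.carrier) :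
    r.tensorL r' (E.tmul F m n) = r.ψ m * r'.ψ n :=
  (E.tensorPre F).ext_coe _ _

lemma tensorL_coe (r : Rep E π) (r' : Rep F π) (x : (E.tensorPre F).carrier) :
    r.tensorL r' ((E.tensorPre F).toCompletion x) = r.tensorAlg r' x :=
  (E.tensorPre F).ext_coe _ _

lemma tensor_induction {p : (E.tensor F).carrier → Prop} (x : (E.tensor F).carrier)
    (hp : IsClosed {x | p x}) (h : ∀ y, p ((E.tensorPre F).toCompletion y)) : p x :=
  UniformSpace.Completion.induction_on x hp h

lemma tensorAlg_ract (r : Rep E π) (r' : Rep F π) (a : A) (x : E.carrier ⊗[ℂ] F.carrier) :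
    r.tensorAlg r' ((F.ract a).toLinearMap.lTensor E.carrier x) = r.tensorAlg r' x * π a := by
  induction x with
  | zero => simp
  | add x y hx hy => simp only [map_add, add_mul, hx, hy]
  | tmul m n =>
    rw [LinearMap.lTensor_tmul, tensorAlg_tmul, tensorAlg_tmul, mul_assoc, ← r'.map_ract]
    rfl

lemma tensorAlg_lact (r : Rep E π) (r' : Rep F π) (a : A) (x : E.carrier ⊗[ℂ] F.carrier) :
    r.tensorAlg r' ((E.lact a).toLinearMap.rTensor F.carrier x) = π a * r.tensorAlg r' x := by
  induction x with
  | zero => simp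
  | add x y hx hy => simp only [map_add, mul_add, hx, hy]
  | tmul m n =>
    rw [LinearMap.rTensor_tmul, tensorAlg_tmul, tensorAlg_tmul, ← mul_assoc, ← r.map_lact]
    rfl

lemma tensorL_ract (r : Rep E π) (r' : Rep F π) (a : A) (x : (E.tensor F).carrier) :
    r.tensorL r' ((E.tensor F).ract a x) = r.tensorL r' x * π a :=
  tensor_induction (p := fun x => r.tensorL r' ((E.tensor F).ract a x) = r.tensorL r' x * π a) x
    (isClosed_eq ((r.tensorL r').continuous.comp ((E.tensor F).ract a).continuous)
      ((r.tensorL r').continuous.mul continuous_const))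
    fun y => (congrArg (r.tensorL r') ((E.tensorPre F).ractC_coe a y)).trans <|
      (r.tensorL_coe r' _).trans <| (r.tensorAlg_ract r' a y).trans <|
        congrArg (· * π a) (r.tensorL_coe r' y).symm

lemma tensorL_lact (r : Rep E π) (r' : Rep F π) (a : A) (x : (E.tensor F).carrier) :
    r.tensorL r' ((E.tensor F).lact a x) = π a * r.tensorL r' x :=
  tensor_induction (p := fun x => r.tensorL r' ((E.tensor F).lact a x) = π a * r.tensorL r' x) x
    (isClosed_eq ((r.tensorL r').continuous.comp ((E.tensor F).lact a).continuous)
      (continuous_const.mul (r.tensorL r').continuous))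
    fun y => (congrArg (r.tensorL r') ((E.tensorPre F).lactC_coe a y)).trans <|
      (r.tensorL_coe r' _).trans <| (r.tensorAlg_lact r' a y).trans <|
        congrArg (π a * ·) (r.tensorL_coe r' y).symm

lemma star_mul_tensorL (r : Rep E π) (r' : Rep F π) (x y : (E.tensor F).carrier) :
    star (r.tensorL r' x) * r.tensorL r' y = π ((E.tensor F).inner x y) := by
  have hπ : Continuous π :=
    AddMonoidHomClass.continuous_of_bound π 1 fun a => by
      rw [one_mul]; exact NonUnitalStarAlgHom.norm_apply_le π a
  refine UniformSpace.Completion.induction_on₂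
    (p := fun x y => star (r.tensorL r' x) * r.tensorL r' y = π ((E.tensor F).inner x y)) x y
    (isClosed_eq (((r.tensorL r').continuous.comp continuous_fst).star.mul
      ((r.tensorL r').continuous.comp continuous_snd))
    (hπ.comp (E.tensorPre F).continuous_innerC_pair)) fun x y => ?_
  exact (congrArg₂ (fun b c => star b * c) (r.tensorL_coe r' x) (r.tensorL_coe r' y)).trans <|
    (r.star_mul_tensorAlg r' x y).trans <| congrArg π ((E.tensorPre F).innerC_coe x y).symm

/-- The representation `(ψ ⊗ ψ', π)` of `E ⊗_A F` with `(ψ ⊗ ψ')(m ⊗_A n) = ψ(m) ψ'(n)`. -/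
def tensor (r : Rep E π) (r' : Rep F π) : Rep (E.tensor F) π where
  ψ := r.tensorL r'
  map_ract := r.tensorL_ract r'
  star_mul_map := r.star_mul_tensorL r'
  map_lact := r.tensorL_lact r'

variable (π) in
/-- The representation `(π, π)` of the bimodule `A`. -/
def self : Rep (HilbertBimodule.self A) π where
  ψ := (π : A →ₗ[ℂ] B)
  map_ract a (m : A) := map_mul π m a
  star_mul_map (m n : A) := by
    change star (π m) * π n = π (star m * n)
    rw [map_mul, map_star]
  map_lact a (m : A) := map_mul π a m

/-- The representation `(ψ^{⊗ i}, π)` of `E^{⊗ i}`. -/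
def pow (r : Rep E π) : (i : ℕ) → Rep (E.pow i) π
  | 0 => self π
  | i + 1 => r.tensor (r.pow i)

/-- The representation `(ψ, π)` is coisometric on `J`: the homomorphism `(ψ, π)^{(1)}` of `𝒦(E)`,
that is the unique bounded linear map `T` with `T(Θ_{m, n}) = ψ(m) ψ(n)⋆`, satisfies
`T(φ(a)) = π(a)` for all `a ∈ J`. -/
def IsCoisometric (r : Rep E π) (J : Set A) (hJ : ∀ a ∈ J, E.lact a ∈ E.compacts) : Prop :=
  ∃ T : E.compacts →L[ℂ] B,
    (∀ m n, T ⟨E.rankOne m n, E.rankOne_mem m n⟩ = r.ψ m * star (r.ψ n)) ∧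
    ∀ a (ha : a ∈ J), T ⟨E.lact a, hJ a ha⟩ = π a

end Rep
end Representations

section Multipliers

/-- The strict topology on `M(A)`: pointwise norm convergence of `a ↦ m a` and `a ↦ a m`. -/
abbrev strictTopology (A : Type u) [NonUnitalCStarAlgebra A] : TopologicalSpace 𝓜(ℂ, A) :=
  TopologicalSpace.induced
    (fun m => ((fun a => m.fst a, fun a => m.snd a) : (A → A) × (A → A))) inferInstance

/-- `αbar` is a strictly continuous endomorphism of `M(A)` that extends the endomorphism `α`
of `A`. There is at most one such `αbar`. -/
structure IsStrictExtension {A : Type u} [NonUnitalCStarAlgebra A] (α : A →⋆ₙₐ[ℂ] A)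
    (αbar : 𝓜(ℂ, A) →⋆ₙₐ[ℂ] 𝓜(ℂ, A)) : Prop where
  map_coe : ∀ a : A, αbar (a : 𝓜(ℂ, A)) = (α a : 𝓜(ℂ, A))
  strictly_continuous : @Continuous _ _ (strictTopology A) (strictTopology A) αbar

/-- The endomorphism `α` of `A` is extendible. -/
def Extendible {A : Type u} [NonUnitalCStarAlgebra A] (α : A →⋆ₙₐ[ℂ] A) : Prop :=
  ∃ αbar : 𝓜(ℂ, A) →⋆ₙₐ[ℂ] 𝓜(ℂ, A), IsStrictExtension α αbar

/-- The homomorphism `π : A → B` is nondegenerate: `π(A)B` spans a dense subspace of `B`. -/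
def Nondegenerate {A : Type u} {B : Type v} [NonUnitalCStarAlgebra A] [NonUnitalCStarAlgebra B]
    (π : A →⋆ₙₐ[ℂ] B) : Prop :=
  Dense (Submodule.span ℂ (Set.range fun p : A × B => π p.1 * p.2) : Set B)

end Multipliers

section ExelSystems

variable (A : Type u) [NonUnitalCStarAlgebra A] [PartialOrder A] [StarOrderedRing A]

/-- An Exel system `(A, α, L)`: an extendible endomorphism `α` of `A` and a transfer operator `L`,
with its (unique) extension `Lbar` to `M(A)`. -/
structure ExelSystem where
  α : A →⋆ₙₐ[ℂ] A
  extendible : Extendible α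
  L : A →ₚ[ℂ] A
  Lbar : 𝓜(ℂ, A) →ₗ[ℂ] 𝓜(ℂ, A)
  /-- `Lbar` is positive. -/
  Lbar_pos : ∀ m, ∃ n, Lbar (star m * m) = star n * n
  /-- `Lbar` extends `L`. -/
  Lbar_coe : ∀ a : A, Lbar (a : 𝓜(ℂ, A)) = (L a : 𝓜(ℂ, A))
  /-- `L(α(a) m) = a Lbar(m)`; here `m.snd x` is the product `x m` in `A`. -/
  transfer : ∀ (a : A) (m : 𝓜(ℂ, A)), L (m.snd (α a)) = (Lbar m).snd a
  Lbar_one : Lbar 1 = 1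

variable {A}

namespace ExelSystem

variable (S : ExelSystem A)

lemma L_alpha_mul (a x : A) : S.L (S.α a * x) = a * S.L x := by
  have := S.transfer a (x : 𝓜(ℂ, A))
  rw [S.Lbar_coe] at this
  exact this

lemma L_mul_alpha (a x : A) : S.L (x * S.α a) = S.L x * a := by
  have := S.L_alpha_mul (star a) (star x)
  rw [map_star, ← star_mul, map_star, map_star, ← star_mul] at this
  exact star_injective this

/-- `A` with the bimodule structure `a · m = am`, `m · b = m α(b)` and the pairing
`⟨m, n⟩ = L(m⋆ n)`. -/
def preModule : PreBimodule A where
  carrier := A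
  inner := LinearMap.mk₂'ₛₗ (starRingEnd ℂ) (RingHom.id ℂ) (fun m n => S.L (star m * n))
    (fun x y z => by rw [star_add, add_mul, map_add])
    (fun c x y => by rw [star_smul, smul_mul_assoc, map_smul]; rfl)
    (fun x y z => by rw [mul_add, map_add])
    (fun c x y => by rw [mul_smul_comm, map_smul]; rfl)
  lact := LinearMap.mk₂ ℂ (fun a m => a * m) add_mul (fun c x y => smul_mul_assoc c x y) mul_add
    (fun c x y => mul_smul_comm c x y)
  ract := LinearMap.mk₂ ℂ (fun b m => m * S.α b) (fun x y z => by rw [map_add, mul_add])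
    (fun c x y => by rw [map_smul, mul_smul_comm]) (fun x y z => by rw [add_mul])
    (fun c x y => by rw [smul_mul_assoc])
  lact_mul a b x := mul_assoc a b x
  ract_mul a b x := by
    change x * S.α (a * b) = x * S.α a * S.α b
    rw [map_mul, mul_assoc]
  lact_ract a b x := (mul_assoc a x _).symm
  star_inner x y := by
    change star (S.L (star x * y)) = S.L (star y * x)
    rw [← map_star, star_mul, star_star]
  inner_self_nonneg x := map_nonneg S.L (star_mul_self_nonneg x)
  inner_ract a x y := by
    change S.L (star x * (y * S.α a)) = S.L (star x * y) * a
    rw [← mul_assoc, S.L_mul_alpha]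
  inner_lact a x y := by
    change S.L (star (a * x) * y) = S.L (star x * (star a * y))
    rw [star_mul, mul_assoc]

/-- The right-Hilbert bimodule `M_L`. Its left action `φ` is `S.M.lact`. -/
def M : HilbertBimodule A := S.preModule.completion

/-- The canonical map `q : A → M_L`. -/
def q : A →ₗ[ℂ] S.M.carrier := S.preModule.toCompletion

end ExelSystem
end ExelSystems

section RelativeCuntzPimsner

variable {A : Type u} [NonUnitalCStarAlgebra A] [PartialOrder A] [StarOrderedRing A]
variable (E : HilbertBimodule A) (J : Set A) (hJ : ∀ a ∈ J, E.lact a ∈ E.compacts)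

/-- A representation of `E` in some C⋆-algebra, coisometric on `J`. -/
structure CoisometricRep where
  B : Type u
  [cstar : NonUnitalCStarAlgebra B]
  π : A →⋆ₙₐ[ℂ] B
  rep : Rep E π
  coisometric : rep.IsCoisometric J hJ

attribute [instance] CoisometricRep.cstar

/-- The C⋆-algebra of bounded families indexed by the representations coisometric on `J`. -/
abbrev RepProduct : Type (u + 1) := lp (fun r : CoisometricRep E J hJ => r.B) ∞

/-- The direct sum of the homomorphisms `π`. -/
def prodA : A →⋆ₙₐ[ℂ] RepProduct E J hJ where
  toFun a := ⟨fun r => r.π a, memℓp_infty ⟨‖a‖, by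
    rintro _ ⟨r, rfl⟩
    exact NonUnitalStarAlgHom.norm_apply_le r.π a⟩⟩
  map_smul' c a := Subtype.ext <| funext fun r => map_smul r.π c a
  map_zero' := Subtype.ext <| funext fun r => map_zero r.π
  map_add' a b := Subtype.ext <| funext fun r => map_add r.π a b
  map_mul' a b := Subtype.ext <| funext fun r => map_mul r.π a b
  map_star' a := Subtype.ext <| funext fun r => map_star r.π a

/-- The direct sum of the linear maps `ψ`. -/
def prodM : E.carrier →ₗ[ℂ] RepProduct E J hJ where
  toFun m := ⟨fun r => r.rep.ψ m, memℓp_infty ⟨‖m‖, by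
    rintro _ ⟨r, rfl⟩
    exact r.rep.norm_le m⟩⟩
  map_smul' c a := Subtype.ext <| funext fun r => map_smul r.rep.ψ c a
  map_add' a b := Subtype.ext <| funext fun r => map_add r.rep.ψ a b

/-- The relative Cuntz–Pimsner algebra `𝒪(J, E)`: the C⋆-algebra generated by the universal
representation `(k_M, k_A)` coisometric on `J`, realised as the direct sum of all such
representations. The C⋆-algebra generated by a representation is bounded in size in terms of `A`
and `E`, so that representations in C⋆-algebras in `Type u` suffice. -/
def relCP : NonUnitalStarSubalgebra ℂ (RepProduct E J hJ) :=
  (NonUnitalStarAlgebra.adjoin ℂ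
    (Set.range (prodA E J hJ) ∪ Set.range (prodM E J hJ))).topologicalClosure

instance : IsClosed (relCP E J hJ : Set (RepProduct E J hJ)) :=
  NonUnitalStarSubalgebra.isClosed_topologicalClosure _

lemma prodA_mem (a : A) : prodA E J hJ a ∈ relCP E J hJ :=
  NonUnitalStarSubalgebra.le_topologicalClosure _
    (NonUnitalStarAlgebra.subset_adjoin ℂ _ (Or.inl ⟨a, rfl⟩))

lemma prodM_mem (m : E.carrier) : prodM E J hJ m ∈ relCP E J hJ :=
  NonUnitalStarSubalgebra.le_topologicalClosure _
    (NonUnitalStarAlgebra.subset_adjoin ℂ _ (Or.inr ⟨m, rfl⟩))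

/-- The C⋆-algebra `𝒪(J, E)` as a type. -/
def RelCP : Type (u + 1) := relCP E J hJ

instance : NonUnitalCStarAlgebra (RelCP E J hJ) :=
  inferInstanceAs (NonUnitalCStarAlgebra (relCP E J hJ))

/-- The canonical homomorphism `k_A : A → 𝒪(J, E)`. -/
def kA : A →⋆ₙₐ[ℂ] RelCP E J hJ :=
  NonUnitalStarAlgHom.codRestrict (prodA E J hJ) _ (prodA_mem E J hJ)

/-- The universal representation `(k_M, k_A)` of `E` in `𝒪(J, E)`; its linear map is `k_M`. -/
def k : Rep E (kA E J hJ) where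
  ψ := (prodM E J hJ).codRestrict (relCP E J hJ).toNonUnitalSubalgebra.toSubmodule
    (prodM_mem E J hJ)
  map_ract a m := Subtype.ext <| Subtype.ext <| funext fun r => r.rep.map_ract a m
  star_mul_map m n := Subtype.ext <| Subtype.ext <| funext fun r => r.rep.star_mul_map m n
  map_lact a m := Subtype.ext <| Subtype.ext <| funext fun r => r.rep.map_lact a m

lemma circle_star_mul (z : Circle) : star (z : ℂ) * (z : ℂ) = 1 := by
  rw [Complex.star_def, ← Circle.coe_inv_eq_conj, ← Circle.coe_mul, inv_mul_cancel, Circle.coe_one]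

variable {E J hJ} in
/-- The representation `(zψ, π)`. -/
def CoisometricRep.twist (z : Circle) (r : CoisometricRep E J hJ) : CoisometricRep E J hJ where
  B := r.B
  π := r.π
  rep :=
    { ψ := (z : ℂ) • r.rep.ψ
      map_ract := fun a m => by
        rw [LinearMap.smul_apply, LinearMap.smul_apply, r.rep.map_ract, smul_mul_assoc]
      star_mul_map := fun m n => by
        rw [LinearMap.smul_apply, LinearMap.smul_apply, star_smul, smul_mul_smul_comm,
          r.rep.star_mul_map, circle_star_mul, one_smul]
      map_lact := fun a m => by
        rw [LinearMap.smul_apply, LinearMap.smul_apply, r.rep.map_lact, mul_smul_comm] }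
  coisometric := by
    obtain ⟨T, hT, hTJ⟩ := r.coisometric
    refine ⟨T, fun m n => ?_, hTJ⟩
    rw [hT, LinearMap.smul_apply, LinearMap.smul_apply, star_smul, smul_mul_smul_comm, mul_comm,
      circle_star_mul, one_smul]

/-- Reindexing of bounded families along `(ψ, π) ↦ (zψ, π)`. -/
def prodGauge (z : Circle) : RepProduct E J hJ →⋆ₙₐ[ℂ] RepProduct E J hJ where
  toFun x := ⟨fun r => (x : ∀ r : CoisometricRep E J hJ, r.B) (r.twist z), memℓp_infty ⟨‖x‖, by
    rintro _ ⟨r, rfl⟩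
    exact lp.norm_apply_le_norm ENNReal.top_ne_zero x (r.twist z)⟩⟩
  map_smul' c a := rfl
  map_zero' := rfl
  map_add' a b := rfl
  map_mul' a b := rfl
  map_star' a := rfl

lemma prodGauge_mem (z : Circle) (x : RepProduct E J hJ) (hx : x ∈ relCP E J hJ) :
    prodGauge E J hJ z x ∈ relCP E J hJ := by
  have hc : Continuous (prodGauge E J hJ z) :=
    AddMonoidHomClass.continuous_of_bound (prodGauge E J hJ z) 1 fun a => by
      rw [one_mul]; exact NonUnitalStarAlgHom.norm_apply_le (prodGauge E J hJ z) a
  have h : relCP E J hJ ≤ (relCP E J hJ).comap (prodGauge E J hJ z) := by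
    refine NonUnitalStarSubalgebra.topologicalClosure_minimal _ (NonUnitalStarAlgebra.adjoin_le ?_)
      (IsClosed.preimage hc (NonUnitalStarSubalgebra.isClosed_topologicalClosure _))
    rintro _ (⟨a, rfl⟩ | ⟨m, rfl⟩)
    · exact prodA_mem E J hJ a
    · have : prodGauge E J hJ z (prodM E J hJ m) = prodM E J hJ ((z : ℂ) • m) := by
        rw [map_smul]; rfl
      change prodGauge E J hJ z (prodM E J hJ m) ∈ relCP E J hJ
      rw [this]
      exact prodM_mem E J hJ _
  exact h hx

/-- The gauge action: `γ_z(k_A(a)) = k_A(a)` and `γ_z(k_M(m)) = z k_M(m)`. -/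
def gauge (z : Circle) : RelCP E J hJ →⋆ₙₐ[ℂ] RelCP E J hJ :=
  NonUnitalStarAlgHom.codRestrict
    ((prodGauge E J hJ z).comp (NonUnitalStarSubalgebraClass.subtype (relCP E J hJ))) _
    fun x => prodGauge_mem E J hJ z x x.2

lemma gauge_kA (z : Circle) (a : A) : gauge E J hJ z (kA E J hJ a) = kA E J hJ a := rfl

lemma gauge_kM (z : Circle) (m : E.carrier) :
    gauge E J hJ z ((k E J hJ).ψ m) = (z : ℂ) • (k E J hJ).ψ m := rfl

/-- The core `𝒪(J, E)^γ`, the fixed-point algebra of the gauge action. -/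
def core : NonUnitalStarSubalgebra ℂ (RelCP E J hJ) where
  carrier := {x | ∀ z, gauge E J hJ z x = x}
  add_mem' hx hy z := by rw [map_add, hx z, hy z]
  zero_mem' z := map_zero _
  mul_mem' hx hy z := by rw [map_mul, hx z, hy z]
  smul_mem' c x hx z := by rw [map_smul, hx z]
  star_mem' hx z := by rw [map_star, hx z]

instance : IsClosed (core E J hJ : Set (RelCP E J hJ)) := by
  have h : (core E J hJ : Set (RelCP E J hJ)) = ⋂ z, {x | gauge E J hJ z x = x} := by
    ext x
    simp only [Set.mem_iInter]
    rfl
  rw [h]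
  refine isClosed_iInter fun z => isClosed_eq ?_ continuous_id
  exact AddMonoidHomClass.continuous_of_bound (gauge E J hJ z) 1 fun a => by
    rw [one_mul]; exact NonUnitalStarAlgHom.norm_apply_le (gauge E J hJ z) a

/-- The core as a type. -/
def Core : Type (u + 1) := core E J hJ

instance : NonUnitalCStarAlgebra (Core E J hJ) :=
  inferInstanceAs (NonUnitalCStarAlgebra (core E J hJ))

/-- The inclusion of the core in `𝒪(J, E)`. -/
def coreIncl : Core E J hJ →⋆ₙₐ[ℂ] RelCP E J hJ :=
  NonUnitalStarSubalgebraClass.subtype (core E J hJ)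

end RelativeCuntzPimsner

section Stacey

variable {C : Type w} [NonUnitalCStarAlgebra C] (β : C →⋆ₙₐ[ℂ] C)

/-- `(π, V)` is a Stacey-covariant representation of `(C, β)` in `B`. -/
structure IsStaceyCovariant {B : Type v} [NonUnitalCStarAlgebra B] (π : C →⋆ₙₐ[ℂ] B)
    (V : 𝓜(ℂ, B)) : Prop where
  nondegenerate : Nondegenerate π
  isometry : star V * V = 1
  covariant : ∀ c, (π (β c) : 𝓜(ℂ, B)) = V * (π c : 𝓜(ℂ, B)) * star V

/-- A Stacey-covariant representation of `(C, β)` in some C⋆-algebra. -/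
structure StaceyRep where
  B : Type w
  [cstar : NonUnitalCStarAlgebra B]
  π : C →⋆ₙₐ[ℂ] B
  V : 𝓜(ℂ, B)
  isStacey : IsStaceyCovariant β π V

attribute [instance] StaceyRep.cstar

/-- The C⋆-algebra of bounded families indexed by the Stacey-covariant representations. -/
abbrev StaceyProduct : Type (w + 1) := lp (fun r : StaceyRep β => r.B) ∞

/-- The direct sum of the homomorphisms `π`. -/
def staceyProdA : C →⋆ₙₐ[ℂ] StaceyProduct β where
  toFun a := ⟨fun r => r.π a, memℓp_infty ⟨‖a‖, by
    rintro _ ⟨r, rfl⟩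
    exact NonUnitalStarAlgHom.norm_apply_le r.π a⟩⟩
  map_smul' c a := Subtype.ext <| funext fun r => map_smul r.π c a
  map_zero' := Subtype.ext <| funext fun r => map_zero r.π
  map_add' a b := Subtype.ext <| funext fun r => map_add r.π a b
  map_mul' a b := Subtype.ext <| funext fun r => map_mul r.π a b
  map_star' a := Subtype.ext <| funext fun r => map_star r.π a

lemma norm_V_le (r : StaceyRep β) : ‖r.V‖ ≤ 1 := by
  have h1 : ‖(1 : 𝓜(ℂ, r.B))‖ ≤ 1 := by
    rw [← DoubleCentralizer.norm_fst, DoubleCentralizer.one_fst]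
    exact ContinuousLinearMap.norm_id_le
  have h2 : ‖star r.V * r.V‖ = ‖r.V‖ * ‖r.V‖ := CStarRing.norm_star_mul_self
  rw [r.isStacey.isometry] at h2
  nlinarith [norm_nonneg r.V]

/-- The bounded family `(T_r (x_r))_r` for contractions `T_r`. -/
def prodMap (T : ∀ r : StaceyRep β, r.B →L[ℂ] r.B) (hT : ∀ r, ‖T r‖ ≤ 1) :
    StaceyProduct β →L[ℂ] StaceyProduct β :=
  have h : ∀ (x : StaceyProduct β) (r : StaceyRep β),
      ‖T r ((x : ∀ r : StaceyRep β, r.B) r)‖ ≤ ‖x‖ := fun x r =>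
    ((T r).le_of_opNorm_le (hT r) _).trans <| by
      rw [one_mul]; exact lp.norm_apply_le_norm ENNReal.top_ne_zero x r
  LinearMap.mkContinuous
    { toFun := fun x => ⟨fun r => T r ((x : ∀ r : StaceyRep β, r.B) r), memℓp_infty ⟨‖x‖, by
        rintro _ ⟨r, rfl⟩
        exact h x r⟩⟩
      map_add' := fun x y => Subtype.ext <| funext fun r => map_add (T r) _ _
      map_smul' := fun c x => Subtype.ext <| funext fun r => map_smul (T r) c _ } 1
    fun x => by
      rw [one_mul]
      exact lp.norm_le_of_forall_le (norm_nonneg x) (h x)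

/-- The direct sum of the isometries `V`, as a multiplier. -/
def staceyProdV : 𝓜(ℂ, StaceyProduct β) where
  fst := prodMap β (fun r => r.V.fst) fun r =>
    (DoubleCentralizer.norm_fst _).trans_le (norm_V_le β r)
  snd := prodMap β (fun r => r.V.snd) fun r =>
    (DoubleCentralizer.norm_snd _).trans_le (norm_V_le β r)
  central _ _ := Subtype.ext <| funext fun r => r.V.central _ _

/-- The Stacey crossed product `C ×_β ℕ`: the C⋆-algebra generated by the universal
Stacey-covariant representation `(i_C, v)`, realised as the direct sum of all such representations.
It is the smallest C⋆-algebra that contains `i_C(C)` and has `v` as a multiplier. -/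
def staceyCrossedProduct : NonUnitalStarSubalgebra ℂ (StaceyProduct β) :=
  sInf {D | IsClosed (D : Set (StaceyProduct β)) ∧ (∀ c, staceyProdA β c ∈ D) ∧
    ∀ x ∈ D, (staceyProdV β).fst x ∈ D ∧ (staceyProdV β).snd x ∈ D}

instance : IsClosed (staceyCrossedProduct β : Set (StaceyProduct β)) := by
  rw [staceyCrossedProduct, NonUnitalStarAlgebra.coe_sInf]
  exact isClosed_biInter fun D hD => hD.1

/-- The Stacey crossed product as a type. -/
def StaceyCrossedProduct : Type (w + 1) := staceyCrossedProduct β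

instance : NonUnitalCStarAlgebra (StaceyCrossedProduct β) :=
  inferInstanceAs (NonUnitalCStarAlgebra (staceyCrossedProduct β))

/-- The canonical homomorphism `i_C : C → C ×_β ℕ`. -/
def staceyI : C →⋆ₙₐ[ℂ] StaceyCrossedProduct β :=
  NonUnitalStarAlgHom.codRestrict (staceyProdA β) _ fun c =>
    NonUnitalStarAlgebra.mem_sInf.2 fun _ hD => hD.2.1 c

lemma staceyProdV_mem {x : StaceyProduct β} (hx : x ∈ staceyCrossedProduct β) :
    (staceyProdV β).fst x ∈ staceyCrossedProduct β ∧
      (staceyProdV β).snd x ∈ staceyCrossedProduct β :=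
  ⟨NonUnitalStarAlgebra.mem_sInf.2 fun D hD =>
      (hD.2.2 x (NonUnitalStarAlgebra.mem_sInf.1 hx D hD)).1,
    NonUnitalStarAlgebra.mem_sInf.2 fun D hD =>
      (hD.2.2 x (NonUnitalStarAlgebra.mem_sInf.1 hx D hD)).2⟩

/-- The canonical isometry `v ∈ M(C ×_β ℕ)`. -/
def staceyV : 𝓜(ℂ, StaceyCrossedProduct β) where
  fst := LinearMap.mkContinuous
    { toFun := fun x => ⟨(staceyProdV β).fst x.1, (staceyProdV_mem β x.2).1⟩
      map_add' := fun x y => Subtype.ext <| map_add (staceyProdV β).fst x.1 y.1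
      map_smul' := fun c x => Subtype.ext <| map_smul (staceyProdV β).fst c x.1 }
    ‖(staceyProdV β).fst‖ fun x => (staceyProdV β).fst.le_opNorm x.1
  snd := LinearMap.mkContinuous
    { toFun := fun x => ⟨(staceyProdV β).snd x.1, (staceyProdV_mem β x.2).2⟩
      map_add' := fun x y => Subtype.ext <| map_add (staceyProdV β).snd x.1 y.1
      map_smul' := fun c x => Subtype.ext <| map_smul (staceyProdV β).snd c x.1 }
    ‖(staceyProdV β).snd‖ fun x => (staceyProdV β).snd.le_opNorm x.1
  central x y := Subtype.ext <| (staceyProdV β).central x.1 y.1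

end Stacey

end ExelStacey

end

open ExelStacey

/-! The isometry `V` is the strict limit of `k_M(q(e))` along an approximate unit `e` of `A`
(`exists_isometry`): `k_A(a) k_M(q(e)) = k_M(q(ae))` tends to `k_M(q(a))`, and `k_M(q(e)) k_A(a) =
k_M(q(e α(a)))` tends to `k_M(q(α(a)))`. The normalisation of the transfer operator gives `L ∘ α =
id`, which becomes `V⋆V = 1` (`star_isom_mul_isom`); nondegeneracy of `k_A` gives uniqueness. As `V`
has degree one for the gauge action, `Ad V` and `Ad V⋆` both preserve the core, and the formula on
spanning elements, injectivity and the range are algebra with `V⋆V = 1`. Extendibility is less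
formal: `V T V⋆ c` must be strictly continuous in `T` although `V⋆ c` is not in the core, and this
comes from a factorization of `V V⋆ c` (`exists_factorization`, `exists_adIsomBar_fst`).

For the isomorphism, let `(ρ, W)` be a Stacey-covariant representation of the core. Since `k_M(m)
V⋆` has degree zero, `ψ(m) = ρ(k_M(m) V⋆) W` makes sense, and `(ψ, ρ ∘ k_A)` is a representation of
`M_L`. It is coisometric on `J`, because the coisometry of the universal representation is an
identity inside the core (`isCoisometric_k`, `isCoisometric_toRep`). The universal property of `𝒪(J,
M_L)` yields `θ`, which intertwines `V` with `W`, and it remains to see that `θ = ρ` on the core.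
For this the core is shown to be generated by `k_A(A)` under `Ad V`, `Ad V⋆` and the range
projections of `Vⁿ` (`IsIsomInvariant.mem_of_isClosed`): the elements `d Vⁿ` and `V⋆ⁿ d` span a
dense subspace, and averaging over roots of unity isolates degree zero. The maps `θ` for all `(ρ,
W)` together invert the coordinate map at `(id, V)`.

Two points concern the universal objects as constructed. Contractivity of `(ψ, π)^{(1)}`, uniform in
the representation, makes the product representation coisometric (`Rep.norm_sum_le`); and a
smallness argument extends the universal property to targets in every universe
(`Rep.IsCoisometric.exists_lift`). -/

noncomputable section

namespace ExelStacey

open Filter Topology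

/-! ### Multipliers as double centralizers, and strict limits. -/

section MultiplierLemmas

variable {B : Type v} [NonUnitalCStarAlgebra B]

/-- The centrality relation alone forces the left half of `V` to be right `B`-linear: the defect is
annihilated by all left multiplications, so it vanishes by the C⋆-identity. -/
lemma mul_coe_eq (V : 𝓜(ℂ, B)) (x : B) : V * (x : 𝓜(ℂ, B)) = (V.fst x : B) := by
  refine DoubleCentralizer.ext _ _ _ _ (Prod.ext ?_ ?_)
  · refine ContinuousLinearMap.ext fun y => ?_
    change V.fst (x * y) = V.fst x * y
    rw [← sub_eq_zero, ← CStarRing.star_mul_self_eq_zero_iff]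
    have key : ∀ z : B, z * (V.fst (x * y) - V.fst x * y) = 0 := fun z => by
      rw [mul_sub, ← mul_assoc, ← V.central, ← V.central, mul_assoc, sub_self]
    exact key _
  · refine ContinuousLinearMap.ext fun y => ?_
    change V.snd y * x = y * V.fst x
    exact V.central y x

lemma coe_mul_eq (V : 𝓜(ℂ, B)) (x : B) : (x : 𝓜(ℂ, B)) * V = (V.snd x : B) := by
  refine DoubleCentralizer.ext _ _ _ _ (Prod.ext ?_ ?_)
  · refine ContinuousLinearMap.ext fun y => ?_
    change x * V.fst y = V.snd x * y
    exact (V.central x y).symm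
  · refine ContinuousLinearMap.ext fun y => ?_
    change V.snd (y * x) = y * V.snd x
    rw [← sub_eq_zero, ← CStarRing.mul_star_self_eq_zero_iff]
    have key : ∀ z : B, (V.snd (y * x) - y * V.snd x) * z = 0 := fun z => by
      rw [sub_mul, mul_assoc, V.central, V.central, mul_assoc, sub_self]
    exact key _

lemma coe_injective : Function.Injective fun x : B => (x : 𝓜(ℂ, B)) := by
  intro x y h
  have h1 : (x - y) * star (x - y) = 0 := by
    have := congrArg (fun V : 𝓜(ℂ, B) => V.fst (star (x - y))) h
    change x * _ = y * _ at this
    rw [sub_mul, this, sub_self]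
  exact sub_eq_zero.1 (CStarRing.mul_star_self_eq_zero_iff _ |>.1 h1)

lemma coe_inj {x y : B} : (x : 𝓜(ℂ, B)) = (y : 𝓜(ℂ, B)) ↔ x = y := coe_injective.eq_iff

lemma coe_mul (x y : B) : ((x * y : B) : 𝓜(ℂ, B)) = (x : 𝓜(ℂ, B)) * (y : 𝓜(ℂ, B)) :=
  map_mul (DoubleCentralizer.coeHom (𝕜 := ℂ) (A := B)) x y

lemma coe_star (x : B) : ((star x : B) : 𝓜(ℂ, B)) = star (x : 𝓜(ℂ, B)) :=
  map_star (DoubleCentralizer.coeHom (𝕜 := ℂ) (A := B)) x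

lemma fst_mul (V : 𝓜(ℂ, B)) (x y : B) : V.fst (x * y) = V.fst x * y := by
  rw [← coe_inj, ← mul_coe_eq, coe_mul, coe_mul, ← mul_coe_eq, mul_assoc]

lemma snd_mul (V : 𝓜(ℂ, B)) (x y : B) : V.snd (x * y) = x * V.snd y := by
  rw [← coe_inj, ← coe_mul_eq, coe_mul, coe_mul, ← coe_mul_eq, mul_assoc]

/-- By centrality the right half is determined by the left half: the difference of the right halves
annihilates `B`. -/
lemma ext_of_fst {V W : 𝓜(ℂ, B)} (h : ∀ x, V.fst x = W.fst x) : V = W := by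
  refine DoubleCentralizer.ext _ _ _ _ (Prod.ext (ContinuousLinearMap.ext h) ?_)
  refine ContinuousLinearMap.ext fun x => ?_
  rw [← sub_eq_zero, ← CStarRing.mul_star_self_eq_zero_iff, sub_mul, V.central, W.central, h,
    sub_self]

lemma ext_of_snd {V W : 𝓜(ℂ, B)} (h : ∀ x, V.snd x = W.snd x) : V = W := by
  refine ext_of_fst fun x => ?_
  rw [← sub_eq_zero, ← CStarRing.star_mul_self_eq_zero_iff, mul_sub, ← V.central, ← W.central, h,
    sub_self]

variable (B) in
/-- The canonical approximate unit of a C⋆-algebra, for its spectral order. -/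
def approxUnit : Filter B :=
  letI := CStarAlgebra.spectralOrder B
  haveI := CStarAlgebra.spectralOrderedRing B
  CStarAlgebra.approximateUnit B

instance : (approxUnit B).NeBot := by
  let _ := CStarAlgebra.spectralOrder B
  have := CStarAlgebra.spectralOrderedRing B
  exact (CStarAlgebra.increasingApproximateUnit B).neBot

lemma tendsto_approxUnit_mul (x : B) : Tendsto (fun e => e * x) (approxUnit B) (𝓝 x) := by
  let _ := CStarAlgebra.spectralOrder B
  have := CStarAlgebra.spectralOrderedRing B
  exact (CStarAlgebra.increasingApproximateUnit B).tendsto_mul_right x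

lemma tendsto_mul_approxUnit (x : B) : Tendsto (fun e => x * e) (approxUnit B) (𝓝 x) := by
  let _ := CStarAlgebra.spectralOrder B
  have := CStarAlgebra.spectralOrderedRing B
  exact (CStarAlgebra.increasingApproximateUnit B).tendsto_mul_left x

lemma eventually_norm_approxUnit : ∀ᶠ e in approxUnit B, ‖e‖ ≤ 1 := by
  let _ := CStarAlgebra.spectralOrder B
  have := CStarAlgebra.spectralOrderedRing B
  exact (CStarAlgebra.increasingApproximateUnit B).eventually_norm

lemma eventually_star_approxUnit : ∀ᶠ e in approxUnit B, star e = e := by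
  let _ := CStarAlgebra.spectralOrder B
  have := CStarAlgebra.spectralOrderedRing B
  exact (CStarAlgebra.increasingApproximateUnit B).eventually_star_eq

/-- An eventually bounded family of operators that converges pointwise on a total set converges
pointwise to a bounded operator. -/
lemma exists_clm_of_tendsto {X : Type*} [NormedAddCommGroup X] [NormedSpace ℂ X] [CompleteSpace X]
    {ι : Type*} {l : Filter ι} [l.NeBot] {T : ι → X →L[ℂ] X} {C : ℝ} (hC : ∀ᶠ i in l, ‖T i‖ ≤ C)
    {D : Set X} (hD : Dense (Submodule.span ℂ D : Set X))
    (h : ∀ x ∈ D, ∃ y, Tendsto (fun i => T i x) l (𝓝 y)) :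
    ∃ S : X →L[ℂ] X, ∀ x, Tendsto (fun i => T i x) l (𝓝 (S x)) := by
  have hspan : ∀ x ∈ Submodule.span ℂ D, ∃ y, Tendsto (fun i => T i x) l (𝓝 y) := by
    intro x hx
    induction hx using Submodule.span_induction with
    | mem x hx => exact h x hx
    | zero => exact ⟨0, by simp⟩
    | add x y _ _ hx hy =>
      obtain ⟨a, ha⟩ := hx
      obtain ⟨b, hb⟩ := hy
      exact ⟨a + b, by simpa using ha.add hb⟩
    | smul c x _ hx =>
      obtain ⟨a, ha⟩ := hx
      exact ⟨c • a, by simpa using ha.const_smul c⟩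
  have hC0 : 0 ≤ C := by
    obtain ⟨i, hi⟩ := hC.exists
    exact (norm_nonneg _).trans hi
  have hall : ∀ x, ∃ y, Tendsto (fun i => T i x) l (𝓝 y) := by
    intro x
    refine CompleteSpace.complete (f := map (fun i => T i x) l)
      (Metric.cauchy_iff.2 ⟨inferInstance, fun ε hε => ?_⟩)
    -- The divisor `C + 1` stays positive when `C = 0`.
    obtain ⟨x', hx', hd⟩ := Metric.dense_iff.1 hD x (ε / (4 * (C + 1))) (by positivity)
    obtain ⟨y, hy⟩ := hspan x' hd
    have h2 := hC.and (Metric.tendsto_nhds.1 hy (ε / 4) (by positivity))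
    refine ⟨_, mem_map.2 (mem_of_superset h2 (Set.subset_preimage_image _ _)), ?_⟩
    have h3 : ∀ i, ‖T i‖ ≤ C → dist (T i x') y < ε / 4 → dist (T i x) y < ε / 2 := by
      intro i h4 h5
      have h6 : dist (T i x) (T i x') ≤ ε / 4 := by
        rw [dist_eq_norm, ← map_sub]
        refine ((T i).le_of_opNorm_le h4 _).trans ?_
        have h7 : ‖x - x'‖ < ε / (4 * (C + 1)) := by
          rw [← dist_eq_norm, dist_comm]; exact hx'
        calc C * ‖x - x'‖ ≤ (C + 1) * (ε / (4 * (C + 1))) := by gcongr; linarith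
          _ = ε / 4 := by field_simp
      linarith [dist_triangle (T i x) (T i x') y]
    rintro _ ⟨i, ⟨hi, hi'⟩, rfl⟩ _ ⟨j, ⟨hj, hj'⟩, rfl⟩
    have h8 := h3 i hi hi'
    have h9 := h3 j hj hj'
    linarith [dist_triangle_right (T i x) (T j x) y]
  choose S hS using hall
  refine ⟨LinearMap.mkContinuous
    { toFun := S
      map_add' := fun x y => tendsto_nhds_unique (hS (x + y)) (by simpa using (hS x).add (hS y))
      map_smul' := fun c x => tendsto_nhds_unique (hS (c • x))
        (by simpa using (hS x).const_smul c) } C fun x => ?_, hS⟩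
  exact le_of_tendsto (hS x).norm (hC.mono fun i hi => (T i).le_of_opNorm_le hi x)

/-- A bounded family in a C⋆-algebra that converges strictly on total sets defines a multiplier. -/
lemma exists_multiplier_of_tendsto {ι : Type*} {l : Filter ι} [l.NeBot] {f : ι → B} {C : ℝ}
    (hC : ∀ᶠ i in l, ‖f i‖ ≤ C) {D D' : Set B} (hD : Dense (Submodule.span ℂ D : Set B))
    (hD' : Dense (Submodule.span ℂ D' : Set B))
    (h : ∀ x ∈ D, ∃ y, Tendsto (fun i => f i * x) l (𝓝 y))
    (h' : ∀ x ∈ D', ∃ y, Tendsto (fun i => x * f i) l (𝓝 y)) :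
    ∃ V : 𝓜(ℂ, B), (∀ x, Tendsto (fun i => f i * x) l (𝓝 (V.fst x))) ∧
      ∀ x, Tendsto (fun i => x * f i) l (𝓝 (V.snd x)) := by
  obtain ⟨S, hS⟩ := exists_clm_of_tendsto (T := fun i => ContinuousLinearMap.mul ℂ B (f i))
    (hC.mono fun i hi => (ContinuousLinearMap.opNorm_mul_apply_le ℂ B (f i)).trans hi) hD h
  obtain ⟨S', hS'⟩ := exists_clm_of_tendsto
    (T := fun i => (ContinuousLinearMap.mul ℂ B).flip (f i)) (C := C)
    (hC.mono fun i hi =>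
      ContinuousLinearMap.opNorm_le_bound _ ((norm_nonneg _).trans hi) fun x => by
      refine (norm_mul_le x (f i)).trans ?_
      rw [mul_comm]
      gcongr) hD' h'
  refine ⟨⟨(S, S'), fun x y => ?_⟩, hS, hS'⟩
  refine tendsto_nhds_unique ((hS' x).mul_const y) ?_
  simpa [mul_assoc] using (hS y).const_mul x

end MultiplierLemmas

/-! ### Nondegenerate homomorphisms and their extension to multiplier algebras. -/

section NondegenerateHoms

variable {C : Type u} {B : Type v} [NonUnitalCStarAlgebra C] [NonUnitalCStarAlgebra B]
  {π : C →⋆ₙₐ[ℂ] B}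

lemma continuous_hom (π : C →⋆ₙₐ[ℂ] B) : Continuous π :=
  AddMonoidHomClass.continuous_of_bound π 1 fun a => by
    rw [one_mul]; exact NonUnitalStarAlgHom.norm_apply_le π a

lemma eventually_norm_map_approxUnit (π : C →⋆ₙₐ[ℂ] B) : ∀ᶠ e in approxUnit C, ‖π e‖ ≤ 1 :=
  eventually_norm_approxUnit.mono fun e he => (NonUnitalStarAlgHom.norm_apply_le π e).trans he

namespace Nondegenerate

/-- The contractions `π(e)` converge on the total set `π(C)B`, so they converge everywhere to a
bounded operator, which is the identity because it is so on `π(C)B`. -/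
lemma tendsto_mul (hπ : Nondegenerate π) (x : B) :
    Tendsto (fun e => π e * x) (approxUnit C) (𝓝 x) := by
  obtain ⟨S, hS⟩ := exists_clm_of_tendsto (l := approxUnit C) (C := 1)
    (T := fun e => ContinuousLinearMap.mul ℂ B (π e))
    ((eventually_norm_map_approxUnit π).mono fun i hi =>
      (ContinuousLinearMap.opNorm_mul_apply_le ℂ B (π i)).trans hi) hπ (by
      rintro _ ⟨p, rfl⟩
      refine ⟨π p.1 * p.2, ?_⟩
      have := (((continuous_hom π).tendsto _).comp (tendsto_approxUnit_mul p.1)).mul_const p.2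
      simpa [Function.comp_def, mul_assoc] using this)
  have hS1 : S = ContinuousLinearMap.id ℂ B := by
    refine ContinuousLinearMap.ext_on hπ ?_
    rintro _ ⟨p, rfl⟩
    refine tendsto_nhds_unique (hS _) ?_
    have := (((continuous_hom π).tendsto _).comp (tendsto_approxUnit_mul p.1)).mul_const p.2
    simpa [Function.comp_def, mul_assoc] using this
  simpa [hS1] using hS x

lemma tendsto_mul_right (hπ : Nondegenerate π) (x : B) :
    Tendsto (fun e => x * π e) (approxUnit C) (𝓝 x) := by
  have := (hπ.tendsto_mul (star x)).star
  rw [star_star] at this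
  refine this.congr' (eventually_star_approxUnit.mono fun e he => ?_)
  rw [star_mul, star_star, ← map_star, he]

lemma of_tendsto (h : ∀ x : B, Tendsto (fun e => π e * x) (approxUnit C) (𝓝 x)) :
    Nondegenerate π := fun x =>
  mem_closure_of_tendsto (h x)
    (Eventually.of_forall fun e => Submodule.subset_span ⟨(e, x), rfl⟩)

lemma dense_right (hπ : Nondegenerate π) :
    Dense (Submodule.span ℂ (Set.range fun p : B × C => p.1 * π p.2) : Set B) := fun x =>
  mem_closure_of_tendsto (hπ.tendsto_mul_right x)
    (Eventually.of_forall fun e => Submodule.subset_span ⟨(x, e), rfl⟩)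

/-- Every `x` is itself the limit of the products `π(e) x`, so single products are dense and no
linearity of `f` and `g` is needed. -/
lemma eq_of_left (hπ : Nondegenerate π) {X : Type*} [TopologicalSpace X] [T2Space X] {f g : B → X}
    (hf : Continuous f) (hg : Continuous g) (h : ∀ c y, f (π c * y) = g (π c * y)) (x : B) :
    f x = g x :=
  tendsto_nhds_unique ((hf.tendsto x).comp (hπ.tendsto_mul x))
    (((hg.tendsto x).comp (hπ.tendsto_mul x)).congr fun e => (h e x).symm)

lemma eq_of_right (hπ : Nondegenerate π) {X : Type*} [TopologicalSpace X] [T2Space X] {f g : B → X}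
    (hf : Continuous f) (hg : Continuous g) (h : ∀ c y, f (y * π c) = g (y * π c)) (x : B) :
    f x = g x :=
  tendsto_nhds_unique ((hf.tendsto x).comp (hπ.tendsto_mul_right x))
    (((hg.tendsto x).comp (hπ.tendsto_mul_right x)).congr fun e => (h e x).symm)

lemma ext_left (hπ : Nondegenerate π) {V W : 𝓜(ℂ, B)}
    (h : ∀ c, V * (π c : 𝓜(ℂ, B)) = W * (π c : 𝓜(ℂ, B))) : V = W :=
  ext_of_fst <| hπ.eq_of_left V.fst.continuous W.fst.continuous fun c y => by
    have := h c
    rw [mul_coe_eq, mul_coe_eq, coe_inj] at this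
    rw [fst_mul, fst_mul, this]

lemma ext_right (hπ : Nondegenerate π) {V W : 𝓜(ℂ, B)}
    (h : ∀ c, (π c : 𝓜(ℂ, B)) * V = (π c : 𝓜(ℂ, B)) * W) : V = W :=
  ext_of_snd <| hπ.eq_of_right V.snd.continuous W.snd.continuous fun c y => by
    have := h c
    rw [coe_mul_eq, coe_mul_eq, coe_inj] at this
    rw [snd_mul, snd_mul, this]

/-- A multiplier of `C` acts on `B` through a nondegenerate homomorphism `C → B`. -/
lemma exists_extension (hπ : Nondegenerate π) (T : 𝓜(ℂ, C)) :
    ∃ V : 𝓜(ℂ, B), ∀ c, V * (π c : 𝓜(ℂ, B)) = (π (T.fst c) : B) := by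
  have hπc := continuous_hom π
  -- The extension is the strict limit of `π(T e)`: on the left `π(T e) π(c) y = π(T(ec)) y`, on the
  -- right `y π(c) π(T e) = y π((cT) e)`.
  obtain ⟨V, hV, -⟩ := exists_multiplier_of_tendsto (l := approxUnit C)
    (f := fun e => π (T.fst e)) (C := ‖T.fst‖)
    (eventually_norm_approxUnit.mono fun e he =>
      (NonUnitalStarAlgHom.norm_apply_le π _).trans <| (T.fst.le_opNorm e).trans <|
        mul_le_of_le_one_right (norm_nonneg _) he) hπ hπ.dense_right
    (by
      rintro _ ⟨p, rfl⟩
      refine ⟨π (T.fst p.1) * p.2, ?_⟩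
      have := ((((hπc.comp T.fst.continuous).tendsto _).comp
        (tendsto_approxUnit_mul p.1))).mul_const p.2
      simpa [Function.comp_def, mul_assoc, fst_mul] using this)
    (by
      rintro _ ⟨p, rfl⟩
      refine ⟨p.1 * π (T.snd p.2), ?_⟩
      have := ((hπc.tendsto _).comp (tendsto_mul_approxUnit (T.snd p.2))).const_mul p.1
      refine this.congr fun e => ?_
      rw [Function.comp_apply, T.central, map_mul, mul_assoc])
  refine ⟨V, fun c => ?_⟩
  rw [mul_coe_eq, coe_inj]
  refine tendsto_nhds_unique (hV _) ?_
  have := (((hπc.comp T.fst.continuous).tendsto _).comp (tendsto_approxUnit_mul c))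
  simpa [Function.comp_def, fst_mul] using this

/-- The extension of a nondegenerate homomorphism to multiplier algebras. -/
def extend (hπ : Nondegenerate π) (T : 𝓜(ℂ, C)) : 𝓜(ℂ, B) := (hπ.exists_extension T).choose

lemma extend_mul_coe (hπ : Nondegenerate π) (T : 𝓜(ℂ, C)) (c : C) :
    hπ.extend T * (π c : 𝓜(ℂ, B)) = (π (T.fst c) : B) := (hπ.exists_extension T).choose_spec c

lemma coe_mul_extend (hπ : Nondegenerate π) (T : 𝓜(ℂ, C)) (c : C) :
    (π c : 𝓜(ℂ, B)) * hπ.extend T = (π (T.snd c) : B) :=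
  hπ.ext_left fun d => by
    rw [mul_assoc, extend_mul_coe, ← coe_mul, ← coe_mul, ← map_mul, ← map_mul, T.central]

lemma extend_coe (hπ : Nondegenerate π) (c : C) :
    hπ.extend (c : 𝓜(ℂ, C)) = (π c : 𝓜(ℂ, B)) :=
  hπ.ext_left fun d => by
    rw [extend_mul_coe, ← coe_mul, ← map_mul]; rfl

lemma extend_one (hπ : Nondegenerate π) : hπ.extend 1 = 1 :=
  hπ.ext_left fun d => by rw [extend_mul_coe, one_mul]; rfl

lemma extend_mul (hπ : Nondegenerate π) (S T : 𝓜(ℂ, C)) :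
    hπ.extend (S * T) = hπ.extend S * hπ.extend T :=
  hπ.ext_left fun d => by rw [mul_assoc, extend_mul_coe, extend_mul_coe, extend_mul_coe]; rfl

lemma extend_star (hπ : Nondegenerate π) (T : 𝓜(ℂ, C)) :
    hπ.extend (star T) = star (hπ.extend T) :=
  hπ.ext_left fun d => by
    rw [extend_mul_coe, ← star_inj, star_mul, star_star, ← coe_star, ← coe_star, ← map_star π d,
      coe_mul_extend, DoubleCentralizer.star_fst, map_star π, star_star]

lemma extend_add (hπ : Nondegenerate π) (S T : 𝓜(ℂ, C)) :
    hπ.extend (S + T) = hπ.extend S + hπ.extend T :=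
  hπ.ext_left fun d => by
    rw [add_mul, extend_mul_coe, extend_mul_coe, extend_mul_coe]
    change ((π (S.fst d + T.fst d) : B) : 𝓜(ℂ, B)) = _
    rw [map_add]
    exact map_add (DoubleCentralizer.coeHom (𝕜 := ℂ) (A := B)) _ _

lemma extend_smul (hπ : Nondegenerate π) (z : ℂ) (T : 𝓜(ℂ, C)) :
    hπ.extend (z • T) = z • hπ.extend T :=
  hπ.ext_left fun d => by
    rw [smul_mul_assoc, extend_mul_coe, extend_mul_coe]
    change ((π (z • T.fst d) : B) : 𝓜(ℂ, B)) = _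
    rw [map_smul]
    exact map_smul (DoubleCentralizer.coeHom (𝕜 := ℂ) (A := B)) _ _

end Nondegenerate
end NondegenerateHoms

/-! ### Factoring an element through a fractional power of its modulus. -/

section Factorization

variable {B : Type v} [NonUnitalCStarAlgebra B]

/-- The function `t³ / (t⁴ + δ⁴)` is a regularised `1 / t` that vanishes at zero, as the non-unital
functional calculus requires. The error is `t δ⁴ / (t⁴ + δ⁴)`, estimated separately for `t ≤ δ` and
`t ≥ δ`. -/
lemma abs_mul_div_sub_le {t δ : ℝ} (ht : 0 ≤ t) (hδ : 0 < δ) :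
    |t ^ 3 / (t ^ 4 + δ ^ 4) * (t * t) - t| ≤ δ := by
  have h0 : 0 < t ^ 4 + δ ^ 4 := by positivity
  have h1 : t ^ 3 / (t ^ 4 + δ ^ 4) * (t * t) - t = -(t * δ ^ 4 / (t ^ 4 + δ ^ 4)) := by
    field_simp
    ring
  rw [h1, abs_neg, abs_of_nonneg (by positivity), div_le_iff₀ h0]
  rcases le_total t δ with h | h
  · nlinarith [mul_le_mul_of_nonneg_right h (pow_nonneg hδ.le 4),
      mul_nonneg hδ.le (pow_nonneg ht 4)]
  · have h2 : δ ^ 3 ≤ t ^ 3 := by gcongr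
    nlinarith [mul_le_mul_of_nonneg_left h2 (mul_nonneg ht hδ.le),
      mul_nonneg hδ.le (pow_nonneg hδ.le 4)]

/-- Every element `d` of a C⋆-algebra factors as `d = s y` with `s = (d d⋆)^{1/4}`. -/
lemma exists_factorization (d : B) :
    ∃ s d' : B, star s = s ∧ (s * s) * (s * s) = d * star d ∧ d = s * d' := by
  let _ := CStarAlgebra.spectralOrder B
  have := CStarAlgebra.spectralOrderedRing B
  have hh : 0 ≤ d * star d := mul_star_self_nonneg d
  set r := CFC.sqrt (d * star d)
  have hr : 0 ≤ r := CFC.sqrt_nonneg _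
  set s := CFC.sqrt r
  have hs : 0 ≤ s := CFC.sqrt_nonneg _
  have hsa : IsSelfAdjoint s := .of_nonneg hs
  have hs4 : (s * s) * (s * s) = d * star d := by
    rw [CFC.sqrt_mul_sqrt_self r hr, CFC.sqrt_mul_sqrt_self _ hh]
  -- Because `d d⋆ = s² (s²)⋆`, left multiplication by `a - c` gives `d` and `s²` the same norm.
  -- Estimates on `d` thereby reduce to functional calculus in `s`; the scalar `c` stands in for a
  -- unit.
  have hnorm : ∀ (a : B) (c : ℂ), ‖a * d - c • d‖ = ‖a * (s * s) - c • (s * s)‖ := by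
    intro a c
    have h1 : (a * d - c • d) * star (a * d - c • d)
        = (a * (s * s) - c • (s * s)) * star (a * (s * s) - c • (s * s)) := by
      simp only [star_sub, star_mul, star_smul, sub_mul, mul_sub, smul_mul_assoc, mul_smul_comm,
        mul_assoc, hsa.star_eq]
      simp only [mul_assoc] at hs4
      have hs5 : ∀ y, s * (s * (s * (s * y))) = d * (star d * y) := fun y => by
        simpa only [mul_assoc] using congrArg (· * y) hs4
      simp only [hs4, hs5]
    have h2 := congrArg norm h1
    rw [CStarRing.norm_self_mul_star, CStarRing.norm_self_mul_star] at h2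
    exact (mul_self_inj (norm_nonneg _) (norm_nonneg _)).1 h2
  let g : ℝ → ℝ → ℝ := fun δ t => t ^ 3 / (t ^ 4 + δ ^ 4)
  have hg : ∀ δ, 0 < δ → Continuous (g δ) := fun δ hδ =>
    Continuous.div (by fun_prop) (by fun_prop) fun t => by positivity
  have hg0 : ∀ δ, g δ 0 = 0 := fun δ => by simp [g]
  have hspec : ∀ t ∈ quasispectrum ℝ s, 0 ≤ t := fun t ht =>
    quasispectrum_nonneg_of_nonneg s hs t ht
  have hss : s * s = cfcₙ (fun t : ℝ => t * t) s := by
    rw [cfcₙ_mul (fun t : ℝ => t) (fun t : ℝ => t) s, cfcₙ_id' ℝ s]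
  have hGs : ∀ δ, 0 < δ → cfcₙ (g δ) s * (s * s) = cfcₙ (fun t => g δ t * (t * t)) s := by
    intro δ hδ
    have := (hg δ hδ).continuousOn (s := quasispectrum ℝ s)
    rw [hss, cfcₙ_mul (g δ) (fun t : ℝ => t * t) s (hf0 := hg0 δ)]
  have hGd : ∀ δ, 0 < δ → ‖cfcₙ (g δ) s * (s * s) - s‖ ≤ δ := by
    intro δ hδ
    have h1 := (hg δ hδ).continuousOn (s := quasispectrum ℝ s)
    rw [hGs δ hδ]
    conv_lhs => enter [1, 2]; rw [← cfcₙ_id' ℝ s]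
    rw [← cfcₙ_sub (fun t => g δ t * (t * t)) (fun t => t) s (by fun_prop) (by simp)]
    exact norm_cfcₙ_le fun t ht => abs_mul_div_sub_le (hspec t ht) hδ
  let δ : ℕ → ℝ := fun n => 1 / ((n : ℝ) + 1)
  have hδ : ∀ n, 0 < δ n := fun n => by positivity
  have hδ0 : Tendsto δ atTop (𝓝 0) := tendsto_one_div_add_atTop_nhds_zero_nat
  -- The second factor is formally `s⁻¹ d`; it is obtained as the limit of `g_δ(s) d` for `δ → 0`.
  have hcau : CauchySeq fun n => cfcₙ (g (δ n)) s * d := by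
    refine cauchySeq_of_le_tendsto_0 (fun n => δ n + δ n) (fun n m N hn hm => ?_)
      (by simpa using hδ0.add hδ0)
    have h1 := hnorm (cfcₙ (g (δ n)) s - cfcₙ (g (δ m)) s) 0
    rw [zero_smul, zero_smul, sub_zero, sub_zero, sub_mul, sub_mul] at h1
    rw [dist_eq_norm, h1]
    have h2 := hGd _ (hδ n)
    have h3 := hGd _ (hδ m)
    have h4 : ∀ n, N ≤ n → δ n ≤ δ N := fun n hn => by
      simp only [δ]; gcongr
    have h5 := norm_sub_le (cfcₙ (g (δ n)) s * (s * s) - s) (cfcₙ (g (δ m)) s * (s * s) - s)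
    rw [sub_sub_sub_cancel_right] at h5
    linarith [h4 n hn, h4 m hm]
  obtain ⟨d', hd'⟩ := cauchySeq_tendsto_of_complete hcau
  refine ⟨s, d', hsa.star_eq, hs4, ?_⟩
  refine tendsto_nhds_unique ?_ (hd'.const_mul s)
  rw [tendsto_iff_norm_sub_tendsto_zero]
  refine squeeze_zero (fun _ => norm_nonneg _) (fun n => ?_)
    (by simpa using hδ0.const_mul ‖s‖)
  have h1 := hnorm (s * cfcₙ (g (δ n)) s) 1
  rw [one_smul, one_smul] at h1
  rw [← mul_assoc, h1, mul_assoc, ← mul_sub]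
  exact (norm_mul_le _ _).trans (by gcongr; exact hGd _ (hδ n))

end Factorization

/-! ### Smallness of C⋆-algebras generated by small sets. -/

section Smallness

/-- Each point of the closure is the limit of a sequence in `s`, and the sequences in a small set
form a small type. -/
lemma small_closure_set {X : Type v} [TopologicalSpace X] [T2Space X] [FrechetUrysohnSpace X]
    (s : Set X) [Small.{u} s] : Small.{u} (closure s) := by
  rcases isEmpty_or_nonempty X with _ | _
  · exact small_of_injective (β := PEmpty.{u + 1}) (f := fun x => isEmptyElim x.1)
      fun x => isEmptyElim x.1
  refine small_subset (s := Set.range fun f : ℕ → s => limUnder atTop fun n => (f n : X)) ?_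
  intro x hx
  obtain ⟨f, hf, hx⟩ := mem_closure_iff_seq_limit.1 hx
  exact ⟨fun n => ⟨f n, hf n⟩, hx.limUnder_eq⟩

lemma small_subsemigroup_closure {X : Type v} [Semigroup X] (s : Set X) [Small.{u} s] :
    Small.{u} (Subsemigroup.closure s : Set X) := by
  let f : FreeSemigroup (Shrink.{u} s) →ₙ* X :=
    FreeSemigroup.lift fun x => ((equivShrink s).symm x : X)
  refine small_subset (s := Set.range f) ?_
  change Subsemigroup.closure s ≤ f.srange
  rw [Subsemigroup.closure_le]
  intro x hx
  refine ⟨FreeSemigroup.of (equivShrink s ⟨x, hx⟩), ?_⟩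
  simp [f]

/-- The generated ⋆-algebra is the linear span of the words in `s ∪ star s`, and a small set has few
words. This lets a product over representations in `Type u` control representations in all
universes. -/
lemma small_adjoin_closure {B : Type v} [NonUnitalCStarAlgebra B] (s : Set B) [Small.{u} s] :
    Small.{u} (NonUnitalStarAlgebra.adjoin ℂ s).topologicalClosure := by
  have h0 : Small.{u} (star s : Set B) :=
    small_of_injective (β := s) (f := fun x => ⟨star x.1, x.2⟩) fun x y h =>
      Subtype.ext (star_injective (congrArg Subtype.val h))
  have h1 := small_subsemigroup_closure.{u} (s ∪ star s)
  have h2 := Submodule.small_span.{u} (R := ℂ) (Subsemigroup.closure (s ∪ star s) : Set B)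
  have h3 : ((NonUnitalStarAlgebra.adjoin ℂ s : NonUnitalStarSubalgebra ℂ B) : Set B)
      = (Submodule.span ℂ (Subsemigroup.closure (s ∪ star s) : Set B) : Set B) := by
    rw [← NonUnitalAlgebra.adjoin_eq_span]
    rfl
  have h4 : Small.{u}
      ((NonUnitalStarAlgebra.adjoin ℂ s : NonUnitalStarSubalgebra ℂ B) : Set B) := by
    rw [h3]; exact h2
  exact small_closure_set.{u}
    ((NonUnitalStarAlgebra.adjoin ℂ s : NonUnitalStarSubalgebra ℂ B) : Set B)

/-- Transport of a C⋆-algebra structure along a bijection. -/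
abbrev transferCStar {X : Type u} {D : Type v} [NonUnitalCStarAlgebra D] (e : X ≃ D) :
    NonUnitalCStarAlgebra X :=
  letI : NonUnitalRing X := e.nonUnitalRing
  letI : Module ℂ X := e.module ℂ
  letI f : X →ₙ+* D := { toFun := e, map_mul' := fun x y => e.apply_symm_apply _,
                         map_zero' := e.apply_symm_apply _,
                         map_add' := fun x y => e.apply_symm_apply _ }
  letI : NonUnitalNormedRing X := NonUnitalNormedRing.induced X D f e.injective
  { (inferInstance : NonUnitalNormedRing X), (inferInstance : Module ℂ X) with
    star := fun x => e.symm (star (e x))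
    star_involutive := fun x => by
      change e.symm (star (e (e.symm (star (e x))))) = x
      simp
    star_mul := fun x y => by
      change e.symm (star (e (e.symm (e x * e y)))) =
        e.symm (e (e.symm (star (e y))) * e (e.symm (star (e x))))
      simp
    star_add := fun x y => by
      change e.symm (star (e (e.symm (e x + e y)))) =
        e.symm (e (e.symm (star (e x))) + e (e.symm (star (e y))))
      simp
    complete := by
      have h : IsUniformInducing e := ⟨rfl⟩
      have : CompleteSpace X :=
        (completeSpace_congr (e := e) ⟨h, e.injective⟩).2 inferInstance
      exact fun {f} hf => CompleteSpace.complete hf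
    norm_mul_self_le := fun x => by
      change ‖e x‖ * ‖e x‖ ≤ ‖e (e.symm (e (e.symm (star (e x))) * e x))‖
      simp [CStarRing.norm_star_mul_self]
    norm_smul_le := fun c x => by
      change ‖e (e.symm (c • e x))‖ ≤ ‖c‖ * ‖e x‖
      rw [e.apply_symm_apply]
      exact norm_smul_le c (e x)
    smul_assoc := fun c x y => by
      change e.symm (e (e.symm (c • e x)) * e y) = e.symm (c • e (e.symm (e x * e y)))
      simp [smul_mul_assoc]
    smul_comm := fun c x y => by
      change e.symm (c • e (e.symm (e x * e y))) = e.symm (e x * e (e.symm (c • e y)))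
      simp [mul_smul_comm]
    star_smul := fun c x => by
      change e.symm (star (e (e.symm (c • e x)))) = e.symm (star c • e (e.symm (star (e x))))
      simp }

lemma exists_starAlgEquiv_of_small (D : Type v) [NonUnitalCStarAlgebra D] [Small.{u} D] :
    ∃ (X : Type u) (_ : NonUnitalCStarAlgebra X), Nonempty (X ≃⋆ₐ[ℂ] D) := by
  let e := (equivShrink.{u} D).symm
  refine ⟨Shrink.{u} D, transferCStar e, ⟨?_⟩⟩
  letI := transferCStar e
  exact
    { e with
      map_mul' := fun x y => e.apply_symm_apply _
      map_add' := fun x y => e.apply_symm_apply _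
      map_star' := fun x => e.apply_symm_apply _
      map_smul' := fun c x => e.apply_symm_apply _ }

end Smallness

/-! ### The universal property of the relative Cuntz–Pimsner algebra. -/

section UniversalProperty

variable {A : Type u} [NonUnitalCStarAlgebra A] [PartialOrder A] [StarOrderedRing A]
variable {E : HilbertBimodule A} {J : Set A} {hJ : ∀ a ∈ J, E.lact a ∈ E.compacts}

lemma HilbertBimodule.compacts_induction {p : E.compacts → Prop} (hp : IsClosed {K | p K})
    (h : ∀ K (hK : K ∈ E.compacts), K ∈ Submodule.span ℂ
      (Set.range fun p : E.carrier × E.carrier => E.rankOne p.1 p.2) → p ⟨K, hK⟩)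
    (K : E.compacts) : p K := by
  obtain ⟨K, hK⟩ := K
  obtain ⟨f, hf, hfK⟩ := mem_closure_iff_seq_limit.1 hK
  have h2 : Tendsto (fun n => (⟨f n, Submodule.le_topologicalClosure _ (hf n)⟩ : E.compacts))
      atTop (𝓝 ⟨K, hK⟩) := tendsto_subtype_rng.2 hfK
  exact hp.mem_of_tendsto h2 (Eventually.of_forall fun n => h _ _ (hf n))

lemma HilbertBimodule.compacts_mem (E : HilbertBimodule A) {B : Type v} [NonUnitalCStarAlgebra B]
    (D : Submodule ℂ B) (hD : IsClosed (D : Set B)) (T : E.compacts →L[ℂ] B)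
    (h : ∀ m n, T ⟨E.rankOne m n, E.rankOne_mem m n⟩ ∈ D) (K : E.compacts) : T K ∈ D := by
  refine E.compacts_induction (p := fun K => T K ∈ D) (hD.preimage T.continuous)
    (fun K hK hKs => ?_) K
  induction hKs using Submodule.span_induction with
  | mem K h' =>
    obtain ⟨p, rfl⟩ := h'
    exact h _ _
  | zero => exact (map_zero T).symm ▸ zero_mem D
  | add K K' h₁ h₂ h h' =>
    have := add_mem (h (Submodule.le_topologicalClosure _ h₁))
      (h' (Submodule.le_topologicalClosure _ h₂))
    rwa [← map_add] at this
  | smul c K h₁ h =>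
    have := D.smul_mem c (h (Submodule.le_topologicalClosure _ h₁))
    rwa [← map_smul] at this

namespace RelCP

/-- The coordinate of `𝒪(J, E)` at a coisometric representation. -/
def eval (r : CoisometricRep E J hJ) : RelCP E J hJ →⋆ₙₐ[ℂ] r.B where
  toFun x := (x.1 : ∀ r : CoisometricRep E J hJ, r.B) r
  map_smul' _ _ := rfl
  map_zero' := rfl
  map_add' _ _ := rfl
  map_mul' _ _ := rfl
  map_star' _ := rfl

/-- A closed ⋆-subalgebra of `𝒪(J, E)` that contains the generators is everything. -/
lemma mem_of_generators (D : NonUnitalStarSubalgebra ℂ (RelCP E J hJ))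
    (hD : IsClosed (D : Set (RelCP E J hJ))) (hA : ∀ a, kA E J hJ a ∈ D)
    (hM : ∀ m, (k E J hJ).ψ m ∈ D) (x : RelCP E J hJ) : x ∈ D := by
  let ι : RelCP E J hJ →⋆ₙₐ[ℂ] RepProduct E J hJ :=
    NonUnitalStarSubalgebraClass.subtype (relCP E J hJ)
  have hι : Topology.IsClosedEmbedding ι :=
    (inferInstance : IsClosed (relCP E J hJ : Set (RepProduct E J hJ))).isClosedEmbedding_subtypeVal
  have hle : relCP E J hJ ≤ D.map ι := by
    refine NonUnitalStarSubalgebra.topologicalClosure_minimal _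
      (NonUnitalStarAlgebra.adjoin_le ?_) ?_
    · rintro _ (⟨a, rfl⟩ | ⟨m, rfl⟩)
      · exact ⟨_, hA a, rfl⟩
      · exact ⟨_, hM m, rfl⟩
    · rw [NonUnitalStarSubalgebra.coe_map]
      exact hι.isClosedMap _ hD
  obtain ⟨y, hy, hyx⟩ := hle x.2
  have : y = x := hι.injective hyx
  exact this ▸ hy

lemma hom_ext {B : Type v} [NonUnitalCStarAlgebra B] {f g : RelCP E J hJ →⋆ₙₐ[ℂ] B}
    (hA : ∀ a, f (kA E J hJ a) = g (kA E J hJ a))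
    (hM : ∀ m, f ((k E J hJ).ψ m) = g ((k E J hJ).ψ m)) : f = g :=
  NonUnitalStarAlgHom.ext fun x =>
    mem_of_generators (NonUnitalStarAlgHom.equalizer f g)
      (isClosed_eq (continuous_hom f) (continuous_hom g)) hA hM x

end RelCP

/-- The universal property of `𝒪(J, E)`, for representations in C⋆-algebras of any universe. -/
lemma Rep.IsCoisometric.exists_lift {B : Type v} [NonUnitalCStarAlgebra B] {π : A →⋆ₙₐ[ℂ] B}
    {r : Rep E π} (hr : r.IsCoisometric J hJ) :
    ∃ θ : RelCP E J hJ →⋆ₙₐ[ℂ] B, (∀ a, θ (kA E J hJ a) = π a) ∧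
      ∀ m, θ ((k E J hJ).ψ m) = r.ψ m := by
  let s : Set B := Set.range π ∪ Set.range r.ψ
  let D := (NonUnitalStarAlgebra.adjoin ℂ s).topologicalClosure
  have hDc : IsClosed (D : Set B) := NonUnitalStarSubalgebra.isClosed_topologicalClosure _
  have hsD : s ⊆ D := fun x hx => NonUnitalStarSubalgebra.le_topologicalClosure _
    (NonUnitalStarAlgebra.subset_adjoin ℂ _ hx)
  -- The generators come from `A` and `E`, which live in `Type u`. So the algebra they generate has
  -- a copy `X` in `Type u`, and the representation, moved to `X`, is one of the coordinates of the
  -- product that contains `𝒪(J, E)`.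
  have hDs : Small.{u} D := small_adjoin_closure.{u} s
  obtain ⟨X, _, ⟨e⟩⟩ := exists_starAlgEquiv_of_small.{u} D
  let ε : X →⋆ₙₐ[ℂ] B := (NonUnitalStarSubalgebraClass.subtype D).comp (e : X →⋆ₙₐ[ℂ] D)
  have hε : Function.Injective ε := Subtype.val_injective.comp e.injective
  have hεs : ∀ d (hd : d ∈ D), ε (e.symm ⟨d, hd⟩) = d := fun d hd =>
    congrArg Subtype.val (e.apply_symm_apply ⟨d, hd⟩)
  let π' : A →⋆ₙₐ[ℂ] X := (e.symm : D →⋆ₙₐ[ℂ] X).comp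
    (NonUnitalStarAlgHom.codRestrict π D fun a => hsD (Or.inl ⟨a, rfl⟩))
  have hπ' : ∀ a, ε (π' a) = π a := fun a => hεs _ _
  let eL : D →ₗ[ℂ] X := ((e.symm : D →⋆ₙₐ[ℂ] X) : D →ₗ[ℂ] X)
  let ψ' : E.carrier →ₗ[ℂ] X := eL.comp
    (r.ψ.codRestrict D.toNonUnitalSubalgebra.toSubmodule fun m => hsD (Or.inr ⟨m, rfl⟩))
  have hψ' : ∀ m, ε (ψ' m) = r.ψ m := fun m => hεs _ _
  let r' : Rep E π' :=
    { ψ := ψ'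
      map_ract := fun a m => hε <| by rw [map_mul, hψ', hψ', hπ', r.map_ract]
      star_mul_map := fun m n => hε <| by rw [map_mul, map_star, hψ', hψ', hπ', r.star_mul_map]
      map_lact := fun a m => hε <| by rw [map_mul, hψ', hψ', hπ', r.map_lact] }
  obtain ⟨T, hT, hTJ⟩ := hr
  -- Coisometry can be transported to `X` because `T` takes rank-one operators, and hence all
  -- compact operators, into the generated subalgebra.
  have hTD : ∀ K, T K ∈ D := by
    exact E.compacts_mem D.toNonUnitalSubalgebra.toSubmodule hDc T fun m n => by
      rw [hT]
      exact D.mul_mem (hsD (Or.inr ⟨_, rfl⟩)) (star_mem (s := D) (hsD (Or.inr ⟨_, rfl⟩)))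
  let T' : E.compacts →L[ℂ] X := 
    { toLinearMap :=
        eL.comp ((T : E.compacts →ₗ[ℂ] B).codRestrict D.toNonUnitalSubalgebra.toSubmodule hTD)
      cont := (continuous_hom (e.symm : D →⋆ₙₐ[ℂ] X)).comp (T.continuous.subtype_mk hTD) }
  have hT' : ∀ K, ε (T' K) = T K := fun K => hεs _ _
  let R : CoisometricRep E J hJ :=
    { B := X
      π := π'
      rep := r'
      coisometric := ⟨T', fun m n => hε <| by
        rw [hT', hT, map_mul, map_star]
        exact congrArg₂ (fun a b => a * star b) (hψ' m).symm (hψ' n).symm, fun a ha => hε <| by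
        rw [hT', hTJ a ha, hπ']⟩ }
  exact ⟨ε.comp (RelCP.eval R), hπ', hψ'⟩

end UniversalProperty

/-! ### Contractivity of the induced maps on compact operators. -/

section CompactOperators

variable {A : Type u} [NonUnitalCStarAlgebra A] [PartialOrder A] [StarOrderedRing A]
variable {E : HilbertBimodule A}

lemma HilbertBimodule.rankOne_apply (m n p : E.carrier) :
    E.rankOne m n p = E.ract (E.inner n p) m := rfl

lemma HilbertBimodule.inner_sum_rankOne {ι : Type*} (s : Finset ι) (m n : ι → E.carrier)
    (x y : E.carrier) :
    E.inner x ((∑ i ∈ s, E.rankOne (m i) (n i)) y)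
      = E.inner ((∑ i ∈ s, E.rankOne (n i) (m i)) x) y := by
  simp only [sum_apply, map_sum, LinearMap.sum_apply, E.rankOne_apply,
    E.inner_ract, E.inner_ract_left, E.star_inner]

/-- The two sums are adjoint to each other, and `‖Θx‖² = ‖⟨Θ'Θx, x⟩‖ ≤ ‖Θ'‖ ‖Θx‖ ‖x‖`. -/
lemma HilbertBimodule.norm_sum_rankOne_le {ι : Type*} (s : Finset ι) (m n : ι → E.carrier) :
    ‖∑ i ∈ s, E.rankOne (m i) (n i)‖ ≤ ‖∑ i ∈ s, E.rankOne (n i) (m i)‖ := by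
  set Θ := ∑ i ∈ s, E.rankOne (m i) (n i)
  set Θ' := ∑ i ∈ s, E.rankOne (n i) (m i)
  refine ContinuousLinearMap.opNorm_le_bound _ (norm_nonneg _) fun x => ?_
  have h1 : ‖Θ x‖ * ‖Θ x‖ ≤ ‖Θ'‖ * ‖x‖ * ‖Θ x‖ := by
    rw [← sq, E.norm_sq, E.inner_sum_rankOne]
    refine (E.norm_inner_le _ _).trans ?_
    calc ‖Θ' (Θ x)‖ * ‖x‖ ≤ ‖Θ'‖ * ‖Θ x‖ * ‖x‖ := by gcongr; exact Θ'.le_opNorm _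
      _ = _ := by ring
  rcases (norm_nonneg (Θ x)).eq_or_lt with h | h
  · rw [← h]; positivity
  · exact le_of_mul_le_mul_right h1 h

variable {B : Type v} [NonUnitalCStarAlgebra B] {π : A →⋆ₙₐ[ℂ] B}

lemma Rep.sum_mul_map (r : Rep E π) {ι : Type*} (s : Finset ι) (m n : ι → E.carrier)
    (p : E.carrier) : (∑ i ∈ s, r.ψ (m i) * star (r.ψ (n i))) * r.ψ p
      = r.ψ ((∑ i ∈ s, E.rankOne (m i) (n i)) p) := by
  simp only [sum_apply, map_sum, E.rankOne_apply, r.map_ract, Finset.sum_mul, mul_assoc,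
    r.star_mul_map]

/-- The homomorphism `(ψ, π)^{(1)}` of `𝒦(E)` is contractive on finite-rank operators. -/
lemma Rep.norm_sum_le (r : Rep E π) {ι : Type*} (s : Finset ι) (m n : ι → E.carrier) :
    ‖∑ i ∈ s, r.ψ (m i) * star (r.ψ (n i))‖ ≤ ‖∑ i ∈ s, E.rankOne (m i) (n i)‖ := by
  set k := ∑ i ∈ s, r.ψ (m i) * star (r.ψ (n i)) with hk
  set Θ := ∑ i ∈ s, E.rankOne (m i) (n i)
  set Θ' := ∑ i ∈ s, E.rankOne (n i) (m i)
  have hk' : star k = ∑ i ∈ s, r.ψ (n i) * star (r.ψ (m i)) := by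
    rw [hk, star_sum]
    simp only [star_mul, star_star]
  have hΘ : ‖Θ'‖ ≤ ‖Θ‖ := E.norm_sum_rankOne_le s n m
  set S : E.carrier →L[ℂ] E.carrier := Θ' * Θ with hS
  have hSn : ‖S‖ ≤ ‖Θ‖ ^ 2 := by
    refine (ContinuousLinearMap.opNorm_comp_le Θ' Θ).trans ?_
    rw [sq]; gcongr
  have hkS : ∀ p, star k * k * r.ψ p = r.ψ (S p) := fun p => by
    rw [mul_assoc, r.sum_mul_map, hk', r.sum_mul_map]; rfl
  -- Replacing `‖Θ‖²` by a larger `t` makes division by `t` legitimate when `Θ = 0`.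
  suffices h : ∀ t, ‖Θ‖ ^ 2 < t → ‖k‖ ^ 2 ≤ t from
    le_of_sq_le_sq (le_of_forall_gt_imp_ge_of_dense h) (norm_nonneg _)
  intro t ht
  have ht0 : 0 < t := (sq_nonneg _).trans_lt ht
  have hSt : ‖S‖ ≤ t := hSn.trans ht.le
  set a₀ : ι → E.carrier := fun i => Θ' (m i)
  -- A spectral radius argument. Here `h` is `(k⋆k)^(2^j)`, whose norm is the corresponding power of
  -- `‖k‖²` by repeated use of the C⋆-identity. It is again a sum over the same finite set with the
  -- same `n i`, and its vectors `a i` grow at most like `t^(2^j - 1)`; the last clause is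
  -- multiplied by `t` to avoid the subtraction in the exponent.
  have claim : ∀ j : ℕ, ∃ (h : B) (a : ι → E.carrier), star h = h ∧
      ‖h‖ = (‖k‖ ^ 2) ^ 2 ^ j ∧ h = ∑ i ∈ s, r.ψ (a i) * star (r.ψ (n i)) ∧
      (∀ p, ∃ p', ‖p'‖ ≤ t ^ 2 ^ j * ‖p‖ ∧ h * r.ψ p = r.ψ p') ∧
      ∀ i, t * ‖a i‖ ≤ t ^ 2 ^ j * ‖a₀ i‖ := by
    intro j
    induction j with
    | zero =>
      refine ⟨star k * k, a₀, ?_, ?_, ?_, fun p => ⟨S p, ?_, hkS p⟩, fun i => ?_⟩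
      · rw [star_mul, star_star]
      · rw [CStarRing.norm_star_mul_self, sq, pow_zero, pow_one]
      · conv_lhs => rw [hk]
        rw [Finset.mul_sum]
        refine Finset.sum_congr rfl fun i _ => ?_
        rw [← mul_assoc, ← hk, hk', r.sum_mul_map]
      · rw [pow_zero, pow_one]
        exact S.le_of_opNorm_le hSt p
      · rw [pow_zero, pow_one]
    | succ j ih =>
      obtain ⟨h, a, hs, hn, ha, hp, hb⟩ := ih
      choose f hf hfp using hp
      refine ⟨h * h, fun i => f (a i), ?_, ?_, ?_, fun p => ⟨f (f p), ?_, ?_⟩, fun i => ?_⟩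
      · rw [star_mul, hs]
      · conv_lhs => enter [1, 1]; rw [← hs]
        rw [CStarRing.norm_star_mul_self, hn]
        ring
      · conv_lhs => enter [2]; rw [ha]
        rw [Finset.mul_sum]
        refine Finset.sum_congr rfl fun i _ => ?_
        rw [← mul_assoc, hfp]
      · calc ‖f (f p)‖ ≤ t ^ 2 ^ j * (t ^ 2 ^ j * ‖p‖) := (hf _).trans (by gcongr; exact hf p)
          _ = _ := by ring
      · rw [mul_assoc, hfp, hfp]
      · calc t * ‖f (a i)‖ ≤ t * (t ^ 2 ^ j * ‖a i‖) := by gcongr; exact hf _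
          _ = t ^ 2 ^ j * (t * ‖a i‖) := by ring
          _ ≤ t ^ 2 ^ j * (t ^ 2 ^ j * ‖a₀ i‖) := mul_le_mul_of_nonneg_left (hb i) (by positivity)
          _ = _ := by ring
  set c := ∑ i ∈ s, ‖a₀ i‖ * ‖n i‖
  have hc : ∀ j : ℕ, (‖k‖ ^ 2 / t) ^ 2 ^ j ≤ c / t := by
    intro j
    obtain ⟨h, a, -, hn, ha, -, hb⟩ := claim j
    have h1 : ‖h‖ ≤ ∑ i ∈ s, ‖a i‖ * ‖n i‖ := by
      rw [ha]
      refine (_root_.norm_sum_le _ _).trans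
        (Finset.sum_le_sum fun i _ => (norm_mul_le _ _).trans ?_)
      rw [norm_star]
      exact mul_le_mul (r.norm_le _) (r.norm_le _) (norm_nonneg _) (norm_nonneg _)
    have h2 : t * ‖h‖ ≤ t ^ 2 ^ j * c := by
      refine (mul_le_mul_of_nonneg_left h1 ht0.le).trans ?_
      rw [Finset.mul_sum, Finset.mul_sum]
      refine Finset.sum_le_sum fun i _ => ?_
      rw [← mul_assoc, ← mul_assoc]
      exact mul_le_mul_of_nonneg_right (hb i) (norm_nonneg _)
    rw [div_pow, div_le_div_iff₀ (by positivity) ht0, ← hn]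
    linarith
  -- If `‖k‖² > t`, the powers of `‖k‖² / t` would be unbounded, against the bound `c / t` that is
  -- independent of `j`.
  by_contra! hlt
  have h1 : 1 < ‖k‖ ^ 2 / t := (one_lt_div ht0).2 hlt
  obtain ⟨N, hN⟩ := pow_unbounded_of_one_lt (c / t) h1
  have h2 : (‖k‖ ^ 2 / t) ^ N ≤ (‖k‖ ^ 2 / t) ^ 2 ^ N :=
    pow_le_pow_right₀ h1.le Nat.lt_two_pow_self.le
  linarith [hc N]

/-- Passes from finite-rank operators to all of `𝒦(E)` by density. The bound does not depend on the
representation, which is what makes the direct sum of these maps well defined. -/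
lemma Rep.norm_compacts_le (r : Rep E π) {T : E.compacts →L[ℂ] B}
    (hT : ∀ m n, T ⟨E.rankOne m n, E.rankOne_mem m n⟩ = r.ψ m * star (r.ψ n)) (K : E.compacts) :
    ‖T K‖ ≤ ‖(K : E.carrier →L[ℂ] E.carrier)‖ := by
  refine E.compacts_induction (p := fun K => ‖T K‖ ≤ ‖(K : E.carrier →L[ℂ] E.carrier)‖)
    (isClosed_le T.continuous.norm continuous_subtype_val.norm) (fun K hK hKs => ?_) K
  obtain ⟨N, c, g, rfl⟩ := Submodule.mem_span_set'.1 hKs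
  choose p hp using fun i => (g i).2
  have h1 : ∑ i, c i • (g i : E.carrier →L[ℂ] E.carrier)
      = ∑ i, E.rankOne (c i • (p i).1) (p i).2 :=
    Finset.sum_congr rfl fun i _ => by
      rw [← hp i]
      ext x
      simp [E.rankOne_apply]
  have h2 : T ⟨_, hK⟩ = ∑ i, r.ψ (c i • (p i).1) * star (r.ψ (p i).2) := by
    have : (⟨_, hK⟩ : E.compacts) = ∑ i, ⟨_, E.rankOne_mem (c i • (p i).1) (p i).2⟩ :=
      Subtype.ext (h1.trans (by simp))
    rw [this, map_sum]
    exact Finset.sum_congr rfl fun i _ => hT _ _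
  rw [h2]
  exact (r.norm_sum_le _ _ _).trans (congrArg norm h1).ge

variable {J : Set A} {hJ : ∀ a ∈ J, E.lact a ∈ E.compacts}

/-- The universal representation is coisometric on `J`. -/
lemma isCoisometric_k : (k E J hJ).IsCoisometric J hJ := by
  choose T hT hTJ using fun r : CoisometricRep E J hJ => r.coisometric
  -- The uniform bound puts the family `(T_r K)_r` in the product of bounded families.
  have hb : ∀ K r, ‖T r K‖ ≤ ‖(K : E.carrier →L[ℂ] E.carrier)‖ := fun K r =>
    r.rep.norm_compacts_le (hT r) K
  let T' : E.compacts →ₗ[ℂ] RepProduct E J hJ :=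
    { toFun := fun K => ⟨fun r => T r K, memℓp_infty ⟨‖(K : E.carrier →L[ℂ] E.carrier)‖, by
        rintro _ ⟨r, rfl⟩
        exact hb K r⟩⟩
      map_add' := fun K K' => Subtype.ext <| funext fun r => map_add (T r) K K'
      map_smul' := fun c K => Subtype.ext <| funext fun r => map_smul (T r) c K }
  have hT'c : Continuous T' :=
    AddMonoidHomClass.continuous_of_bound T' 1 fun K => by
      rw [one_mul]
      exact lp.norm_le_of_forall_le (norm_nonneg _) (hb K)
  have hT'm : ∀ K, T' K ∈ relCP E J hJ :=
    E.compacts_mem (relCP E J hJ).toNonUnitalSubalgebra.toSubmodule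
      (NonUnitalStarSubalgebra.isClosed_topologicalClosure _) ⟨T', hT'c⟩ fun m n => by
      have : T' ⟨_, E.rankOne_mem m n⟩ = prodM E J hJ m * star (prodM E J hJ n) :=
        Subtype.ext <| funext fun r => hT r m n
      exact this ▸ (relCP E J hJ).mul_mem (prodM_mem E J hJ m)
        (star_mem (s := relCP E J hJ) (prodM_mem E J hJ n))
  refine ⟨⟨T'.codRestrict (relCP E J hJ).toNonUnitalSubalgebra.toSubmodule hT'm,
    hT'c.subtype_mk hT'm⟩, fun m n => ?_, fun a ha => ?_⟩
  · exact Subtype.ext <| Subtype.ext <| funext fun r => hT r m n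
  · exact Subtype.ext <| Subtype.ext <| funext fun r => hTJ r a ha

end CompactOperators

/-! ### Approximate units on Hilbert modules, and identities for the transfer operator. -/

section ExelSystemLemmas

variable {A : Type u} [NonUnitalCStarAlgebra A] [PartialOrder A] [StarOrderedRing A]

/-- Expanding `⟨m·e - m, m·e - m⟩` bounds the squared distance by `2 ‖⟨m, m⟩ e - ⟨m, m⟩‖` as soon as
`‖e‖ ≤ 1`. -/
lemma HilbertBimodule.tendsto_ract_approxUnit (E : HilbertBimodule A) (m : E.carrier) :
    Tendsto (fun e => E.ract e m) (approxUnit A) (𝓝 m) := by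
  rw [tendsto_iff_norm_sub_tendsto_zero]
  have h1 : ∀ e, ‖E.ract e m - m‖ ^ 2 =
      ‖star e * E.inner m m * e - star e * E.inner m m - (E.inner m m * e - E.inner m m)‖ := by
    intro e
    rw [E.norm_sq]
    simp only [map_sub, LinearMap.sub_apply, E.inner_ract, E.inner_ract_left]
    congr 1
    abel
  have h2 : Tendsto (fun e => E.inner m m * e - E.inner m m) (approxUnit A) (𝓝 0) := by
    simpa using (tendsto_mul_approxUnit (E.inner m m)).sub_const (E.inner m m)
  have h3 : Tendsto (fun e => ‖E.ract e m - m‖ ^ 2) (approxUnit A) (𝓝 0) := by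
    refine squeeze_zero' (Eventually.of_forall fun e => sq_nonneg _)
      (eventually_norm_approxUnit.mono fun e he => ?_)
      (by simpa using h2.norm.const_mul 2)
    rw [h1, mul_assoc, ← mul_sub]
    refine (norm_sub_le _ _).trans ?_
    rw [two_mul]
    gcongr
    refine (norm_mul_le _ _).trans ?_
    rw [norm_star]
    exact mul_le_of_le_one_left (norm_nonneg _) he
  have h4 := h3.sqrt
  simpa [Real.sqrt_sq (norm_nonneg _)] using h4

namespace ExelSystem

variable (S : ExelSystem A)

/-- The transfer identity at the multiplier `1`, with `Lbar 1 = 1`. This is the source of `V⋆V = 1`.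
-/
lemma L_alpha (a : A) : S.L (S.α a) = a := by
  have := S.transfer a 1
  rwa [S.Lbar_one] at this

lemma q_mul (a b : A) : S.q (a * b) = S.M.lact a (S.q b) :=
  (S.preModule.lactC_coe a b).symm

lemma q_mul_alpha (a b : A) : S.q (a * S.α b) = S.M.ract b (S.q a) :=
  (S.preModule.ractC_coe b a).symm

lemma inner_q (a b : A) : S.M.inner (S.q a) (S.q b) = S.L (star a * b) :=
  S.preModule.innerC_coe a b

lemma denseRange_q : DenseRange S.q :=
  UniformSpace.Completion.denseRange_coe (α := S.preModule.carrier)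

lemma exists_norm_q_le : ∃ C : ℝ, ∀ a : A, ‖S.q a‖ ≤ C * ‖a‖ := by
  obtain ⟨C, hC⟩ := S.L.exists_norm_apply_le
  refine ⟨√C, fun a => le_of_sq_le_sq ?_ (by positivity)⟩
  rw [S.M.norm_sq, inner_q, mul_pow, Real.sq_sqrt C.coe_nonneg]
  refine (hC _).trans ?_
  rw [CStarRing.norm_star_mul_self, sq]

lemma continuous_q : Continuous S.q := by
  obtain ⟨C, hC⟩ := S.exists_norm_q_le
  exact AddMonoidHomClass.continuous_of_bound S.q C hC

end ExelSystem
end ExelSystemLemmas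

/-! ### The canonical isometry. -/

section Isometry

variable {A : Type u} [NonUnitalCStarAlgebra A] [PartialOrder A] [StarOrderedRing A]

lemma Rep.continuous {E : HilbertBimodule A} {B : Type v} [NonUnitalCStarAlgebra B]
    {π : A →⋆ₙₐ[ℂ] B} (r : Rep E π) : Continuous r.ψ :=
  AddMonoidHomClass.continuous_of_bound r.ψ 1 fun m => by rw [one_mul]; exact r.norm_le m

/-- The elements on which an approximate unit acts as one from both sides form a C⋆-algebra. -/
def approxUnitSubalgebra {C : Type u} {B : Type v} [NonUnitalCStarAlgebra C]
    [NonUnitalCStarAlgebra B] (π : C →⋆ₙₐ[ℂ] B) : NonUnitalStarSubalgebra ℂ B where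
  carrier := {x | Tendsto (fun e => π e * x) (approxUnit C) (𝓝 x) ∧
    Tendsto (fun e => π e * star x) (approxUnit C) (𝓝 (star x))}
  add_mem' {x y} hx hy := ⟨by simpa only [mul_add] using hx.1.add hy.1,
    by simpa only [mul_add, star_add] using hx.2.add hy.2⟩
  zero_mem' := by simp
  mul_mem' {x y} hx hy := ⟨by simpa only [mul_assoc] using hx.1.mul_const y,
    by simpa only [mul_assoc, star_mul] using hy.2.mul_const (star x)⟩
  smul_mem' c x hx := ⟨by simpa only [mul_smul_comm] using hx.1.const_smul c,
    by simpa only [mul_smul_comm, star_smul] using hx.2.const_smul (star c)⟩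
  star_mem' hx := ⟨hx.2, by simpa only [star_star] using hx.1⟩

lemma isClosed_tendsto_mul {C : Type u} {B : Type v} [NonUnitalCStarAlgebra C]
    [NonUnitalCStarAlgebra B] (π : C →⋆ₙₐ[ℂ] B) :
    IsClosed {x | Tendsto (fun e => π e * x) (approxUnit C) (𝓝 x)} := by
  rw [← closure_subset_iff_isClosed]
  intro x hx
  rw [Set.mem_ofPred_eq, Metric.tendsto_nhds]
  intro ε hε
  obtain ⟨y, hy, hxy⟩ := Metric.mem_closure_iff.1 hx (ε / 3) (by positivity)
  filter_upwards [Metric.tendsto_nhds.1 hy (ε / 3) (by positivity),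
    eventually_norm_map_approxUnit π] with e h1 h2
  have h3 : dist (π e * x) (π e * y) ≤ dist x y := by
    rw [dist_eq_norm, ← mul_sub, dist_eq_norm]
    exact (norm_mul_le _ _).trans (mul_le_of_le_one_left (norm_nonneg _) h2)
  linarith [dist_triangle4 (π e * x) (π e * y) y x, dist_comm x y]

lemma isClosed_approxUnitSubalgebra {C : Type u} {B : Type v} [NonUnitalCStarAlgebra C]
    [NonUnitalCStarAlgebra B] (π : C →⋆ₙₐ[ℂ] B) :
    IsClosed (approxUnitSubalgebra π : Set B) :=
  (isClosed_tendsto_mul π).inter ((isClosed_tendsto_mul π).preimage continuous_star)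

variable (S : ExelSystem A) (J : Set A) (hJ : ∀ a ∈ J, S.M.lact a ∈ S.M.compacts)

/-- It suffices that `k_A(e)` acts as an approximate unit on the generators and their adjoints. For
`k_M(q(a))` this holds since `k_A(e) k_M(q(a)) = k_M(q(ea))`; for `k_M(m)⋆` it is the adjoint of
`k_M(m·e) → k_M(m)`. -/
lemma nondegenerate_kA : Nondegenerate (kA S.M J hJ) := by
  refine Nondegenerate.of_tendsto fun x => ?_
  refine (RelCP.mem_of_generators (approxUnitSubalgebra (kA S.M J hJ))
    (isClosed_approxUnitSubalgebra _) (fun a => ?_) (fun m => ?_) x).1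
  · have h : ∀ a : A, Tendsto (fun e => kA S.M J hJ e * kA S.M J hJ a) (approxUnit A)
        (𝓝 (kA S.M J hJ a)) := fun a => by
      have := ((continuous_hom (kA S.M J hJ)).tendsto a).comp (tendsto_approxUnit_mul a)
      simpa only [Function.comp_def, map_mul] using this
    exact ⟨h a, by simpa only [map_star] using h (star a)⟩
  · constructor
    · have hcl : IsClosed {m : S.M.carrier |
          Tendsto (fun e => kA S.M J hJ e * (k S.M J hJ).ψ m) (approxUnit A)
            (𝓝 ((k S.M J hJ).ψ m))} :=
        (isClosed_tendsto_mul (kA S.M J hJ)).preimage (k S.M J hJ).continuous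
      refine S.denseRange_q.induction_on
        (p := fun m => Tendsto (fun e => kA S.M J hJ e * (k S.M J hJ).ψ m) (approxUnit A)
          (𝓝 ((k S.M J hJ).ψ m))) m hcl fun a => ?_
      have := (((k S.M J hJ).continuous.comp S.continuous_q).tendsto a).comp
        (tendsto_approxUnit_mul a)
      refine this.congr fun e => ?_
      rw [Function.comp_apply, Function.comp_apply, S.q_mul, (k S.M J hJ).map_lact]
    · have h := ((((k S.M J hJ).continuous.tendsto m).comp
        (S.M.tendsto_ract_approxUnit m))).star
      refine h.congr' (eventually_star_approxUnit.mono fun e he => ?_)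
      rw [Function.comp_apply, (k S.M J hJ).map_ract, star_mul, ← map_star, he]

/-- The canonical isometry implements `k_M ∘ q` and `k_M ∘ q ∘ α`. -/
lemma exists_isometry : ∃ V : 𝓜(ℂ, RelCP S.M J hJ),
    (∀ a, (kA S.M J hJ a : 𝓜(ℂ, RelCP S.M J hJ)) * V = ((k S.M J hJ).ψ (S.q a) : RelCP S.M J hJ)) ∧
    (∀ a, V * (kA S.M J hJ a : 𝓜(ℂ, RelCP S.M J hJ))
      = ((k S.M J hJ).ψ (S.q (S.α a)) : RelCP S.M J hJ)) ∧
    ∀ x, Tendsto (fun e => (k S.M J hJ).ψ (S.q e) * x) (approxUnit A) (𝓝 (V.fst x)) := by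
  obtain ⟨C, hC⟩ := S.exists_norm_q_le
  have hnd := nondegenerate_kA S J hJ
  have hc := (k S.M J hJ).continuous.comp S.continuous_q
  -- `q(e) · a = q(e α(a))` gives the limit on the left and, below, `a · q(e) = q(ae)` the limit on
  -- the right. Together they make `k_M(q(e))` strictly convergent.
  have h1 : ∀ a y, Tendsto (fun e => (k S.M J hJ).ψ (S.q e) * (kA S.M J hJ a * y)) (approxUnit A)
      (𝓝 ((k S.M J hJ).ψ (S.q (S.α a)) * y)) := fun a y => by
    have := ((hc.tendsto (S.α a)).comp (tendsto_approxUnit_mul (S.α a))).mul_const y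
    refine this.congr fun e => ?_
    rw [Function.comp_apply, Function.comp_apply, S.q_mul_alpha, (k S.M J hJ).map_ract, mul_assoc]
  have h2 : ∀ a y, Tendsto (fun e => y * kA S.M J hJ a * (k S.M J hJ).ψ (S.q e)) (approxUnit A)
      (𝓝 (y * (k S.M J hJ).ψ (S.q a))) := fun a y => by
    have := ((hc.tendsto a).comp (tendsto_mul_approxUnit a)).const_mul y
    refine this.congr fun e => ?_
    rw [Function.comp_apply, Function.comp_apply, S.q_mul, (k S.M J hJ).map_lact, mul_assoc]
  obtain ⟨V, hV, hV'⟩ := exists_multiplier_of_tendsto (l := approxUnit A)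
    -- The constant `C` is not known to be nonnegative.
    (f := fun e => (k S.M J hJ).ψ (S.q e)) (C := max C 0)
    (eventually_norm_approxUnit.mono fun e he => ((k S.M J hJ).norm_le _).trans <| (hC e).trans <|
      (mul_le_mul_of_nonneg_right (le_max_left C 0) (norm_nonneg e)).trans
        (mul_le_of_le_one_right (le_max_right C 0) he)) hnd hnd.dense_right
    (by rintro _ ⟨p, rfl⟩; exact ⟨_, h1 p.1 p.2⟩) (by rintro _ ⟨p, rfl⟩; exact ⟨_, h2 p.2 p.1⟩)
  refine ⟨V, fun a => hnd.ext_right fun b => ?_, fun a => hnd.ext_left fun b => ?_, hV⟩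
  · rw [← mul_assoc, ← coe_mul, coe_mul_eq, ← coe_mul, coe_inj]
    exact tendsto_nhds_unique (hV' _) (h2 a _)
  · rw [mul_assoc, ← coe_mul, mul_coe_eq, ← coe_mul, coe_inj]
    exact tendsto_nhds_unique (hV _) (h1 a _)

/-- The isometry `V ∈ M(𝒪(J, M_L))` with `k_M(q(a)) = k_A(a) V`. -/
def isom : 𝓜(ℂ, RelCP S.M J hJ) := (exists_isometry S J hJ).choose

lemma kA_mul_isom (a : A) : (kA S.M J hJ a : 𝓜(ℂ, RelCP S.M J hJ)) * isom S J hJ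
    = ((k S.M J hJ).ψ (S.q a) : RelCP S.M J hJ) :=
  (exists_isometry S J hJ).choose_spec.1 a

lemma isom_mul_kA (a : A) : isom S J hJ * (kA S.M J hJ a : 𝓜(ℂ, RelCP S.M J hJ))
    = ((k S.M J hJ).ψ (S.q (S.α a)) : RelCP S.M J hJ) :=
  (exists_isometry S J hJ).choose_spec.2.1 a

/-- Between `k_A(b)` and `k_A(a)` the product `V⋆V` becomes `k_M(q(α(b⋆)))⋆ k_M(q(α(a))) =
k_A(L(α(b) α(a))) = k_A(ba)`. -/
lemma star_isom_mul_isom : star (isom S J hJ) * isom S J hJ = 1 := by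
  have hnd := nondegenerate_kA S J hJ
  refine hnd.ext_left fun a => hnd.ext_right fun b => ?_
  have h1 : (kA S.M J hJ b : 𝓜(ℂ, RelCP S.M J hJ)) * star (isom S J hJ)
      = star (isom S J hJ * (kA S.M J hJ (star b) : 𝓜(ℂ, RelCP S.M J hJ))) := by
    rw [star_mul, ← coe_star, ← map_star, star_star]
  rw [one_mul, mul_assoc, isom_mul_kA, ← mul_assoc, h1, isom_mul_kA, ← coe_star, ← coe_mul,
    (k S.M J hJ).star_mul_map, S.inner_q, ← map_star, star_star, S.L_alpha_mul, S.L_alpha, map_mul,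
    coe_mul]

/-- Uniqueness holds among all multipliers, not only isometries, because `k_A` is nondegenerate. -/
lemma eq_isom {W : 𝓜(ℂ, RelCP S.M J hJ)} (hW : ∀ a : A,
    ((k S.M J hJ).ψ (S.q a) : 𝓜(ℂ, RelCP S.M J hJ)) = kA S.M J hJ a * W) : W = isom S J hJ :=
  (nondegenerate_kA S J hJ).ext_right fun a => by rw [kA_mul_isom, ← hW]

/-- The gauge action scales `V`. -/
lemma gauge_isom_fst (z : Circle) (x : RelCP S.M J hJ) :
    gauge S.M J hJ z ((isom S J hJ).fst x)
      = (z : ℂ) • (isom S J hJ).fst (gauge S.M J hJ z x) := by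
  have h := (exists_isometry S J hJ).choose_spec.2.2
  have h1 := ((continuous_hom (gauge S.M J hJ z)).tendsto _).comp (h x)
  refine tendsto_nhds_unique h1 (((h (gauge S.M J hJ z x)).const_smul (z : ℂ)).congr fun e => ?_)
  rw [Function.comp_apply, map_mul, gauge_kM, smul_mul_assoc]

end Isometry

/-! ### Homogeneous multipliers for the gauge action, and the core. -/

section Homogeneous

variable {A : Type u} [NonUnitalCStarAlgebra A] [PartialOrder A] [StarOrderedRing A]
variable {E : HilbertBimodule A} {J : Set A} {hJ : ∀ a ∈ J, E.lact a ∈ E.compacts}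

lemma gauge_gauge_inv (z : Circle) (x : RelCP E J hJ) :
    gauge E J hJ z (gauge E J hJ z⁻¹ x) = x := by
  have h : (gauge E J hJ z).comp (gauge E J hJ z⁻¹) = NonUnitalStarAlgHom.id ℂ (RelCP E J hJ) := by
    refine RelCP.hom_ext (fun a => ?_) fun m => ?_
    · rw [NonUnitalStarAlgHom.comp_apply, gauge_kA, gauge_kA]; rfl
    · rw [NonUnitalStarAlgHom.comp_apply, gauge_kM, map_smul, gauge_kM, smul_smul,
        ← Circle.coe_mul, inv_mul_cancel, Circle.coe_one, one_smul]
      rfl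
  exact DFunLike.congr_fun h x

lemma norm_gauge_le (z : Circle) (x : RelCP E J hJ) : ‖gauge E J hJ z x‖ ≤ ‖x‖ :=
  NonUnitalStarAlgHom.norm_apply_le _ x

/-- The multiplier `T` of `𝒪(J, E)` is homogeneous of degree `n` for the gauge action. -/
def IsHomogeneous (n : ℤ) (T : 𝓜(ℂ, RelCP E J hJ)) : Prop :=
  ∀ z x, gauge E J hJ z (T.fst x) = ((z ^ n : Circle) : ℂ) • T.fst (gauge E J hJ z x)

/-- Each `γ_z` is onto, with right inverse `γ_{z⁻¹}`, so testing against `γ_z(w)` includes testing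
against `(x - y)⋆`. -/
lemma eq_of_mul_gauge {z : Circle} {x y : RelCP E J hJ}
    (h : ∀ w, x * gauge E J hJ z w = y * gauge E J hJ z w) : x = y := by
  have h1 := h (gauge E J hJ z⁻¹ (star (x - y)))
  rw [gauge_gauge_inv] at h1
  rw [← sub_eq_zero, ← CStarRing.mul_star_self_eq_zero_iff, sub_mul, h1, sub_self]

namespace IsHomogeneous

lemma snd {n : ℤ} {T : 𝓜(ℂ, RelCP E J hJ)} (h : IsHomogeneous n T) (z : Circle)
    (x : RelCP E J hJ) :
    gauge E J hJ z (T.snd x) = ((z ^ n : Circle) : ℂ) • T.snd (gauge E J hJ z x) :=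
  eq_of_mul_gauge (z := z) fun w => by
    rw [← map_mul, T.central, map_mul, h, smul_mul_assoc, T.central, mul_smul_comm]

lemma mul {m n : ℤ} {S T : 𝓜(ℂ, RelCP E J hJ)} (hS : IsHomogeneous m S) (hT : IsHomogeneous n T) :
    IsHomogeneous (m + n) (S * T) := fun z x => by
  change gauge E J hJ z (S.fst (T.fst x)) = _ • S.fst (T.fst _)
  rw [hS, hT, map_smul, smul_smul, ← Circle.coe_mul, zpow_add]

lemma star {n : ℤ} {T : 𝓜(ℂ, RelCP E J hJ)} (h : IsHomogeneous n T) :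
    IsHomogeneous (-n) (star T) := fun z x => by
  rw [DoubleCentralizer.star_fst, DoubleCentralizer.star_fst, map_star, h.snd, star_smul, map_star,
    zpow_neg, Circle.coe_inv_eq_conj]
  rfl

lemma coe {n : ℤ} {x : RelCP E J hJ} (h : ∀ z, gauge E J hJ z x = ((z ^ n : Circle) : ℂ) • x) :
    IsHomogeneous n (x : 𝓜(ℂ, RelCP E J hJ)) := fun z y => by
  change gauge E J hJ z (x * y) = _ • (x * _)
  rw [map_mul, h, smul_mul_assoc]

lemma gauge_eq {n : ℤ} {x : RelCP E J hJ} (h : IsHomogeneous n (x : 𝓜(ℂ, RelCP E J hJ)))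
    (z : Circle) : gauge E J hJ z x = ((z ^ n : Circle) : ℂ) • x :=
  eq_of_mul_gauge (z := z) fun w => by
    rw [← map_mul, smul_mul_assoc]
    exact h z w

lemma one : IsHomogeneous 0 (1 : 𝓜(ℂ, RelCP E J hJ)) := fun z x => by
  rw [zpow_zero, Circle.coe_one, one_smul]; rfl

lemma pow {n : ℤ} {T : 𝓜(ℂ, RelCP E J hJ)} (h : IsHomogeneous n T) (i : ℕ) :
    IsHomogeneous (i * n) (T ^ i) := by
  induction i with
  | zero => simpa using one
  | succ i ih =>
    rw [pow_succ, Nat.cast_succ, add_mul, one_mul]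
    exact ih.mul h

lemma kM (m : E.carrier) :
    IsHomogeneous 1 ((k E J hJ).ψ m : 𝓜(ℂ, RelCP E J hJ)) :=
  coe fun z => by rw [zpow_one, gauge_kM]

lemma kA (a : A) : IsHomogeneous 0 (kA E J hJ a : 𝓜(ℂ, RelCP E J hJ)) :=
  coe fun z => by rw [zpow_zero, Circle.coe_one, one_smul, gauge_kA]

lemma coreIncl (c : Core E J hJ) : IsHomogeneous 0 (coreIncl E J hJ c : 𝓜(ℂ, RelCP E J hJ)) :=
  coe fun z => by rw [zpow_zero, Circle.coe_one, one_smul]; exact c.2 z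

end IsHomogeneous

variable (E J hJ) in
lemma coreIncl_injective : Function.Injective (coreIncl E J hJ) := Subtype.val_injective

lemma core_ext {c d : Core E J hJ}
    (h : (coreIncl E J hJ c : 𝓜(ℂ, RelCP E J hJ)) = coreIncl E J hJ d) : c = d :=
  coreIncl_injective _ _ _ (coe_injective h)

lemma continuous_to_core {X : Type*} [TopologicalSpace X] {f : X → Core E J hJ}
    (h : Continuous fun x => coreIncl E J hJ (f x)) : Continuous f :=
  continuous_induced_rng.2 h

/-- The element of the core given by an element that is homogeneous of degree `0`. -/
def coreMk (x : RelCP E J hJ) (h : IsHomogeneous 0 (x : 𝓜(ℂ, RelCP E J hJ))) : Core E J hJ :=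
  ⟨x, fun z => by simpa using h.gauge_eq z⟩

lemma coreIncl_coreMk (x : RelCP E J hJ) (h : IsHomogeneous 0 (x : 𝓜(ℂ, RelCP E J hJ))) :
    coreIncl E J hJ (coreMk x h) = x := rfl

/-- A multiplier of `𝒪(J, E)` that is homogeneous of degree `0` restricts to the core. -/
def coreRestrict (T : 𝓜(ℂ, RelCP E J hJ)) (hT : IsHomogeneous 0 T) : 𝓜(ℂ, Core E J hJ) where
  fst := LinearMap.mkContinuous
    { toFun := fun c => coreMk (T.fst (coreIncl E J hJ c)) (by
        rw [← mul_coe_eq]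
        exact hT.mul (.coreIncl c))
      map_add' := fun x y => Subtype.ext <| map_add T.fst x.1 y.1
      map_smul' := fun c x => Subtype.ext <| map_smul T.fst c x.1 }
    ‖T.fst‖ fun x => T.fst.le_opNorm x.1
  snd := LinearMap.mkContinuous
    { toFun := fun c => coreMk (T.snd (coreIncl E J hJ c)) (by
        rw [← coe_mul_eq]
        exact (IsHomogeneous.coreIncl c).mul hT)
      map_add' := fun x y => Subtype.ext <| map_add T.snd x.1 y.1
      map_smul' := fun c x => Subtype.ext <| map_smul T.snd c x.1 }
    ‖T.snd‖ fun x => T.snd.le_opNorm x.1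
  central x y := Subtype.ext <| T.central x.1 y.1

lemma coreRestrict_fst (T : 𝓜(ℂ, RelCP E J hJ)) (hT : IsHomogeneous 0 T) (c : Core E J hJ) :
    coreIncl E J hJ ((coreRestrict T hT).fst c) = T.fst (coreIncl E J hJ c) := rfl

lemma coreRestrict_snd (T : 𝓜(ℂ, RelCP E J hJ)) (hT : IsHomogeneous 0 T) (c : Core E J hJ) :
    coreIncl E J hJ ((coreRestrict T hT).snd c) = T.snd (coreIncl E J hJ c) := rfl

/-- Each tensor factor contributes one `z`. Consequently `k_M^{⊗ i}(m) k_M^{⊗ i}(n)⋆` lies in the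
core. -/
lemma pow_gauge (i : ℕ) (m : (E.pow i).carrier) (z : Circle) :
    gauge E J hJ z (((k E J hJ).pow i).ψ m)
      = ((z ^ (i : ℤ) : Circle) : ℂ) • ((k E J hJ).pow i).ψ m := by
  induction i with
  | zero =>
    rw [Nat.cast_zero, zpow_zero, Circle.coe_one, one_smul]
    exact gauge_kA E J hJ z m
  | succ i ih =>
    -- Both sides are continuous in `m`, so algebraic tensors suffice, and then elementary ones.
    refine Rep.tensor_induction (E := E) (F := E.pow i) (p := fun m => gauge E J hJ z
      (((k E J hJ).pow (i + 1)).ψ m) = ((z ^ ((i + 1 : ℕ) : ℤ) : Circle) : ℂ) •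
        ((k E J hJ).pow (i + 1)).ψ m) m
      (isClosed_eq ((continuous_hom _).comp (Rep.continuous _))
        ((Rep.continuous ((k E J hJ).pow (i + 1))).const_smul
          ((z ^ ((i + 1 : ℕ) : ℤ) : Circle) : ℂ))) fun y => ?_
    have h1 : ((k E J hJ).pow (i + 1)).ψ ((E.tensorPre (E.pow i)).toCompletion y)
        = (k E J hJ).tensorAlg ((k E J hJ).pow i) y := Rep.tensorL_coe _ _ y
    rw [h1]
    change E.carrier ⊗[ℂ] (E.pow i).carrier at y
    induction y with
    | zero => simp
    | add x y hx hy =>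
      rw [map_add, map_add, smul_add, hx, hy]
      all_goals exact Rep.tensorL_coe _ _ _
    | tmul m n =>
      rw [Rep.tensorAlg_tmul, map_mul, ih, gauge_kM, smul_mul_smul_comm, ← Circle.coe_mul,
        Nat.cast_succ, zpow_add_one, mul_comm z]

end Homogeneous

/-! ### The endomorphism `Ad V` of the core and its strict extension. -/

section CoreEndomorphism

variable {A : Type u} [NonUnitalCStarAlgebra A] [PartialOrder A] [StarOrderedRing A]
variable (S : ExelSystem A) (J : Set A) (hJ : ∀ a ∈ J, S.M.lact a ∈ S.M.compacts)

lemma isHomogeneous_isom : IsHomogeneous 1 (isom S J hJ) := fun z x => by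
  rw [zpow_one, gauge_isom_fst]

lemma star_isom_mul_isom_mul (T : 𝓜(ℂ, RelCP S.M J hJ)) :
    star (isom S J hJ) * (isom S J hJ * T) = T := by
  rw [← mul_assoc, star_isom_mul_isom, one_mul]

/-- The map `c ↦ V c V⋆` on the core. -/
def adIsomFun (c : Core S.M J hJ) : Core S.M J hJ :=
  coreMk ((isom S J hJ).fst ((star (isom S J hJ)).snd (coreIncl S.M J hJ c))) (by
    rw [← mul_coe_eq, ← coe_mul_eq]
    exact (isHomogeneous_isom S J hJ).mul
      ((IsHomogeneous.coreIncl c).mul (isHomogeneous_isom S J hJ).star))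

lemma coe_adIsomFun (c : Core S.M J hJ) :
    (coreIncl S.M J hJ (adIsomFun S J hJ c) : 𝓜(ℂ, RelCP S.M J hJ))
      = isom S J hJ * (coreIncl S.M J hJ c : 𝓜(ℂ, RelCP S.M J hJ)) * star (isom S J hJ) := by
  rw [mul_assoc, coe_mul_eq, mul_coe_eq]
  rfl

/-- The endomorphism `Ad V` of the core. -/
def adIsom : Core S.M J hJ →⋆ₙₐ[ℂ] Core S.M J hJ where
  toFun := adIsomFun S J hJ
  map_smul' z c := coreIncl_injective _ _ _ <| by
    simp only [adIsomFun, map_smul, coreIncl_coreMk]; rfl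
  map_zero' := coreIncl_injective _ _ _ <| by simp only [adIsomFun, map_zero, coreIncl_coreMk]
  map_add' c d := coreIncl_injective _ _ _ <| by simp only [adIsomFun, map_add, coreIncl_coreMk]
  map_mul' c d := core_ext <| by
    rw [map_mul, coe_mul, coe_adIsomFun, coe_adIsomFun, coe_adIsomFun, map_mul, coe_mul]
    simp only [mul_assoc, star_isom_mul_isom_mul]
  map_star' c := core_ext <| by
    rw [map_star, coe_star, coe_adIsomFun, coe_adIsomFun, map_star, coe_star, star_mul, star_mul,
      star_star, mul_assoc]

lemma coe_adIsom (c : Core S.M J hJ) :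
    (coreIncl S.M J hJ (adIsom S J hJ c) : 𝓜(ℂ, RelCP S.M J hJ))
      = isom S J hJ * (coreIncl S.M J hJ c : 𝓜(ℂ, RelCP S.M J hJ)) * star (isom S J hJ) :=
  coe_adIsomFun S J hJ c

/-- Compression by `V` is a left inverse: `V⋆ (V c V⋆) V = c`. -/
lemma adIsom_injective : Function.Injective (adIsom S J hJ) := fun c d h => by
  have h1 : (coreIncl S.M J hJ (adIsom S J hJ c) : 𝓜(ℂ, RelCP S.M J hJ))
      = coreIncl S.M J hJ (adIsom S J hJ d) := by rw [h]
  rw [coe_adIsom, coe_adIsom] at h1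
  have h2 := congrArg (fun T => star (isom S J hJ) * T * isom S J hJ) h1
  simp only [mul_assoc, star_isom_mul_isom_mul, star_isom_mul_isom, mul_one] at h2
  exact core_ext h2

/-- Compression `c ↦ V⋆ c V` of the core. -/
def compress (c : Core S.M J hJ) : Core S.M J hJ :=
  coreMk ((star (isom S J hJ)).fst ((isom S J hJ).snd (coreIncl S.M J hJ c))) (by
    rw [← mul_coe_eq, ← coe_mul_eq]
    exact (isHomogeneous_isom S J hJ).star.mul
      ((IsHomogeneous.coreIncl c).mul (isHomogeneous_isom S J hJ)))

lemma coe_compress (c : Core S.M J hJ) :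
    (coreIncl S.M J hJ (compress S J hJ c) : 𝓜(ℂ, RelCP S.M J hJ))
      = star (isom S J hJ) * ((coreIncl S.M J hJ c : 𝓜(ℂ, RelCP S.M J hJ)) * isom S J hJ) := by
  rw [coe_mul_eq, mul_coe_eq]
  rfl

/-- The core contains `k_A(A)`, which already acts nondegenerately. -/
lemma nondegenerate_coreIncl : Nondegenerate (coreIncl S.M J hJ) := by
  refine (nondegenerate_kA S J hJ).mono (Submodule.span_mono ?_)
  rintro _ ⟨p, rfl⟩
  exact ⟨(coreMk (kA S.M J hJ p.1) (.kA p.1), p.2), rfl⟩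

/-- On products `c y` with `c` in the core, the extension acts by `c y ↦ (T c) y`, and `γ_z` fixes
both `c` and `T c`. -/
lemma isHomogeneous_extend (T : 𝓜(ℂ, Core S.M J hJ)) :
    IsHomogeneous 0 ((nondegenerate_coreIncl S J hJ).extend T) := fun z x => by
  set hnd := nondegenerate_coreIncl S J hJ
  have h1 : ∀ c y, (hnd.extend T).fst (coreIncl S.M J hJ c * y) = coreIncl S.M J hJ (T.fst c) * y :=
    fun c y => by
      have := hnd.extend_mul_coe T c
      rw [mul_coe_eq, coe_inj] at this
      rw [fst_mul, this]
  have h2 : ∀ c, gauge S.M J hJ z (coreIncl S.M J hJ c) = coreIncl S.M J hJ c := fun c => c.2 z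
  rw [zpow_zero, Circle.coe_one, one_smul]
  have hγ := continuous_hom (gauge S.M J hJ z)
  have hT := (hnd.extend T).fst.continuous
  refine hnd.eq_of_left (f := fun x => gauge S.M J hJ z ((hnd.extend T).fst x))
    (g := fun x => (hnd.extend T).fst (gauge S.M J hJ z x)) (hγ.comp hT) (hT.comp hγ)
    (fun c y => ?_) x
  rw [h1, map_mul, map_mul, h2, h2, h1]

lemma isHomogeneous_conj (T : 𝓜(ℂ, Core S.M J hJ)) : IsHomogeneous 0
    (isom S J hJ * (nondegenerate_coreIncl S J hJ).extend T * star (isom S J hJ)) :=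
  ((isHomogeneous_isom S J hJ).mul (isHomogeneous_extend S J hJ T)).mul
    (isHomogeneous_isom S J hJ).star

/-- The extension `T ↦ V T V⋆` of `Ad V` to the multiplier algebra of the core. -/
def adIsomBar : 𝓜(ℂ, Core S.M J hJ) →⋆ₙₐ[ℂ] 𝓜(ℂ, Core S.M J hJ) where
  toFun T := coreRestrict _ (isHomogeneous_conj S J hJ T)
  map_smul' z T := ext_of_fst fun c => coreIncl_injective _ _ _ <| by
    rw [coreRestrict_fst, Nondegenerate.extend_smul, mul_smul_comm, smul_mul_assoc]; rfl
  map_zero' := ext_of_fst fun c => coreIncl_injective _ _ _ <| by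
    rw [coreRestrict_fst]
    have := (nondegenerate_coreIncl S J hJ).extend_smul 0 0
    rw [zero_smul, zero_smul] at this
    rw [this, mul_zero, zero_mul]; rfl
  map_add' T T' := ext_of_fst fun c => coreIncl_injective _ _ _ <| by
    rw [coreRestrict_fst, Nondegenerate.extend_add, mul_add, add_mul]; rfl
  map_mul' T T' := ext_of_fst fun c => coreIncl_injective _ _ _ <| by
    change _ = coreIncl S.M J hJ ((coreRestrict _ (isHomogeneous_conj S J hJ T)).fst
      ((coreRestrict _ (isHomogeneous_conj S J hJ T')).fst c))
    rw [coreRestrict_fst, coreRestrict_fst, coreRestrict_fst, Nondegenerate.extend_mul, ← coe_inj,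
      ← mul_coe_eq, ← mul_coe_eq, ← mul_coe_eq]
    simp only [mul_assoc, star_isom_mul_isom_mul]
  map_star' T := ext_of_fst fun c => coreIncl_injective _ _ _ <| by
    rw [coreRestrict_fst, DoubleCentralizer.star_fst, map_star, coreRestrict_snd, map_star,
      ← DoubleCentralizer.star_fst, Nondegenerate.extend_star, star_mul, star_mul, star_star,
      mul_assoc]

lemma adIsomBar_fst (T : 𝓜(ℂ, Core S.M J hJ)) (c : Core S.M J hJ) :
    coreIncl S.M J hJ ((adIsomBar S J hJ T).fst c) = (isom S J hJ *
      (nondegenerate_coreIncl S J hJ).extend T * star (isom S J hJ)).fst (coreIncl S.M J hJ c) :=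
  rfl

lemma adIsomBar_snd (T : 𝓜(ℂ, Core S.M J hJ)) (c : Core S.M J hJ) :
    coreIncl S.M J hJ ((adIsomBar S J hJ T).snd c) = (isom S J hJ *
      (nondegenerate_coreIncl S J hJ).extend T * star (isom S J hJ)).snd (coreIncl S.M J hJ c) :=
  rfl

lemma adIsomBar_one_fst (c : Core S.M J hJ) : coreIncl S.M J hJ ((adIsomBar S J hJ 1).fst c)
    = (isom S J hJ * star (isom S J hJ)).fst (coreIncl S.M J hJ c) := by
  rw [adIsomBar_fst, Nondegenerate.extend_one, mul_one]

lemma adIsomBar_one_snd (c : Core S.M J hJ) : coreIncl S.M J hJ ((adIsomBar S J hJ 1).snd c)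
    = (isom S J hJ * star (isom S J hJ)).snd (coreIncl S.M J hJ c) := by
  rw [adIsomBar_snd, Nondegenerate.extend_one, mul_one]

/-- Two uses of the C⋆-identity: `(x s²)(x s²)⋆ = x s⁴ x⋆ = 0`, then `(x s)(x s)⋆ = x s² x⋆ = 0`. -/
lemma mul_eq_zero_of_mul_pow_four {M : Type*} [CStarAlgebra M] {x s : M} (hs : star s = s)
    (h : x * ((s * s) * (s * s)) = 0) : x * s = 0 := by
  have h2 : x * (s * s) = 0 := by
    rw [← CStarRing.mul_star_self_eq_zero_iff, star_mul, star_mul, hs,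
      show x * (s * s) * (s * s * star x) = x * ((s * s) * (s * s)) * star x by
        simp only [mul_assoc],
      h, zero_mul]
  rw [← CStarRing.mul_star_self_eq_zero_iff, star_mul, hs,
    show x * s * (s * star x) = x * (s * s) * star x by simp only [mul_assoc], h2, zero_mul]

/-- The key to strict continuity: `V T V⋆ c` depends on `T` only through the single vector `T e`.
Since `V⋆ c` has degree `-1`, `T` cannot be applied to it inside the core. Instead factor `V V⋆ c =
s d'` in the core with `V V⋆ s = s`; then `V T V⋆ c = V T (V⋆ s V) (V⋆ d')`, so `e = V⋆ s V` and `y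
= V⋆ d'`. -/
lemma exists_adIsomBar_fst (c : Core S.M J hJ) : ∃ (e : Core S.M J hJ) (y : RelCP S.M J hJ),
    ∀ T, coreIncl S.M J hJ ((adIsomBar S J hJ T).fst c)
      = (isom S J hJ).fst (coreIncl S.M J hJ (T.fst e) * y) := by
  set V := isom S J hJ with hV
  have hVV : star V * V = 1 := star_isom_mul_isom S J hJ
  set d := (adIsomBar S J hJ 1).fst c
  have hd : (coreIncl S.M J hJ d : 𝓜(ℂ, RelCP S.M J hJ)) = V * star V * coreIncl S.M J hJ c := by
    rw [adIsomBar_one_fst, mul_coe_eq]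
  obtain ⟨s, d', hs, hs4, hsd⟩ := exists_factorization d
  set σ := ((coreIncl S.M J hJ s : RelCP S.M J hJ) : 𝓜(ℂ, RelCP S.M J hJ))
  have hσ : star σ = σ := by rw [← coe_star, ← map_star, hs]
  have hσ4 : (σ * σ) * (σ * σ) = (coreIncl S.M J hJ d : 𝓜(ℂ, RelCP S.M J hJ)) *
      star (coreIncl S.M J hJ d : 𝓜(ℂ, RelCP S.M J hJ)) := by
    rw [← coe_star, ← coe_mul, ← coe_mul, ← coe_mul, ← map_star,
      ← map_mul, ← map_mul, ← map_mul, hs4]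
  -- `1 - V V⋆` kills `d`, hence `d d⋆ = s⁴`, hence `s`.
  have hP : V * star V * σ = σ := by
    have h1 : (1 - V * star V) * σ = 0 := by
      refine mul_eq_zero_of_mul_pow_four hσ ?_
      have h2 : V * star V * (coreIncl S.M J hJ d : 𝓜(ℂ, RelCP S.M J hJ))
          = coreIncl S.M J hJ d := by
        rw [hd, ← mul_assoc, ← mul_assoc, mul_assoc V, hVV, mul_one]
      rw [hσ4, ← mul_assoc, sub_mul, h2, one_mul, sub_self, zero_mul]
    rw [sub_mul, one_mul, sub_eq_zero] at h1
    exact h1.symm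
  have hP' : σ * (V * star V) = σ := by
    have := congrArg star hP
    rwa [star_mul, star_mul, star_star, hσ] at this
  refine ⟨compress S J hJ s, (star V).fst (coreIncl S.M J hJ d'), fun T => ?_⟩
  set R := (nondegenerate_coreIncl S J hJ).extend T with hR
  have h3 : star V * (coreIncl S.M J hJ c : 𝓜(ℂ, RelCP S.M J hJ))
      = star V * coreIncl S.M J hJ d := by
    rw [hd, ← mul_assoc, ← mul_assoc, hVV, one_mul]
  have h4 : star V * σ = coreIncl S.M J hJ (compress S J hJ s) * star V := by
    rw [coe_compress]
    conv_lhs => rw [← hP']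
    simp only [mul_assoc, V, σ]
  rw [adIsomBar_fst, ← coe_inj, ← mul_coe_eq, ← mul_coe_eq, coe_mul, ← mul_coe_eq,
    ← Nondegenerate.extend_mul_coe (nondegenerate_coreIncl S J hJ), mul_assoc, h3, hsd, map_mul,
    coe_mul, ← mul_assoc (star V), h4]
  simp only [mul_assoc, V]

lemma isStrictExtension_adIsomBar : IsStrictExtension (adIsom S J hJ) (adIsomBar S J hJ) where
  map_coe c := ext_of_fst fun d => coreIncl_injective _ _ _ <| by
    rw [adIsomBar_fst, Nondegenerate.extend_coe, ← coe_inj, ← mul_coe_eq, ← coe_adIsom, ← coe_mul]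
    rfl
  strictly_continuous := by
    let _ := strictTopology (Core S.M J hJ)
    have hi : Continuous fun T : 𝓜(ℂ, Core S.M J hJ) => (((fun c => T.fst c), fun c => T.snd c) :
        (Core S.M J hJ → Core S.M J hJ) × (Core S.M J hJ → Core S.M J hJ)) := continuous_induced_dom
    have hf : ∀ c : Core S.M J hJ, Continuous fun T : 𝓜(ℂ, Core S.M J hJ) => T.fst c := fun c =>
      (continuous_apply c).comp (continuous_fst.comp hi)
    have hg : ∀ c : Core S.M J hJ, Continuous fun T : 𝓜(ℂ, Core S.M J hJ) => T.snd c := fun c =>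
      (continuous_apply c).comp (continuous_snd.comp hi)
    have h1 : ∀ c, Continuous fun T => (adIsomBar S J hJ T).fst c := fun c => by
      obtain ⟨e, y, h⟩ := exists_adIsomBar_fst S J hJ c
      refine continuous_to_core ?_
      simp only [h]
      exact (isom S J hJ).fst.continuous.comp
        (((continuous_hom (coreIncl S.M J hJ)).comp (hf e)).mul continuous_const)
    -- The involution exchanges left and right multiplication, so continuity of the right half
    -- follows from that of the left half.
    have hstar : Continuous (star : 𝓜(ℂ, Core S.M J hJ) → 𝓜(ℂ, Core S.M J hJ)) :=
      continuous_induced_rng.2 <| (continuous_pi fun c => (hg (star c)).star).prodMk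
        (continuous_pi fun c => (hf (star c)).star)
    refine continuous_induced_rng.2 ((continuous_pi h1).prodMk (continuous_pi fun c => ?_))
    have h2 := ((h1 (star c)).comp hstar).star
    refine h2.congr fun T => ?_
    rw [Function.comp_apply, map_star (adIsomBar S J hJ), DoubleCentralizer.star_fst,
      star_star, star_star]

/-- The corner is reached through `V V⋆ c V V⋆ = V (V⋆ c V) V⋆`, where `V⋆ c V` lies in the core. -/
lemma range_adIsom : Set.range (adIsom S J hJ) =
    Set.range fun c => (adIsomBar S J hJ 1).fst ((adIsomBar S J hJ 1).snd c) := by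
  have h : ∀ c, (coreIncl S.M J hJ ((adIsomBar S J hJ 1).fst ((adIsomBar S J hJ 1).snd c)) :
      𝓜(ℂ, RelCP S.M J hJ)) = isom S J hJ * star (isom S J hJ) * coreIncl S.M J hJ c *
        (isom S J hJ * star (isom S J hJ)) := fun c => by
    rw [adIsomBar_one_fst, adIsomBar_one_snd, ← mul_coe_eq, ← coe_mul_eq, ← mul_assoc]
  ext x
  constructor
  · rintro ⟨c, rfl⟩
    refine ⟨adIsom S J hJ c, core_ext ?_⟩
    change (coreIncl S.M J hJ ((adIsomBar S J hJ 1).fst ((adIsomBar S J hJ 1).snd _)) :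
      𝓜(ℂ, RelCP S.M J hJ)) = _
    rw [h]
    simp only [coe_adIsom, mul_assoc, star_isom_mul_isom_mul]
  · rintro ⟨c, rfl⟩
    refine ⟨compress S J hJ c, core_ext ?_⟩
    change _ = (coreIncl S.M J hJ ((adIsomBar S J hJ 1).fst ((adIsomBar S J hJ 1).snd c)) :
      𝓜(ℂ, RelCP S.M J hJ))
    rw [h, coe_adIsom, coe_compress]
    simp only [mul_assoc]

lemma isStaceyCovariant_coreIncl :
    IsStaceyCovariant (adIsom S J hJ) (coreIncl S.M J hJ) (isom S J hJ) where
  nondegenerate := nondegenerate_coreIncl S J hJ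
  isometry := star_isom_mul_isom S J hJ
  covariant := coe_adIsom S J hJ

/-- `V k_A(a) = k_M(q(α(a)))` absorbs `V` into one further tensor factor; applied on both sides,
this gives the formula for `α'`. -/
lemma isom_mul_pow_lact (i : ℕ) (a : A) (m : (S.M.pow i).carrier) :
    isom S J hJ * (((k S.M J hJ).pow i).ψ ((S.M.pow i).lact a m) : RelCP S.M J hJ)
      = (((k S.M J hJ).pow (i + 1)).ψ (S.M.tmul (S.M.pow i) (S.q (S.α a)) m) : RelCP S.M J hJ) := by
  have h : ((k S.M J hJ).pow (i + 1)).ψ (S.M.tmul (S.M.pow i) (S.q (S.α a)) m)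
      = (k S.M J hJ).ψ (S.q (S.α a)) * ((k S.M J hJ).pow i).ψ m := Rep.tensorL_tmul _ _ _ _
  rw [h, ((k S.M J hJ).pow i).map_lact, coe_mul, coe_mul, ← mul_assoc, isom_mul_kA]

lemma adIsom_spanning (i : ℕ) (a b : A) (m n : (S.M.pow i).carrier) : ∃ c : Core S.M J hJ,
    coreIncl S.M J hJ c = ((k S.M J hJ).pow i).ψ ((S.M.pow i).lact a m) *
      star (((k S.M J hJ).pow i).ψ ((S.M.pow i).lact b n)) ∧
    coreIncl S.M J hJ (adIsom S J hJ c) =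
      ((k S.M J hJ).pow (i + 1)).ψ (S.M.tmul (S.M.pow i) (S.q (S.α a)) m) *
        star (((k S.M J hJ).pow (i + 1)).ψ (S.M.tmul (S.M.pow i) (S.q (S.α b)) n)) := by
  refine ⟨coreMk _ (IsHomogeneous.coe fun z => ?_), coreIncl_coreMk _ _, ?_⟩
  · rw [map_mul, map_star, pow_gauge, pow_gauge, star_smul, smul_mul_smul_comm, mul_comm,
      circle_star_mul, zpow_zero, Circle.coe_one]
  · rw [← coe_inj, coe_adIsom, coreIncl_coreMk, coe_mul, coe_mul, coe_star, coe_star,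
      ← isom_mul_pow_lact, ← isom_mul_pow_lact, star_mul]
    simp only [mul_assoc]

end CoreEndomorphism

/-! ### Finite averages of the gauge action as approximate conditional expectations. -/

section GaugeAverage

variable {A : Type u} [NonUnitalCStarAlgebra A] [PartialOrder A] [StarOrderedRing A]
variable {E : HilbertBimodule A} {J : Set A} {hJ : ∀ a ∈ J, E.lact a ∈ E.compacts}

/-- The `N`-th root of unity `exp(2πi/N)`. -/
def rootOfUnity (N : ℕ) : Circle := Circle.exp (2 * Real.pi / N)

lemma isPrimitiveRoot_rootOfUnity {N : ℕ} (hN : N ≠ 0) :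
    IsPrimitiveRoot (rootOfUnity N : ℂ) N := by
  have h : (rootOfUnity N : ℂ) = Complex.exp (2 * Real.pi * Complex.I / N) := by
    rw [rootOfUnity, Circle.coe_exp]
    congr 1
    push_cast
    ring
  rw [h]
  exact Complex.isPrimitiveRoot_exp N hN

variable (E J hJ) in
/-- The average of the gauge action over the `N`-th roots of unity. -/
def gaugeAverage (N : ℕ) (x : RelCP E J hJ) : RelCP E J hJ :=
  (N : ℂ)⁻¹ • ∑ i ∈ Finset.range N, gauge E J hJ (rootOfUnity N ^ i) x

lemma gaugeAverage_add (N : ℕ) (x y : RelCP E J hJ) :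
    gaugeAverage E J hJ N (x + y) = gaugeAverage E J hJ N x + gaugeAverage E J hJ N y := by
  simp only [gaugeAverage, map_add, Finset.sum_add_distrib, smul_add]

lemma gaugeAverage_smul (N : ℕ) (c : ℂ) (x : RelCP E J hJ) :
    gaugeAverage E J hJ N (c • x) = c • gaugeAverage E J hJ N x := by
  simp only [gaugeAverage, map_smul, ← Finset.smul_sum, smul_comm c]

lemma gaugeAverage_sub (N : ℕ) (x y : RelCP E J hJ) :
    gaugeAverage E J hJ N (x - y) = gaugeAverage E J hJ N x - gaugeAverage E J hJ N y := by
  simp only [gaugeAverage, map_sub, Finset.sum_sub_distrib, smul_sub]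

lemma norm_gaugeAverage_le (N : ℕ) (x : RelCP E J hJ) : ‖gaugeAverage E J hJ N x‖ ≤ ‖x‖ := by
  rw [gaugeAverage, norm_smul, norm_inv, Complex.norm_natCast]
  have h : ‖∑ i ∈ Finset.range N, gauge E J hJ (rootOfUnity N ^ i) x‖ ≤ N * ‖x‖ := by
    refine (norm_sum_le _ _).trans ((Finset.sum_le_sum fun i _ => norm_gauge_le _ x).trans ?_)
    rw [Finset.sum_const, Finset.card_range, nsmul_eq_mul]
  -- For `N = 0` the average is zero.
  rcases Nat.eq_zero_or_pos N with rfl | hN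
  · simp
  · have hN' : (0 : ℝ) < N := by exact_mod_cast hN
    rw [inv_mul_le_iff₀ hN']
    exact h

lemma gaugeAverage_coreIncl {N : ℕ} (hN : N ≠ 0) (c : Core E J hJ) :
    gaugeAverage E J hJ N (coreIncl E J hJ c) = coreIncl E J hJ c := by
  have h : ∀ z, gauge E J hJ z (coreIncl E J hJ c) = coreIncl E J hJ c := c.2
  simp only [gaugeAverage, h, Finset.sum_const, Finset.card_range]
  rw [← Nat.cast_smul_eq_nsmul ℂ, smul_smul, inv_mul_cancel₀ (by exact_mod_cast hN), one_smul]

/-- The average is a geometric sum of `ζⁿ`, an `N`-th root of unity different from `1` because `0 <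
|n| < N`. On a finite sum of homogeneous elements, averages of large order therefore keep exactly
the part of degree zero. -/
lemma gaugeAverage_eq_zero {N : ℕ} {n : ℤ} (hn : n ≠ 0) (hN : n.natAbs < N) {x : RelCP E J hJ}
    (hx : IsHomogeneous n (x : 𝓜(ℂ, RelCP E J hJ))) : gaugeAverage E J hJ N x = 0 := by
  have hN0 : N ≠ 0 := by omega
  have hζ := isPrimitiveRoot_rootOfUnity hN0
  set ζ := (rootOfUnity N : ℂ)
  have h1 : ∀ i : ℕ, (((rootOfUnity N ^ i) ^ n : Circle) : ℂ) = (ζ ^ n) ^ i := fun i => by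
    rw [← zpow_natCast, ← zpow_mul, mul_comm, zpow_mul, zpow_natCast, Circle.coe_pow,
      Circle.coe_zpow]
  have h2 : ζ ^ n ≠ 1 := by
    rw [Ne, hζ.zpow_eq_one_iff_dvd]
    intro h
    have := Int.natAbs_dvd_natAbs.2 h
    rw [Int.natAbs_natCast] at this
    exact absurd (Nat.le_of_dvd (Int.natAbs_pos.2 hn) this) (by omega)
  have h3 : (ζ ^ n) ^ N = 1 := by
    rw [← zpow_natCast, zpow_comm, zpow_natCast, hζ.pow_eq_one, one_zpow]
  simp only [gaugeAverage, hx.gauge_eq, h1]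
  rw [← Finset.sum_smul, geom_sum_eq h2, h3, sub_self, zero_div, zero_smul, smul_zero]

end GaugeAverage

/-! ### Generation of the core from `k_A(A)` and conjugation by `V`. -/

section CoreStructure

lemma star_pow_mul_pow {M : Type*} [Monoid M] [StarMul M] {v : M} (hv : star v * v = 1) (n : ℕ) :
    star (v ^ n) * v ^ n = 1 := by
  induction n with
  | zero => simp
  | succ n ih =>
    rw [pow_succ, star_mul, mul_assoc, ← mul_assoc (star (v ^ n)), ih, one_mul, hv]

variable {A : Type u} [NonUnitalCStarAlgebra A] [PartialOrder A] [StarOrderedRing A]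
variable (S : ExelSystem A) (J : Set A) (hJ : ∀ a ∈ J, S.M.lact a ∈ S.M.compacts)

/-- The homomorphism `k_A` as a map into the core. -/
def kACore : A →⋆ₙₐ[ℂ] Core S.M J hJ :=
  NonUnitalStarAlgHom.codRestrict (kA S.M J hJ) (core S.M J hJ) fun a z => gauge_kA S.M J hJ z a

lemma coreIncl_kACore (a : A) : coreIncl S.M J hJ (kACore S J hJ a) = kA S.M J hJ a := rfl

/-- Left multiplication by the range projection of `V ^ n` on the core. -/
def projMul (n : ℕ) (c : Core S.M J hJ) : Core S.M J hJ :=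
  (coreRestrict (isom S J hJ ^ n * star (isom S J hJ ^ n)) (by
    have := ((isHomogeneous_isom S J hJ).pow n).mul ((isHomogeneous_isom S J hJ).pow n).star
    rwa [add_neg_cancel] at this)).fst c

lemma coe_projMul (n : ℕ) (c : Core S.M J hJ) :
    (coreIncl S.M J hJ (projMul S J hJ n c) : 𝓜(ℂ, RelCP S.M J hJ))
      = isom S J hJ ^ n * star (isom S J hJ ^ n) * coreIncl S.M J hJ c := by
  rw [mul_coe_eq]
  rfl

lemma coe_iterate_adIsom (n : ℕ) (c : Core S.M J hJ) :
    (coreIncl S.M J hJ ((adIsom S J hJ)^[n] c) : 𝓜(ℂ, RelCP S.M J hJ))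
      = isom S J hJ ^ n * coreIncl S.M J hJ c * star (isom S J hJ ^ n) := by
  induction n with
  | zero => simp
  | succ n ih =>
    rw [Function.iterate_succ_apply', coe_adIsom, ih, pow_succ', star_mul]
    simp only [mul_assoc]

variable (D : NonUnitalStarSubalgebra ℂ (Core S.M J hJ))

/-- The span of the elements `d Vⁿ` and `V⋆ⁿ d` with `d ∈ D`. -/
def isomSpan : Submodule ℂ (RelCP S.M J hJ) := Submodule.span ℂ
  ((Set.range fun p : ℕ × D => (isom S J hJ ^ p.1).snd (coreIncl S.M J hJ p.2)) ∪
    Set.range fun p : ℕ × D => (star (isom S J hJ ^ p.1)).fst (coreIncl S.M J hJ p.2))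

variable {S J hJ D}

lemma mem_isomSpan_of_eq_mul {x : RelCP S.M J hJ} {n : ℕ} {d : Core S.M J hJ} (hd : d ∈ D)
    (h : (x : 𝓜(ℂ, RelCP S.M J hJ)) = coreIncl S.M J hJ d * isom S J hJ ^ n) :
    x ∈ isomSpan S J hJ D := by
  rw [coe_mul_eq, coe_inj] at h
  exact Submodule.subset_span (Or.inl ⟨(n, ⟨d, hd⟩), h.symm⟩)

lemma mem_isomSpan_of_eq_star_mul {x : RelCP S.M J hJ} {n : ℕ} {d : Core S.M J hJ} (hd : d ∈ D)
    (h : (x : 𝓜(ℂ, RelCP S.M J hJ)) = star (isom S J hJ ^ n) * coreIncl S.M J hJ d) :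
    x ∈ isomSpan S J hJ D := by
  rw [mul_coe_eq, coe_inj] at h
  exact Submodule.subset_span (Or.inr ⟨(n, ⟨d, hd⟩), h.symm⟩)

/-- The hypotheses speak of elements `x` equal to a product in the multiplier algebra, so that
identities can be checked there. -/
lemma fst_mem_isomSpan (T : 𝓜(ℂ, RelCP S.M J hJ))
    (h₁ : ∀ (n : ℕ), ∀ d ∈ D, ∀ x : RelCP S.M J hJ,
      (x : 𝓜(ℂ, RelCP S.M J hJ)) = T * (coreIncl S.M J hJ d * isom S J hJ ^ n) →
        x ∈ isomSpan S J hJ D)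
    (h₂ : ∀ (n : ℕ), ∀ d ∈ D, ∀ x : RelCP S.M J hJ,
      (x : 𝓜(ℂ, RelCP S.M J hJ)) = T * (star (isom S J hJ ^ n) * coreIncl S.M J hJ d) →
        x ∈ isomSpan S J hJ D) {f : RelCP S.M J hJ}
    (hf : f ∈ (isomSpan S J hJ D).topologicalClosure) :
    T.fst f ∈ (isomSpan S J hJ D).topologicalClosure := by
  have h : isomSpan S J hJ D ≤ (isomSpan S J hJ D).comap T.fst.toLinearMap := by
    refine Submodule.span_le.2 ?_
    rintro _ (⟨p, rfl⟩ | ⟨p, rfl⟩)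
    · refine h₁ p.1 p.2 p.2.2 _ ?_
      rw [coe_mul_eq, mul_coe_eq]; rfl
    · refine h₂ p.1 p.2 p.2.2 _ ?_
      rw [mul_coe_eq, mul_coe_eq]; rfl
  exact map_mem_closure T.fst.continuous hf fun x hx => h hx

variable (D) in
/-- `D` contains `k_A(A)` and is invariant under `Ad V`, `Ad V⋆` and left multiplication by the
range projections of the powers of `V`. -/
structure IsIsomInvariant : Prop where
  kA_mem : ∀ a, kACore S J hJ a ∈ D
  ad_mem : ∀ d ∈ D, adIsom S J hJ d ∈ D
  compress_mem : ∀ d ∈ D, compress S J hJ d ∈ D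
  proj_mem : ∀ n, ∀ d ∈ D, projMul S J hJ n d ∈ D

namespace IsIsomInvariant

/-- The element `k_A(a)` is moved past `V⋆ⁿ` by `a V⋆ⁿ d = V⋆ⁿ (Vⁿ a V⋆ⁿ) d`, and `Vⁿ a V⋆ⁿ` belongs
to `D` by invariance under `Ad V`. -/
lemma kA_mul_mem (h : IsIsomInvariant D) (a : A) {f : RelCP S.M J hJ}
    (hf : f ∈ (isomSpan S J hJ D).topologicalClosure) :
    kA S.M J hJ a * f ∈ (isomSpan S J hJ D).topologicalClosure := by
  refine fst_mem_isomSpan (kA S.M J hJ a : 𝓜(ℂ, RelCP S.M J hJ)) (fun n d hd x hx => ?_)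
    (fun n d hd x hx => ?_) hf
  · refine mem_isomSpan_of_eq_mul (n := n) (D.mul_mem (h.kA_mem a) hd) ?_
    rw [hx, map_mul, coe_mul, coreIncl_kACore, mul_assoc]
  · have h1 : ∀ n, (adIsom S J hJ)^[n] (kACore S J hJ a) ∈ D := fun n => by
      induction n with
      | zero => exact h.kA_mem a
      | succ n ih => rw [Function.iterate_succ_apply']; exact h.ad_mem _ ih
    refine mem_isomSpan_of_eq_star_mul (n := n) (D.mul_mem (h1 n) hd) ?_
    rw [hx, map_mul, coe_mul, coe_iterate_adIsom, coreIncl_kACore]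
    simp only [← mul_assoc]
    rw [star_pow_mul_pow (star_isom_mul_isom S J hJ), one_mul]

lemma isom_mul_mem (h : IsIsomInvariant D) {f : RelCP S.M J hJ}
    (hf : f ∈ (isomSpan S J hJ D).topologicalClosure) :
    (isom S J hJ).fst f ∈ (isomSpan S J hJ D).topologicalClosure := by
  have hd' : ∀ d n, isom S J hJ * ((coreIncl S.M J hJ d : 𝓜(ℂ, RelCP S.M J hJ)) * isom S J hJ ^ n)
      = coreIncl S.M J hJ (adIsom S J hJ d) * isom S J hJ ^ (n + 1) := fun d n => by
    rw [coe_adIsom, pow_succ']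
    simp only [mul_assoc, star_isom_mul_isom_mul]
  refine fst_mem_isomSpan _ (fun n d hd x hx => ?_) (fun n d hd x hx => ?_) hf
  · exact mem_isomSpan_of_eq_mul (h.ad_mem d hd) (hx.trans (hd' d n))
  -- `V d = (V d V⋆) V` falls in the other family; otherwise `V V⋆^(n+1) d = V⋆ⁿ (V^(n+1) V⋆^(n+1))
  -- d`, which is where invariance under the range projections is needed.
  · rcases n with _ | n
    · refine mem_isomSpan_of_eq_mul (n := 1) (h.ad_mem d hd) ?_
      rw [hx, ← zero_add 1, ← hd', pow_zero, star_one, one_mul, mul_one]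
    · refine mem_isomSpan_of_eq_star_mul (n := n) (h.proj_mem (n + 1) d hd) ?_
      rw [hx, coe_projMul, pow_succ]
      simp only [← mul_assoc]
      rw [star_pow_mul_pow (star_isom_mul_isom S J hJ), one_mul]

lemma star_isom_mul_mem (h : IsIsomInvariant D) {f : RelCP S.M J hJ}
    (hf : f ∈ (isomSpan S J hJ D).topologicalClosure) :
    (star (isom S J hJ)).fst f ∈ (isomSpan S J hJ D).topologicalClosure := by
  have hd' : ∀ d n, star (isom S J hJ) *
      (star (isom S J hJ ^ n) * (coreIncl S.M J hJ d : 𝓜(ℂ, RelCP S.M J hJ)))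
      = star (isom S J hJ ^ (n + 1)) * coreIncl S.M J hJ d := fun d n => by
    rw [pow_succ, star_mul, mul_assoc]
  refine fst_mem_isomSpan _ (fun n d hd x hx => ?_) (fun n d hd x hx => ?_) hf
  -- `V⋆ d` falls in the other family; otherwise `V⋆ d V^(n+1) = (V⋆ d V) Vⁿ`, which needs
  -- invariance under compression.
  · rcases n with _ | n
    · refine mem_isomSpan_of_eq_star_mul (n := 1) hd ?_
      rw [hx, ← zero_add 1, ← hd', pow_zero, star_one, one_mul, mul_one]
    · refine mem_isomSpan_of_eq_mul (n := n) (h.compress_mem d hd) ?_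
      rw [hx, coe_compress, pow_succ']
      simp only [mul_assoc]
  · exact mem_isomSpan_of_eq_star_mul hd (hx.trans (hd' d n))

/-- The elements that, together with their adjoints, multiply the closed span `F` into itself form a
C⋆-algebra. It contains the generators because `k_M(q(a)) = k_A(a) V`, so it is everything. Then `x
k_A(e)` lies in `F`, and its limit is `x`. -/
lemma dense_isomSpan (h : IsIsomInvariant D) (x : RelCP S.M J hJ) :
    x ∈ (isomSpan S J hJ D).topologicalClosure := by
  let F := (isomSpan S J hJ D).topologicalClosure
  have hF : IsClosed (F : Set (RelCP S.M J hJ)) := Submodule.isClosed_topologicalClosure _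
  let N : NonUnitalStarSubalgebra ℂ (RelCP S.M J hJ) :=
    { carrier := {x | (∀ f ∈ F, x * f ∈ F) ∧ ∀ f ∈ F, star x * f ∈ F}
      add_mem' := fun {x y} hx hy => ⟨fun f hf => by
          rw [add_mul]; exact F.add_mem (hx.1 f hf) (hy.1 f hf), fun f hf => by
          rw [star_add, add_mul]; exact F.add_mem (hx.2 f hf) (hy.2 f hf)⟩
      zero_mem' := by simp [F.zero_mem]
      mul_mem' := fun {x y} hx hy => ⟨fun f hf => by
          rw [mul_assoc]; exact hx.1 _ (hy.1 f hf), fun f hf => by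
          rw [star_mul, mul_assoc]; exact hy.2 _ (hx.2 f hf)⟩
      smul_mem' := fun c x hx => ⟨fun f hf => by
          rw [smul_mul_assoc]; exact F.smul_mem c (hx.1 f hf), fun f hf => by
          rw [star_smul, smul_mul_assoc]; exact F.smul_mem _ (hx.2 f hf)⟩
      star_mem' := fun hx => ⟨hx.2, by simpa only [star_star] using hx.1⟩ }
  have hN : (N : Set (RelCP S.M J hJ)) =
      (⋂ f ∈ F, {x | x * f ∈ F}) ∩ ⋂ f ∈ F, {x | star x * f ∈ F} := by
    ext x
    simp only [Set.mem_inter_iff, Set.mem_iInter]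
    rfl
  have hNc : IsClosed (N : Set (RelCP S.M J hJ)) := by
    rw [hN]
    exact (isClosed_biInter fun f _ => hF.preimage (continuous_mul_const f)).inter
      (isClosed_biInter fun f _ => hF.preimage (continuous_star.mul continuous_const))
  have hx : x ∈ N := by
    refine RelCP.mem_of_generators N hNc (fun a => ?_) (fun m => ?_) x
    · refine ⟨fun f hf => h.kA_mul_mem a hf, fun f hf => ?_⟩
      rw [← map_star]
      exact h.kA_mul_mem (star a) hf
    · refine S.denseRange_q.induction_on (p := fun m => (k S.M J hJ).ψ m ∈ N) m
        (hNc.preimage (k S.M J hJ).continuous) fun a => ⟨fun f hf => ?_, fun f hf => ?_⟩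
      · have : (k S.M J hJ).ψ (S.q a) * f = kA S.M J hJ a * (isom S J hJ).fst f := by
          rw [← coe_inj, coe_mul, coe_mul, ← mul_coe_eq, ← kA_mul_isom, mul_assoc]
        rw [this]
        exact h.kA_mul_mem a (h.isom_mul_mem hf)
      · have : star ((k S.M J hJ).ψ (S.q a)) * f
            = (star (isom S J hJ)).fst (kA S.M J hJ (star a) * f) := by
          rw [← coe_inj, coe_mul, coe_star, ← mul_coe_eq, ← kA_mul_isom, coe_mul, star_mul,
            ← coe_star, ← map_star, mul_assoc]
        rw [this]
        exact h.star_isom_mul_mem (h.kA_mul_mem (star a) hf)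
  refine hF.mem_of_tendsto ((nondegenerate_kA S J hJ).tendsto_mul_right x)
    (Eventually.of_forall fun e => hx.1 _ (Submodule.le_topologicalClosure _ ?_))
  refine mem_isomSpan_of_eq_mul (n := 0) (h.kA_mem e) ?_
  rw [pow_zero, mul_one]
  rfl

/-- An invariant C⋆-subalgebra of the core is the whole core. -/
lemma mem_of_isClosed (h : IsIsomInvariant D) (hD : IsClosed (D : Set (Core S.M J hJ)))
    (c : Core S.M J hJ) : c ∈ D := by
  -- Averages of large order annihilate the terms with `n > 0` and fix the term with `n = 0`, which
  -- is already in `D`.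
  have key : ∀ x ∈ isomSpan S J hJ D, ∃ N₀ : ℕ, ∀ N, N₀ ≤ N →
      ∃ d ∈ D, gaugeAverage S.M J hJ N x = coreIncl S.M J hJ d := by
    intro x hx
    induction hx using Submodule.span_induction with
    | mem x hx =>
      rcases hx with ⟨⟨n, d, hd⟩, rfl⟩ | ⟨⟨n, d, hd⟩, rfl⟩
      · refine ⟨n + 1, fun N hN => ?_⟩
        rcases Nat.eq_zero_or_pos n with rfl | hn
        · exact ⟨d, hd, gaugeAverage_coreIncl (by omega) d⟩
        · refine ⟨0, D.zero_mem, ?_⟩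
          rw [map_zero]
          refine gaugeAverage_eq_zero (n := n) (by omega) (by simpa using! hN) ?_
          have := (IsHomogeneous.coreIncl d).mul ((isHomogeneous_isom S J hJ).pow n)
          rwa [zero_add, mul_one, coe_mul_eq] at this
      · refine ⟨n + 1, fun N hN => ?_⟩
        rcases Nat.eq_zero_or_pos n with rfl | hn
        · refine ⟨d, hd, ?_⟩
          have : (star (isom S J hJ ^ 0)).fst (coreIncl S.M J hJ d) = coreIncl S.M J hJ d := by
            rw [pow_zero, star_one]; rfl
          exact (congrArg (gaugeAverage S.M J hJ N) this).trans (gaugeAverage_coreIncl (by omega) d)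
        · refine ⟨0, D.zero_mem, ?_⟩
          rw [map_zero]
          refine gaugeAverage_eq_zero (n := -n) (by omega) (by simpa using! hN) ?_
          have := ((isHomogeneous_isom S J hJ).pow n).star.mul (IsHomogeneous.coreIncl d)
          rwa [add_zero, mul_one, mul_coe_eq] at this
    | zero => exact ⟨0, fun N _ => ⟨0, D.zero_mem, by simp [gaugeAverage]⟩⟩
    | add x y _ _ hx hy =>
      obtain ⟨N₁, h₁⟩ := hx
      obtain ⟨N₂, h₂⟩ := hy
      refine ⟨max N₁ N₂, fun N hN => ?_⟩
      obtain ⟨d₁, hd₁, e₁⟩ := h₁ N ((le_max_left _ _).trans hN)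
      obtain ⟨d₂, hd₂, e₂⟩ := h₂ N ((le_max_right _ _).trans hN)
      exact ⟨d₁ + d₂, D.add_mem hd₁ hd₂, by rw [gaugeAverage_add, e₁, e₂, map_add]⟩
    | smul z x _ hx =>
      obtain ⟨N₁, h₁⟩ := hx
      refine ⟨N₁, fun N hN => ?_⟩
      obtain ⟨d₁, hd₁, e₁⟩ := h₁ N hN
      exact ⟨z • d₁, D.smul_mem z hd₁, by rw [gaugeAverage_smul, e₁, map_smul]⟩
  rw [← SetLike.mem_coe, ← hD.closure_eq, Metric.mem_closure_iff]
  intro ε hε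
  obtain ⟨x, hx, hxc⟩ := Metric.mem_closure_iff.1
    (h.dense_isomSpan (coreIncl S.M J hJ c)) ε hε
  obtain ⟨N₀, hN₀⟩ := key x hx
  -- A nonzero order ensures that averaging fixes `c`. Contractivity then makes the average `d` of
  -- `x` as close to `c` as `x` is.
  obtain ⟨d, hd, hdx⟩ := hN₀ (N₀ + 1) (by omega)
  refine ⟨d, hd, ?_⟩
  have h1 : dist c d = ‖coreIncl S.M J hJ c - coreIncl S.M J hJ d‖ := dist_eq_norm c d
  rw [h1, ← gaugeAverage_coreIncl (Nat.succ_ne_zero N₀) c, ← hdx, ← gaugeAverage_sub]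
  refine (norm_gaugeAverage_le _ _).trans_lt ?_
  rwa [← dist_eq_norm]

end IsIsomInvariant
end CoreStructure

/-! ### From covariant representations of the core to representations of `𝒪(J, M_L)`. -/

section StaceyToCuntzPimsner

variable {A : Type u} [NonUnitalCStarAlgebra A] [PartialOrder A] [StarOrderedRing A]
variable (S : ExelSystem A) (J : Set A) (hJ : ∀ a ∈ J, S.M.lact a ∈ S.M.compacts)

/-- The elements `k_M(m) V⋆` of the core. -/
def kMCore : S.M.carrier →ₗ[ℂ] Core S.M J hJ where
  toFun m := coreMk ((star (isom S J hJ)).snd ((k S.M J hJ).ψ m)) (by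
    rw [← coe_mul_eq]
    exact (IsHomogeneous.kM m).mul (isHomogeneous_isom S J hJ).star)
  map_add' m n := coreIncl_injective _ _ _ <| by simp only [map_add, coreIncl_coreMk]
  map_smul' z m := coreIncl_injective _ _ _ <| by
    simp only [map_smul, coreIncl_coreMk, RingHom.id_apply]

lemma coe_kMCore (m : S.M.carrier) :
    (coreIncl S.M J hJ (kMCore S J hJ m) : 𝓜(ℂ, RelCP S.M J hJ))
      = ((k S.M J hJ).ψ m : RelCP S.M J hJ) * star (isom S J hJ) := by
  rw [coe_mul_eq]
  rfl

variable {S J hJ} {B : Type w} [NonUnitalCStarAlgebra B] {ρ : Core S.M J hJ →⋆ₙₐ[ℂ] B}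
  {W : 𝓜(ℂ, B)}

lemma adIsom_kACore (a : A) :
    adIsom S J hJ (kACore S J hJ a) = kMCore S J hJ (S.q (S.α a)) :=
  core_ext <| by rw [coe_adIsom, coe_kMCore, coreIncl_kACore, isom_mul_kA]

/-- `V k_M(m)⋆ k_M(n) V⋆ = V k_A(⟨m, n⟩) V⋆`. Covariance turns this into the inner product relation
for `m ↦ ρ(k_M(m) V⋆) W`. -/
lemma star_kMCore_mul (m n : S.M.carrier) :
    star (kMCore S J hJ m) * kMCore S J hJ n = adIsom S J hJ (kACore S J hJ (S.M.inner m n)) :=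
  core_ext <| by
    rw [coe_adIsom, coreIncl_kACore, map_mul, map_star, coe_mul, coe_star, coe_kMCore, coe_kMCore,
      star_mul, star_star, ← (k S.M J hJ).star_mul_map, coe_mul, coe_star]
    simp only [mul_assoc]

lemma kMCore_lact (a : A) (m : S.M.carrier) :
    kMCore S J hJ (S.M.lact a m) = kACore S J hJ a * kMCore S J hJ m :=
  core_ext <| by
    rw [map_mul, coe_mul, coe_kMCore, coe_kMCore, coreIncl_kACore, (k S.M J hJ).map_lact, coe_mul,
      mul_assoc]

lemma kMCore_ract (a : A) (m : S.M.carrier) :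
    kMCore S J hJ (S.M.ract a m) = kMCore S J hJ m * adIsom S J hJ (kACore S J hJ a) :=
  core_ext <| by
    rw [map_mul, coe_mul, coe_kMCore, coe_kMCore, coe_adIsom, coreIncl_kACore,
      (k S.M J hJ).map_ract, coe_mul]
    simp only [mul_assoc, star_isom_mul_isom_mul]

namespace IsStaceyCovariant

lemma iterate (h : IsStaceyCovariant (adIsom S J hJ) ρ W) (n : ℕ) (c : Core S.M J hJ) :
    (ρ ((adIsom S J hJ)^[n] c) : 𝓜(ℂ, B)) = W ^ n * ρ c * star (W ^ n) := by
  induction n with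
  | zero => simp
  | succ n ih =>
    rw [Function.iterate_succ_apply', h.covariant, ih, pow_succ', star_mul]
    simp only [mul_assoc]

/-- Covariance speaks only of elements of the core, while `Vⁿ V⋆ⁿ` is a multiplier. It is reached as
a limit: `Vⁿ e V⋆ⁿ c → Vⁿ V⋆ⁿ c` along an approximate unit `e` of the core, and `ρ` turns the left
side into `Wⁿ ρ(e) W⋆ⁿ ρ(c)`, which converges because `ρ` is nondegenerate. -/
lemma map_projMul (h : IsStaceyCovariant (adIsom S J hJ) ρ W) (n : ℕ) (c : Core S.M J hJ) :
    (ρ (projMul S J hJ n c) : 𝓜(ℂ, B)) = W ^ n * star (W ^ n) * ρ c := by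
  rw [mul_coe_eq, coe_inj]
  have h1 : Tendsto (fun e => (adIsom S J hJ)^[n] e * c) (approxUnit (Core S.M J hJ))
      (𝓝 (projMul S J hJ n c)) := by
    have hι : IsInducing (coreIncl S.M J hJ) := ⟨rfl⟩
    refine hι.tendsto_nhds_iff.2 ?_
    have h2 := ((isom S J hJ ^ n).fst.continuous.tendsto _).comp
      ((nondegenerate_coreIncl S J hJ).tendsto_mul
        ((star (isom S J hJ ^ n)).fst (coreIncl S.M J hJ c)))
    refine h2.congr fun e => ?_
    change (isom S J hJ ^ n).fst _ = coreIncl S.M J hJ ((adIsom S J hJ)^[n] e * c)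
    rw [← coe_inj, ← mul_coe_eq, map_mul, coe_mul, coe_mul, coe_iterate_adIsom, ← mul_coe_eq]
    simp only [mul_assoc]
  have h3 := ((continuous_hom ρ).tendsto _).comp h1
  have h4 := ((W ^ n).fst.continuous.tendsto _).comp
    (h.nondegenerate.tendsto_mul ((star (W ^ n)).fst (ρ c)))
  refine tendsto_nhds_unique h3 (h4.congr fun e => ?_)
  rw [Function.comp_apply, Function.comp_apply, ← coe_inj, ← mul_coe_eq, map_mul, coe_mul, coe_mul,
    h.iterate, ← mul_coe_eq]
  simp only [mul_assoc]

lemma map_mul_proj (h : IsStaceyCovariant (adIsom S J hJ) ρ W) {c d : Core S.M J hJ}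
    (hd : (coreIncl S.M J hJ d : 𝓜(ℂ, RelCP S.M J hJ))
      = coreIncl S.M J hJ c * (isom S J hJ * star (isom S J hJ))) :
    (ρ d : 𝓜(ℂ, B)) = ρ c * (W * star W) := by
  have h1 := h.map_projMul 1 (star c)
  have h2 : projMul S J hJ 1 (star c) = star d := core_ext <| by
    rw [coe_projMul, map_star, map_star, coe_star, coe_star, hd, pow_one, star_mul, star_mul,
      star_star]
  rw [h2, map_star, map_star, coe_star, coe_star, pow_one] at h1
  have h3 := congrArg star h1
  rwa [star_star, star_mul, star_mul, star_star, star_star] at h3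

/-- Covariance for `V⋆ c V` reads `W ρ(V⋆ c V) W⋆ = W W⋆ ρ(c) W W⋆`; cancel `W` on both sides. -/
lemma map_compress (h : IsStaceyCovariant (adIsom S J hJ) ρ W) (c : Core S.M J hJ) :
    (ρ (compress S J hJ c) : 𝓜(ℂ, B)) = star W * (ρ c * W) := by
  have h1 := h.covariant (compress S J hJ c)
  have h2 : (ρ (adIsom S J hJ (compress S J hJ c)) : 𝓜(ℂ, B))
      = ρ (projMul S J hJ 1 c) * (W * star W) := by
    refine h.map_mul_proj ?_
    rw [coe_adIsom, coe_compress, coe_projMul, pow_one]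
    simp only [mul_assoc]
  rw [h2, h.map_projMul, pow_one] at h1
  have h3 := congrArg (fun T => star W * T * W) h1
  have hW : ∀ T, star W * (W * T) = T := fun T => by rw [← mul_assoc, h.isometry, one_mul]
  simp only [mul_assoc, hW, h.isometry, mul_one] at h3
  exact h3.symm

/-- The representation of `M_L` defined by a Stacey-covariant representation of the core. -/
def toRep (h : IsStaceyCovariant (adIsom S J hJ) ρ W) : Rep S.M (ρ.comp (kACore S J hJ)) where
  ψ := W.snd.toLinearMap ∘ₗ (ρ : Core S.M J hJ →ₗ[ℂ] B) ∘ₗ kMCore S J hJ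
  map_ract a m := by
    change W.snd (ρ (kMCore S J hJ _)) = W.snd (ρ (kMCore S J hJ m)) * ρ (kACore S J hJ a)
    rw [← coe_inj, coe_mul, ← coe_mul_eq, ← coe_mul_eq, kMCore_ract, map_mul, coe_mul, h.covariant]
    simp only [mul_assoc, h.isometry, mul_one]
  star_mul_map m n := by
    change star (W.snd (ρ (kMCore S J hJ m))) * W.snd (ρ (kMCore S J hJ n))
      = ρ (kACore S J hJ (S.M.inner m n))
    have h1 := h.covariant (kACore S J hJ (S.M.inner m n))
    rw [← star_kMCore_mul, map_mul, map_star, coe_mul] at h1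
    rw [← coe_inj, coe_mul, coe_star, ← coe_mul_eq, ← coe_mul_eq, star_mul, ← coe_star,
      mul_assoc, ← mul_assoc (_ : 𝓜(ℂ, B)) _ W, h1]
    have hW : ∀ T, star W * (W * T) = T := fun T => by rw [← mul_assoc, h.isometry, one_mul]
    simp only [mul_assoc, h.isometry, mul_one, hW]
  map_lact a m := by
    change W.snd (ρ (kMCore S J hJ _)) = ρ (kACore S J hJ a) * W.snd (ρ (kMCore S J hJ m))
    rw [kMCore_lact, map_mul, snd_mul]

lemma coe_toRep (h : IsStaceyCovariant (adIsom S J hJ) ρ W) (m : S.M.carrier) :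
    (h.toRep.ψ m : 𝓜(ℂ, B)) = ρ (kMCore S J hJ m) * W := by
  rw [coe_mul_eq]
  rfl

/-- The map `(k_M, k_A)^{(1)}` takes values in the core, as `k_M(m) k_M(n)⋆` has degree zero.
Following it by `ρ` gives the map required of the new representation, and the coisometry identity on
`J` is carried along. -/
lemma isCoisometric_toRep (h : IsStaceyCovariant (adIsom S J hJ) ρ W) :
    h.toRep.IsCoisometric J hJ := by
  obtain ⟨T, hT, hTJ⟩ := isCoisometric_k (E := S.M) (J := J) (hJ := hJ)
  have hTm : ∀ K, T K ∈ core S.M J hJ :=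
    S.M.compacts_mem (core S.M J hJ).toNonUnitalSubalgebra.toSubmodule
      (inferInstance : IsClosed (core S.M J hJ : Set (RelCP S.M J hJ))) T fun m n => by
      rw [hT]
      intro z
      rw [map_mul, map_star, gauge_kM, gauge_kM, star_smul, smul_mul_smul_comm, mul_comm,
        circle_star_mul, one_smul]
  let T' : S.M.compacts →ₗ[ℂ] Core S.M J hJ :=
    (T : S.M.compacts →ₗ[ℂ] RelCP S.M J hJ).codRestrict
      (core S.M J hJ).toNonUnitalSubalgebra.toSubmodule hTm
  have hT' : ∀ K, coreIncl S.M J hJ (T' K) = T K := fun K => rfl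
  have hc : Continuous T' := continuous_to_core T.continuous
  refine ⟨⟨(ρ : Core S.M J hJ →ₗ[ℂ] B) ∘ₗ T', (continuous_hom ρ).comp hc⟩, fun m n => ?_,
    fun a ha => ?_⟩
  · change ρ (T' _) = _
    have h1 : T' ⟨_, S.M.rankOne_mem m n⟩ = kMCore S J hJ m * star (kMCore S J hJ n) :=
      core_ext <| by
        rw [hT', hT, map_mul, map_star, coe_mul, coe_mul, coe_star, coe_star, coe_kMCore,
          coe_kMCore, star_mul, star_star]
        simp only [mul_assoc, star_isom_mul_isom_mul]
    -- `k_M(m) V⋆` is unchanged by `V V⋆` on the right, so its image is unchanged by `W W⋆`; this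
    -- removes the `W W⋆` that appears in `ψ(m) ψ(n)⋆`.
    have h2 : (ρ (kMCore S J hJ m) : 𝓜(ℂ, B)) = ρ (kMCore S J hJ m) * (W * star W) := by
      refine h.map_mul_proj ?_
      rw [coe_kMCore]
      simp only [mul_assoc, star_isom_mul_isom_mul]
    rw [h1, map_mul, map_star, ← coe_inj, coe_mul, coe_mul, coe_star, coe_star, coe_toRep,
      coe_toRep, star_mul, mul_assoc, ← mul_assoc W, ← mul_assoc, ← h2]
  · change ρ (T' _) = ρ (kACore S J hJ a)
    exact congrArg ρ (coreIncl_injective _ _ _ (hTJ a ha))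

/-- The homomorphism of `𝒪(J, M_L)` integrating a Stacey-covariant representation of the core. -/
lemma exists_integrated (h : IsStaceyCovariant (adIsom S J hJ) ρ W) :
    ∃ θ : RelCP S.M J hJ →⋆ₙₐ[ℂ] B, (∀ c, θ (coreIncl S.M J hJ c) = ρ c) ∧
      (∀ x, θ ((isom S J hJ).fst x) = W.fst (θ x)) ∧
      ∀ x, θ ((isom S J hJ).snd x) = W.snd (θ x) := by
  obtain ⟨θ, hθA, hθM⟩ := h.isCoisometric_toRep.exists_lift
  have hθc := continuous_hom θ
  -- It suffices to take `x = k_A(a) y`, where `V k_A(a) = k_M(q(α(a)))` goes to `ρ(V k_A(a) V⋆) W =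
  -- W ρ(k_A(a))`.
  have hfst : ∀ x, θ ((isom S J hJ).fst x) = W.fst (θ x) := by
    refine (nondegenerate_kA S J hJ).eq_of_left (hθc.comp (isom S J hJ).fst.continuous)
      (W.fst.continuous.comp hθc) fun a y => ?_
    have h1 := isom_mul_kA S J hJ a
    rw [mul_coe_eq, coe_inj] at h1
    change θ ((isom S J hJ).fst _) = W.fst (θ _)
    rw [fst_mul, h1, map_mul, map_mul, hθA, hθM, fst_mul]
    congr 1
    rw [← coe_inj, coe_toRep, ← adIsom_kACore, h.covariant, mul_assoc, h.isometry, mul_one,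
      mul_coe_eq]
    rfl
  have hsnd : ∀ x, θ ((isom S J hJ).snd x) = W.snd (θ x) := by
    refine (nondegenerate_kA S J hJ).eq_of_right (hθc.comp (isom S J hJ).snd.continuous)
      (W.snd.continuous.comp hθc) fun a y => ?_
    have h1 := kA_mul_isom S J hJ a
    rw [coe_mul_eq, coe_inj] at h1
    change θ ((isom S J hJ).snd _) = W.snd (θ _)
    rw [snd_mul, h1, map_mul, map_mul, hθA, hθM, snd_mul]
    congr 1
    have h2 : (ρ (kMCore S J hJ (S.q a)) : 𝓜(ℂ, B)) = ρ (kACore S J hJ a) * (W * star W) := by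
      refine h.map_mul_proj ?_
      rw [coe_kMCore, coreIncl_kACore, ← kA_mul_isom, mul_assoc]
    rw [← coe_inj, coe_toRep, h2, mul_assoc, mul_assoc, h.isometry, mul_one, coe_mul_eq]
    rfl
  have hcoe : ∀ x, (θ ((star (isom S J hJ)).fst x)) = (star W).fst (θ x) := fun x => by
    rw [DoubleCentralizer.star_fst, DoubleCentralizer.star_fst, map_star, hsnd, map_star]
  have hcoe' : ∀ x, (θ ((star (isom S J hJ)).snd x)) = (star W).snd (θ x) := fun x => by
    rw [DoubleCentralizer.star_snd, DoubleCentralizer.star_snd, map_star, hfst, map_star]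
  have hpow : ∀ n x, θ ((isom S J hJ ^ n).fst x) = (W ^ n).fst (θ x) := fun n => by
    induction n with
    | zero => intro x; rfl
    | succ n ih =>
      intro x
      rw [pow_succ, pow_succ]
      change θ ((isom S J hJ ^ n).fst ((isom S J hJ).fst x)) = (W ^ n).fst (W.fst (θ x))
      rw [ih, hfst]
  have hpow' : ∀ n x, θ ((star (isom S J hJ ^ n)).fst x) = (star (W ^ n)).fst (θ x) := fun n => by
    induction n with
    | zero => intro x; rw [pow_zero, pow_zero, star_one, star_one]; rfl
    | succ n ih =>
      intro x
      rw [pow_succ', pow_succ', star_mul, star_mul]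
      change θ ((star (isom S J hJ ^ n)).fst ((star (isom S J hJ)).fst x))
        = (star (W ^ n)).fst ((star W).fst (θ x))
      rw [ih, hcoe]
  refine ⟨θ, fun c => ?_, hfst, hsnd⟩
  -- The set where `θ` and `ρ` agree is a closed invariant subalgebra, since `θ` intertwines `V`
  -- with `W` and `ρ` respects all four operations. Hence it is the whole core.
  let D : NonUnitalStarSubalgebra ℂ (Core S.M J hJ) :=
    NonUnitalStarAlgHom.equalizer (θ.comp (coreIncl S.M J hJ)) ρ
  have hD : ∀ d, d ∈ D ↔ θ (coreIncl S.M J hJ d) = ρ d := fun d => Iff.rfl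
  rw [← hD]
  refine IsIsomInvariant.mem_of_isClosed
    ⟨fun a => hθA a, fun d hd => ?_, fun d hd => ?_, fun n d hd => ?_⟩
    (isClosed_eq (continuous_hom _) (continuous_hom ρ)) c
  · rw [hD] at hd ⊢
    change θ ((isom S J hJ).fst ((star (isom S J hJ)).snd (coreIncl S.M J hJ d))) = _
    rw [hfst, hcoe', hd, ← coe_inj, h.covariant, ← mul_coe_eq, ← coe_mul_eq, mul_assoc]
  · rw [hD] at hd ⊢
    change θ ((star (isom S J hJ)).fst ((isom S J hJ).snd (coreIncl S.M J hJ d))) = _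
    rw [hcoe, hsnd, hd, ← coe_inj, h.map_compress, ← mul_coe_eq, ← coe_mul_eq]
  · rw [hD] at hd ⊢
    change θ ((isom S J hJ ^ n).fst ((star (isom S J hJ ^ n)).fst (coreIncl S.M J hJ d))) = _
    rw [hpow, hpow', hd, ← coe_inj, h.map_projMul, ← mul_coe_eq, ← mul_coe_eq, mul_assoc]

end IsStaceyCovariant

variable (S J hJ)

/-- `𝒪(J, M_L)` is the Stacey crossed product of its core by `Ad V`. -/
lemma exists_staceyCrossedProduct_equiv :
    ∃ Φ : StaceyCrossedProduct (adIsom S J hJ) ≃⋆ₐ[ℂ] RelCP S.M J hJ,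
      (∀ c, Φ (staceyI (adIsom S J hJ) c) = coreIncl S.M J hJ c) ∧
      ∀ x, Φ ((staceyV (adIsom S J hJ)).fst x) = (isom S J hJ).fst (Φ x) ∧
        Φ ((staceyV (adIsom S J hJ)).snd x) = (isom S J hJ).snd (Φ x) := by
  choose θ hθc hθf hθs using fun r : StaceyRep (adIsom S J hJ) => r.isStacey.exists_integrated
  let β := adIsom S J hJ
  -- The pair `(id, V)` is itself a coordinate of the product, because the core and `𝒪(J, M_L)` live
  -- in the same universe. Evaluation at it is the isomorphism, and `Ψ`, assembled from the maps `θ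
  -- r`, is its inverse.
  let r₀ : StaceyRep β := ⟨RelCP S.M J hJ, coreIncl S.M J hJ, isom S J hJ,
    isStaceyCovariant_coreIncl S J hJ⟩
  let Ψ : RelCP S.M J hJ →⋆ₙₐ[ℂ] StaceyProduct β :=
    { toFun := fun x => ⟨fun r => θ r x, memℓp_infty ⟨‖x‖, by
        rintro _ ⟨r, rfl⟩
        exact NonUnitalStarAlgHom.norm_apply_le (θ r) x⟩⟩
      map_smul' := fun c a => Subtype.ext <| funext fun r => map_smul (θ r) c a
      map_zero' := Subtype.ext <| funext fun r => map_zero (θ r)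
      map_add' := fun a b => Subtype.ext <| funext fun r => map_add (θ r) a b
      map_mul' := fun a b => Subtype.ext <| funext fun r => map_mul (θ r) a b
      map_star' := fun a => Subtype.ext <| funext fun r => map_star (θ r) a }
  have hΨc : ∀ c, Ψ (coreIncl S.M J hJ c) = staceyProdA β c := fun c =>
    Subtype.ext <| funext fun r => hθc r c
  have hΨf : ∀ x, Ψ ((isom S J hJ).fst x) = (staceyProdV β).fst (Ψ x) := fun x =>
    Subtype.ext <| funext fun r => hθf r x
  have hΨs : ∀ x, Ψ ((isom S J hJ).snd x) = (staceyProdV β).snd (Ψ x) := fun x =>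
    Subtype.ext <| funext fun r => hθs r x
  -- Generators suffice: `Ψ` sends `k_A(a)` to `i_C(k_A(a))` and `k_M(q(a)) = k_A(a) V` to that
  -- element times `v`.
  have hΨm : ∀ x, Ψ x ∈ staceyCrossedProduct β := by
    intro x
    refine NonUnitalStarAlgebra.mem_sInf.2 fun D hD => ?_
    have hcl : IsClosed ((D.comap Ψ : NonUnitalStarSubalgebra ℂ (RelCP S.M J hJ)) :
        Set (RelCP S.M J hJ)) := hD.1.preimage (continuous_hom Ψ)
    have hkA : ∀ a, Ψ (kA S.M J hJ a) ∈ D := fun a => by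
      rw [← coreIncl_kACore, hΨc]
      exact hD.2.1 _
    refine RelCP.mem_of_generators (D.comap Ψ) hcl hkA (fun m => ?_) x
    refine S.denseRange_q.induction_on (p := fun m => (k S.M J hJ).ψ m ∈ D.comap Ψ) m
      (hcl.preimage (k S.M J hJ).continuous) fun a => ?_
    have h1 := kA_mul_isom S J hJ a
    rw [coe_mul_eq, coe_inj] at h1
    change Ψ _ ∈ D
    rw [← h1, hΨs]
    exact (hD.2.2 _ (hkA a)).2
  have hθ₀ : θ r₀ = NonUnitalStarAlgHom.id ℂ (RelCP S.M J hJ) := by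
    refine RelCP.hom_ext (fun a => hθc r₀ (kACore S J hJ a)) fun m => ?_
    refine S.denseRange_q.induction_on
      (p := fun m => θ r₀ ((k S.M J hJ).ψ m) = (k S.M J hJ).ψ m) m
      (isClosed_eq ((continuous_hom (θ r₀)).comp (k S.M J hJ).continuous)
        (k S.M J hJ).continuous) fun a => ?_
    have h1 := kA_mul_isom S J hJ a
    rw [coe_mul_eq, coe_inj] at h1
    rw [← h1]
    exact (hθs r₀ _).trans (congrArg (isom S J hJ).snd (hθc r₀ (kACore S J hJ a)))
  let ev : StaceyProduct β →⋆ₙₐ[ℂ] RelCP S.M J hJ :=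
    { toFun := fun x => (x : ∀ r : StaceyRep β, r.B) r₀
      map_smul' := fun _ _ => rfl
      map_zero' := rfl
      map_add' := fun _ _ => rfl
      map_mul' := fun _ _ => rfl
      map_star' := fun _ => rfl }
  -- The fixed points of `Ψ ∘ ev` form one of the subalgebras whose intersection is the crossed
  -- product.
  have hev : ∀ x ∈ staceyCrossedProduct β, Ψ (ev x) = x := by
    intro x hx
    let D : NonUnitalStarSubalgebra ℂ (StaceyProduct β) :=
      NonUnitalStarAlgHom.equalizer (Ψ.comp ev) (NonUnitalStarAlgHom.id ℂ _)
    refine NonUnitalStarAlgebra.mem_sInf.1 hx D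
      ⟨isClosed_eq (continuous_hom _) continuous_id, hΨc, fun y hy => ?_⟩
    have hy : Ψ (ev y) = y := hy
    exact ⟨(hΨf (ev y)).trans (congrArg _ hy), (hΨs (ev y)).trans (congrArg _ hy)⟩
  refine ⟨
    { toFun := fun x => ev x.1
      invFun := fun x => ⟨Ψ x, hΨm x⟩
      left_inv := fun x => Subtype.ext (hev x.1 x.2)
      right_inv := fun x => DFunLike.congr_fun hθ₀ x
      map_mul' := fun _ _ => rfl
      map_add' := fun _ _ => rfl
      map_star' := fun _ => rfl
      map_smul' := fun _ _ => rfl }, fun c => rfl, fun x => ⟨rfl, rfl⟩⟩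

end StaceyToCuntzPimsner

end ExelStacey

end

theorem theorem3p1 {A : Type u} [NonUnitalCStarAlgebra A] [PartialOrder A] [StarOrderedRing A]
    (S : ExelSystem A) (J : TwoSidedIdeal A) (hJ_closed : IsClosed (J : Set A))
    (hJ : ∀ a ∈ (J : Set A), S.M.lact a ∈ S.M.compacts) :
    ∃ V : 𝓜(ℂ, RelCP S.M J hJ),
      (star V * V = 1 ∧
        ∀ a : A, ((k S.M J hJ).ψ (S.q a) : 𝓜(ℂ, RelCP S.M J hJ)) = kA S.M J hJ a * V) ∧
      (∀ W : 𝓜(ℂ, RelCP S.M J hJ),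
        (star W * W = 1 ∧
          ∀ a : A, ((k S.M J hJ).ψ (S.q a) : 𝓜(ℂ, RelCP S.M J hJ)) = kA S.M J hJ a * W) →
        W = V) ∧
      ∃ α' : Core S.M J hJ →⋆ₙₐ[ℂ] Core S.M J hJ,
        (∀ c : Core S.M J hJ,
          (coreIncl S.M J hJ (α' c) : 𝓜(ℂ, RelCP S.M J hJ)) =
            V * (coreIncl S.M J hJ c : 𝓜(ℂ, RelCP S.M J hJ)) * star V) ∧
        (∀ (i : ℕ) (a b : A) (m n : (S.M.pow i).carrier), ∃ c : Core S.M J hJ,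
          coreIncl S.M J hJ c =
            ((k S.M J hJ).pow i).ψ ((S.M.pow i).lact a m) *
              star (((k S.M J hJ).pow i).ψ ((S.M.pow i).lact b n)) ∧
          coreIncl S.M J hJ (α' c) =
            ((k S.M J hJ).pow (i + 1)).ψ (S.M.tmul (S.M.pow i) (S.q (S.α a)) m) *
              star (((k S.M J hJ).pow (i + 1)).ψ (S.M.tmul (S.M.pow i) (S.q (S.α b)) n))) ∧
        (∃ αbar : 𝓜(ℂ, Core S.M J hJ) →⋆ₙₐ[ℂ] 𝓜(ℂ, Core S.M J hJ),
          IsStrictExtension α' αbar ∧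
          (∀ c : Core S.M J hJ,
            coreIncl S.M J hJ ((αbar 1).fst c) = (V * star V).fst (coreIncl S.M J hJ c) ∧
            coreIncl S.M J hJ ((αbar 1).snd c) = (V * star V).snd (coreIncl S.M J hJ c)) ∧
          Set.range α' = Set.range fun c => (αbar 1).fst ((αbar 1).snd c)) ∧
        Function.Injective α' ∧
        IsStaceyCovariant α' (coreIncl S.M J hJ) V ∧
        ∃ Φ : StaceyCrossedProduct α' ≃⋆ₐ[ℂ] RelCP S.M J hJ,
          (∀ c : Core S.M J hJ, Φ (staceyI α' c) = coreIncl S.M J hJ c) ∧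
          ∀ x : StaceyCrossedProduct α',
            Φ ((staceyV α').fst x) = V.fst (Φ x) ∧ Φ ((staceyV α').snd x) = V.snd (Φ x) := by

  refine ⟨isom S J hJ, ⟨star_isom_mul_isom S J hJ, fun a => (kA_mul_isom S J hJ a).symm⟩,
    fun W hW => eq_isom S J hJ hW.2, adIsom S J hJ, coe_adIsom S J hJ, adIsom_spanning S J hJ,
    ⟨adIsomBar S J hJ, isStrictExtension_adIsomBar S J hJ, fun c => ⟨adIsomBar_one_fst S J hJ c,
      adIsomBar_one_snd S J hJ c⟩, range_adIsom S J hJ⟩, adIsom_injective S J hJ,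
    isStaceyCovariant_coreIncl S J hJ, exists_staceyCrossedProduct_equiv S J hJ⟩
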